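/- **Setting.** For each $n\ge 1$ let $y=f+\epsilon\in\mathbb R^n$ with $f=X\beta$, where $X\in\mathbb R^{n\times p_n}$ is nonrandom with full column rank, $1\le p_n\le n$. The noise variables $\epsilon_1,\dots,\epsilon_n$ are i.i.d. sub-Gaussian with a sub-Gaussian parameter not depending on $n$, with $\mathbb E\epsilon_i=0$ and $\mathbb E\epsilon_i^2=\sigma^2>0$, $\sigma$ fixed. Let $\phi_1,\dots,\phi_{p_n}$ be an orthonormal basis of the column space of $X$ and put $\theta_j=\phi_j^\top f/\sqrt n$. Let $|\theta|_{(1)}\ge\dots\ge|\theta|_{(p_n)}$ be the decreasing rearrangement of $|\theta_1|,\dots,|\theta_{p_n}|$. For $I\subseteq\{1,\dots,p_n\}$ let $P_I$ be the least squares projection onto $\mathrm{span}\{\phi_j:j\in I\}$. For a finite family $\mathcal M=\{I_1,\dots,I_M\}$ of candidate models and $w$ in the unit simplex $\mathcal W_M$, let $P_w=\sum_m w_mP_{I_m}$, $L_n(w|\mathcal M,f)=n^{-1}\|P_wy-f\|^2$, $R_n(w|\mathcal M,f)=\mathbb E L_n(w|\mathcal M,f)=n^{-1}\|f-P_wf\|^2+n^{-1}\sigma^2\operatorname{tr}(P_w^\top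 P_w)$ and $R_n(w^*|\mathcal M,f)=\min_{w\in\mathcal W_M}R_n(w|\mathcal M,f)$. Let $\mathcal M_A=\{\{1,\dots,j\}:1\le j\le p_n\}$ and let $\mathcal M_{AS}$ be the family of all subsets of $\{1,\dots,p_n\}$; $R_n(w^*|\mathcal M_{AS},f)$ is the ideal MA risk. Given an estimator $\hat\sigma^2$ of $\sigma^2$, an MMA weight vector $\hat w|\mathcal M$ is a (measurable) minimizer over $\mathcal W_M$ of $n^{-1}\|y-P_wy\|^2+2n^{-1}\hat\sigma^2\sum_m|I_m|w_m$. Its risk $Q_n(\hat w|\mathcal M,f)$ is either $\mathbb E L_n(\hat w|\mathcal M,f)$ or $n^{-1}\mathbb E\|f-P_{\hat w}f\|^2+n^{-1}\sigma^2\mathbb E\operatorname{tr}(P_{\hat w}^\top P_{\hat w})$. The MMA estimator achieves the ideal AOP if, for both choices of $Q_n$, $Q_n(\hat w|\mathcal M,f)\le[1+o(1)]R_n(w^*|\mathcal M_{AS},f)$ as $n\to\infty$. For nested models $\{1,\dots,k_m\}$, $0=k_0<k_1<\dots<k_M\le p_n$, let $S_j=\sum_{l=k_j+1}^{k_M}\theta_l^2$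 for $0\le j\le M$, $M'=\min\{1\le j\le M:S_j=0\}$ and $$\psi(\mathcal M)=\Big[M\wedge\Big(1+\sum_{j=1}^{M-1}\frac{k_{j+1}-k_j}{4k_j}+\sum_{j=1}^{M'-1}\frac{S_{j-1}-S_j}{4S_j}\Big)\Big](1+\log M)^2 .$$ For fixed $t_1,t_2>0$ and $n\ge2$ let $\zeta_n=t_1/(\log n)^{t_2}$. The family $\mathcal M_{G1}$ consists of the nested models with sizes $k_1=\lceil\zeta_n^{-1}\rceil$, $k_m=k_{m-1}+\lfloor k_1(1+\zeta_n)^{m-1}\rfloor$ for $2\le m\le M-1$, and $k_M=p_n$, where $M$ is the least $m\ge1$ with $k_1+\sum_{j=2}^m\lfloor k_1(1+\zeta_n)^{j-1}\rfloor\ge p_n$ (with $k_1$ in this sum equal to $\lceil\zeta_n^{-1}\rceil$; if $M=1$, the only model has size $k_1=p_n$). **Theorem.** Suppose $\limsup_n n^{-1}\|f\|^2<\infty$ and that the coefficients are weakly ordered: there are indices $0=d_0<d_1<\dots<d_{D_n}=p_n$ (depending on $n$) and $z_n\to0$ with $\max_{1\le l\le D_n-1}(d_{l+1}-d_l)/(d_l-d_{l-1})\le1+z_n$,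 such that for each $1\le l\le D_n$ the vector $(|\theta_{d_{l-1}+1}|,\dots,|\theta_{d_l}|)$ is a permutation of $(|\theta|_{(d_{l-1}+1)},\dots,|\theta|_{(d_l)})$. 1. If $d_1=o[nR_n(w^*|\mathcal M_{AS},f)]$, then $R_n(w^*|\mathcal M_A,f)=[1+o(1)]R_n(w^*|\mathcal M_{AS},f)$. 2. Suppose moreover that the variance estimator satisfies $p_n\,\mathbb E(\hat\sigma^2-\sigma^2)^2=o[nR_n(w^*|\mathcal M_{AS},f)]$. If $d_1\vee\psi(\mathcal M_A)=o[nR_n(w^*|\mathcal M_{AS},f)]$, then the MMA estimator based on $\mathcal M_A$ achieves the ideal AOP. If $d_1\vee k_1\vee\psi(\mathcal M_{G1})=o[nR_n(w^*|\mathcal M_{AS},f)]$, with $k_1$ the size of the smallest model in $\mathcal M_{G1}$, then the MMA estimator based on $\mathcal M_{G1}$ achieves the ideal AOP. -/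

import Mathlib

open MeasureTheory ProbabilityTheory Filter Topology
open scoped NNReal Matrix

noncomputable section

namespace ModelAvg

/-! ### Candidate models and model averaging (MA) estimators -/

/-- The columns of the regressor matrix `Z` with index in `I`. -/
def subDesign {n p : ℕ} (Z : Matrix (Fin n) (Fin p) ℝ) (I : Finset (Fin p)) :
    Matrix (Fin n) I ℝ :=
  Z.submatrix id (fun j : I => (j : Fin p))

/-- Least squares projection matrix `Z_I (Z_Iᵀ Z_I)⁻¹ Z_Iᵀ` of the candidate model `I`. -/
def hatMatrix {n p : ℕ} (Z : Matrix (Fin n) (Fin p) ℝ) (I : Finset (Fin p)) :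
    Matrix (Fin n) (Fin n) ℝ :=
  subDesign Z I * ((subDesign Z I)ᵀ * subDesign Z I)⁻¹ * (subDesign Z I)ᵀ

/-- `P_w = ∑ₘ wₘ Pₘ` for the candidate models `𝓜 m`, `m : ι`. -/
def avgHatMatrix {n p : ℕ} {ι : Type*} [Fintype ι] (Z : Matrix (Fin n) (Fin p) ℝ)
    (𝓜 : ι → Finset (Fin p)) (w : ι → ℝ) : Matrix (Fin n) (Fin n) ℝ :=
  ∑ m, w m • hatMatrix Z (𝓜 m)

/-- Squared Euclidean norm. -/
def sqNorm {n : ℕ} (v : Fin n → ℝ) : ℝ := ∑ i, v i ^ 2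

/-- Normalized squared loss `n⁻¹ ‖g - f‖²`. -/
def loss {n : ℕ} (g f : Fin n → ℝ) : ℝ := sqNorm (g - f) / n

/-- The response vector `y = f + ε`. -/
def response {Ω : Type*} {n : ℕ} (f : Fin n → ℝ) (ε : Fin n → Ω → ℝ) (ω : Ω) : Fin n → ℝ :=
  fun i => f i + ε i ω

/-- The loss of the MA estimator with (possibly data-dependent) weight `w` at the outcome `ω`. -/
def maLoss {Ω : Type*} {n p : ℕ} {ι : Type*} [Fintype ι] (Z : Matrix (Fin n) (Fin p) ℝ)
    (𝓜 : ι → Finset (Fin p)) (f : Fin n → ℝ) (ε : Fin n → Ω → ℝ) (w : ι → ℝ) (ω : Ω) : ℝ :=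
  loss (avgHatMatrix Z 𝓜 w *ᵥ response f ε ω) f

/-- MA risk at a non-random weight vector: the expected loss. -/
def maRisk {Ω : Type*} [MeasurableSpace Ω] (μ : Measure Ω) {n p : ℕ} {ι : Type*} [Fintype ι]
    (Z : Matrix (Fin n) (Fin p) ℝ) (𝓜 : ι → Finset (Fin p)) (f : Fin n → ℝ)
    (ε : Fin n → Ω → ℝ) (w : ι → ℝ) : ℝ :=
  ∫ ω, maLoss Z 𝓜 f ε w ω ∂μ

/-- Optimal MA risk: the minimum of the MA risk over the unit simplex. -/
def optRisk {Ω : Type*} [MeasurableSpace Ω] (μ : Measure Ω) {n p : ℕ} {ι : Type*} [Fintype ι]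
    (Z : Matrix (Fin n) (Fin p) ℝ) (𝓜 : ι → Finset (Fin p)) (f : Fin n → ℝ)
    (ε : Fin n → Ω → ℝ) : ℝ :=
  ⨅ w : stdSimplex ℝ ι, maRisk μ Z 𝓜 f ε w

/-- The bias-variance expression `n⁻¹ ‖f - P_w f‖² + n⁻¹ σ² tr (P_wᵀ P_w)`, into which a random
weight vector can be plugged. -/
def plugInRisk {n p : ℕ} {ι : Type*} [Fintype ι] (Z : Matrix (Fin n) (Fin p) ℝ)
    (𝓜 : ι → Finset (Fin p)) (f : Fin n → ℝ) (σ : ℝ) (w : ι → ℝ) : ℝ :=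
  sqNorm (f - avgHatMatrix Z 𝓜 w *ᵥ f) / n
    + σ ^ 2 / n * ((avgHatMatrix Z 𝓜 w)ᵀ * avgHatMatrix Z 𝓜 w).trace

/-- Mallows model averaging criterion `n⁻¹ ‖y - P_w y‖² + 2 n⁻¹ s kᵀ w`, with `s` the value of the
variance estimator and `kₘ` the size of the `m`-th model. -/
def mmaCriterion {n p : ℕ} {ι : Type*} [Fintype ι] (Z : Matrix (Fin n) (Fin p) ℝ)
    (𝓜 : ι → Finset (Fin p)) (y : Fin n → ℝ) (s : ℝ) (w : ι → ℝ) : ℝ :=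
  sqNorm (y - avgHatMatrix Z 𝓜 w *ᵥ y) / n + 2 * s / n * ∑ m, ((𝓜 m).card : ℝ) * w m

/-- `w` is an MMA weight vector: a random vector which at every outcome minimizes the criterion
over the unit simplex. -/
structure IsMMAWeight {Ω : Type*} [MeasurableSpace Ω] {n p : ℕ} {ι : Type*} [Fintype ι]
    (Z : Matrix (Fin n) (Fin p) ℝ) (𝓜 : ι → Finset (Fin p)) (f : Fin n → ℝ)
    (ε : Fin n → Ω → ℝ) (s : Ω → ℝ) (w : Ω → ι → ℝ) : Prop where
  measurable : Measurable w
  mem_simplex : ∀ ω, w ω ∈ stdSimplex ℝ ι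
  isMinOn : ∀ ω, IsMinOn (mmaCriterion Z 𝓜 (response f ε ω) (s ω)) (stdSimplex ℝ ι) (w ω)

/-! ### Families of candidate models

Regressors are numbered `0, …, p - 1` by `Fin p`; the `m`-th model size is `k m` for `1 ≤ m ≤ M`,
and `k 0 = 0`. -/

/-- The `M` nested models consisting of the first `k 1, …, k M` regressors. -/
def nestedModels (p M : ℕ) (k : ℕ → ℕ) : Fin M → Finset (Fin p) :=
  fun m => Finset.univ.filter (fun j : Fin p => (j : ℕ) < k ((m : ℕ) + 1))

/-- All nested models, with sizes `1, …, p`. -/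
def allNested (p : ℕ) : Fin p → Finset (Fin p) := nestedModels p p id

/-- All subsets of the regressors. -/
def allSubsets (p : ℕ) : Finset (Fin p) → Finset (Fin p) := id

/-- `ζₙ = t₁ / (log n) ^ t₂`. -/
def groupRate (t₁ t₂ : ℝ) (n : ℕ) : ℝ := t₁ / Real.log n ^ t₂

/-- `k₁ + ∑_{j=2}^m ⌊k₁ (1 + ζₙ)^(j-1)⌋` with `k₁ = ⌈ζₙ⁻¹⌉`. -/
def groupSum (t₁ t₂ : ℝ) (n m : ℕ) : ℕ :=
  ⌈(groupRate t₁ t₂ n)⁻¹⌉₊ + ∑ j ∈ Finset.Icc 2 m,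
    ⌊(⌈(groupRate t₁ t₂ n)⁻¹⌉₊ : ℝ) * (1 + groupRate t₁ t₂ n) ^ (j - 1)⌋₊

/-- Number of weakly geometrically increasing groups: the least `m ≥ 1` at which the groups exhaust
the `p` regressors. -/
def groupCount (t₁ t₂ : ℝ) (n p : ℕ) : ℕ := sInf {m : ℕ | 1 ≤ m ∧ p ≤ groupSum t₁ t₂ n m}

/-- Model sizes of the weakly geometrically increasing groups; the last one is `p`. -/
def groupSize (t₁ t₂ : ℝ) (n p m : ℕ) : ℕ :=
  if m = 0 then 0 else if m < groupCount t₁ t₂ n p then groupSum t₁ t₂ n m else p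

/-- The nested models with weakly geometrically increasing groups. -/
def groupedModels (t₁ t₂ : ℝ) (n p : ℕ) : Fin (groupCount t₁ t₂ n p) → Finset (Fin p) :=
  nestedModels p (groupCount t₁ t₂ n p) (groupSize t₁ t₂ n p)

/-! ### Transformed coefficients, their order, and the complexity `ψ` -/

/-- The columns of `Φ` are an orthonormal basis of the column space of `X`. -/
structure IsOrthonormalBasisOfColumns {n p : ℕ} (Φ X : Matrix (Fin n) (Fin p) ℝ) : Prop where
  orthonormal : Φᵀ * Φ = 1
  span_eq : Submodule.span ℝ (Set.range Φ.col) = Submodule.span ℝ (Set.range X.col)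

/-- Transformed coefficients `θⱼ = φⱼᵀ f / √n`. -/
def transCoef {n p : ℕ} (Φ : Matrix (Fin n) (Fin p) ℝ) (f : Fin n → ℝ) : Fin p → ℝ :=
  fun j => (Φᵀ *ᵥ f) j / Real.sqrt n

/-- Decreasing rearrangement of `|θ₁|, …, |θ_p|`. -/
def decrRearr {p : ℕ} (θ : Fin p → ℝ) : Fin p → ℝ :=
  fun j => |θ (Tuple.sort (fun i => -|θ i|) j)|

/-- Weakly ordered coefficients: `0 = d 0 < d 1 < ⋯ < d D = p`, the ratios of successive block
lengths are at most `1 + z`, and in each block the absolute coefficients are a permutation of the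
decreasing rearrangement's entries at the same positions. -/
structure WeaklyOrdered {p : ℕ} (θ : Fin p → ℝ) (D : ℕ) (d : ℕ → ℕ) (z : ℝ) : Prop where
  pos : 1 ≤ D
  zero : d 0 = 0
  lt : ∀ l < D, d l < d (l + 1)
  last : d D = p
  ratio : ∀ l, 1 ≤ l → l + 1 ≤ D →
    ((d (l + 1) : ℝ) - d l) / ((d l : ℝ) - d (l - 1)) ≤ 1 + z
  perm : ∀ l, 1 ≤ l → l ≤ D →
    ∃ π : Equiv.Perm {j : Fin p // d (l - 1) ≤ (j : ℕ) ∧ (j : ℕ) < d l},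
      ∀ j, |θ j.1| = decrRearr θ (π j).1

/-- `S_j = ∑_{l = k_j + 1}^{k_M} θ_l²`. -/
def tailSum {p : ℕ} (θ : Fin p → ℝ) (M : ℕ) (k : ℕ → ℕ) (j : ℕ) : ℝ :=
  ∑ l ∈ Finset.univ.filter (fun l : Fin p => k j ≤ (l : ℕ) ∧ (l : ℕ) < k M), θ l ^ 2

/-- `M' = min {1 ≤ j ≤ M : S_j = 0}`. -/
def tailIndex {p : ℕ} (θ : Fin p → ℝ) (M : ℕ) (k : ℕ → ℕ) : ℕ :=
  sInf {j : ℕ | 1 ≤ j ∧ j ≤ M ∧ tailSum θ M k j = 0}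

/-- The complexity `ψ` of the nested models with sizes `k 1, …, k M`. -/
def psi {p : ℕ} (θ : Fin p → ℝ) (M : ℕ) (k : ℕ → ℕ) : ℝ :=
  min (M : ℝ)
      (1 + ∑ j ∈ Finset.Icc 1 (M - 1), ((k (j + 1) : ℝ) - k j) / (4 * k j)
        + ∑ j ∈ Finset.Icc 1 (tailIndex θ M k - 1),
            (tailSum θ M k (j - 1) - tailSum θ M k j) / (4 * tailSum θ M k j))
    * (1 + Real.log M) ^ 2

/-! ### Noise and asymptotic optimality -/

/-- I.i.d. noise with mean zero, variance `σ²` and sub-Gaussian variance proxy `η`. -/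
structure IsSubgaussianNoise {Ω : Type*} [MeasurableSpace Ω] (μ : Measure Ω) {n : ℕ}
    (ε : Fin n → Ω → ℝ) (σ : ℝ) (η : ℝ≥0) : Prop where
  measurable : ∀ i, Measurable (ε i)
  indep : iIndepFun ε μ
  identDistrib : ∀ i j, IdentDistrib (ε i) (ε j) μ μ
  mean : ∀ i, ∫ ω, ε i ω ∂μ = 0
  variance : ∀ i, ∫ ω, ε i ω ^ 2 ∂μ = σ ^ 2
  subgaussian : ∀ i, HasSubgaussianMGF (ε i) η μ

/-- `Q n ≤ (1 + o(1)) R n` as `n → ∞`. -/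
def AsympLE (Q R : ℕ → ℝ) : Prop :=
  ∃ u : ℕ → ℝ, Tendsto u atTop (𝓝 0) ∧ ∀ᶠ n in atTop, Q n ≤ (1 + u n) * R n

/-- The MA estimators with random weights `w n` have finite risks which are at most `(1 + o(1))`
times the ideal MA risk over all subsets, both for the expected loss and for the expectation of the
plug-in risk. -/
def AchievesIdealAOP {Ω : Type*} [MeasurableSpace Ω] (μ : Measure Ω) {p M : ℕ → ℕ}
    (Z : ∀ n, Matrix (Fin n) (Fin (p n)) ℝ) (𝓜 : ∀ n, Fin (M n) → Finset (Fin (p n)))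
    (f : ∀ n, Fin n → ℝ) (ε : ∀ n, Fin n → Ω → ℝ) (σ : ℝ) (w : ∀ n, Ω → Fin (M n) → ℝ) : Prop :=
  (∀ᶠ n in atTop, Integrable (fun ω => maLoss (Z n) (𝓜 n) (f n) (ε n) (w n ω) ω) μ ∧
    Integrable (fun ω => plugInRisk (Z n) (𝓜 n) (f n) σ (w n ω)) μ) ∧
  AsympLE (fun n => ∫ ω, maLoss (Z n) (𝓜 n) (f n) (ε n) (w n ω) ω ∂μ)
    (fun n => optRisk μ (Z n) (allSubsets (p n)) (f n) (ε n)) ∧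
  AsympLE (fun n => ∫ ω, plugInRisk (Z n) (𝓜 n) (f n) σ (w n ω) ∂μ)
    (fun n => optRisk μ (Z n) (allSubsets (p n)) (f n) (ε n))

end ModelAvg

end

open ModelAvg Asymptotics

/-! In the orthonormal coordinates `Φᵀ f` and `Φᵀ ε` every averaged estimator is a coordinatewise
shrinkage: coefficient `j` is multiplied by the total weight `γ j` of the models containing it. The
risk is then `∑ ((1 - γ j)² θ j² + σ² γ j²)` up to the factor `1/n`. Minimizing each summand
separately bounds the risk over any family from below by `idealSeqRisk`, the sum of `θ j² σ² / (θ j²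
+ σ²)`. Two facts remain.

Approximation (`exists_blockwise_shrinkage`, `exists_grouped_weight`). Nested models realize exactly
the groupwise constant, nonincreasing shrinkage vectors that start at 1. On each block after the
first, use the optimal factor for the mean square of the block. Weak ordering makes these factors
decrease, and it bounds the mean square of a block by every squared coefficient of the preceding
block. The risk on a block is therefore at most its length ratio, `1 + o(1)`, times the ideal risk
of the block before it. The first block has no predecessor and costs `σ² d₁`. The same shift by one
block passes from a monotone vector to one constant on the model groups, at the cost `σ² k₁`.

Oracle inequality (`nested_oracle_inequality`). Both loss minus risk and the noise in the Mallows
criterion are combinations of sums `∑ c j (e j² - σ²)` and `∑ c j θ j e j`, where `c` is monotone in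
the group index but depends on the data. The dyadic inequality `exists_remainder_antitone` bounds
such a sum, for all monotone weights at once, by `δ` times the matching part of the risk plus `T /
(4δ)`. Here `T` does not depend on the weights, and its mean is at most a constant times `(1 + log
M)²` times a sum of relative increments, of the model sizes for the first type and of the tail sums
`S_j` for the second. These sums are what `ψ` measures. The error of the variance estimator is
absorbed by Young's inequality at the price `p (σ̂² - σ²)²`.

Every remainder is `o(n R)` by assumption, so letting `δ` be small gives the factor `1 + o(1)`. -/

open ModelAvg Asymptotics

/-! ### A dyadic maximal inequality for monotone weights -/

namespace ModelAvg

/-- The normalized squared increments of `N` over the left halves of the dyadic intervals. -/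
noncomputable def dyadicEnergy : ℕ → (ℕ → ℝ) → (ℕ → ℝ) → ℝ
  | 0, N, b => (N 1 - N 0) ^ 2 / b 1
  | r + 1, N, b => ∑ i ∈ Finset.range (2 ^ r), (N (2 * i + 1) - N (2 * i)) ^ 2 / b (2 * i + 1)
      + dyadicEnergy r (fun i => N (2 * i)) (fun i => b (2 * i))

theorem sum_range_two_mul (F : ℕ → ℝ) (n : ℕ) :
    ∑ g ∈ Finset.range (2 * n), F g = ∑ i ∈ Finset.range n, (F (2 * i) + F (2 * i + 1)) := by
  induction n with
  | zero => simp
  | succ n ih =>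
    rw [show 2 * (n + 1) = 2 * n + 1 + 1 by ring, Finset.sum_range_succ, Finset.sum_range_succ, ih,
      Finset.sum_range_succ]
    ring

/-- Since `0 ≤ y ≤ x` gives `(x - y)² ≤ x² - y²`, summation by parts turns squared decrements
weighted by `b` into squares weighted by increments of `b`. The boundary term on the left is what
carries the induction. -/
theorem sum_sq_decrement_mul_le {γ b : ℕ → ℝ} (hγ : Antitone γ) (hγ0 : ∀ g, 0 ≤ γ g)
    (hb : Monotone b) (hb0 : b 0 = 0) (n : ℕ) :
    ∑ i ∈ Finset.range n, (γ (2 * i) - γ (2 * i + 1)) ^ 2 * b (2 * i + 1) + γ (2 * n) ^ 2 * b (2 * n)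
      ≤ ∑ g ∈ Finset.range (2 * n), γ g ^ 2 * (b (g + 1) - b g) := by
  induction n with
  | zero => simp [hb0]
  | succ n ih =>
    rw [sum_range_two_mul] at ih ⊢
    rw [Finset.sum_range_succ, Finset.sum_range_succ _ n]
    have e : 2 * (n + 1) = 2 * n + 1 + 1 := by ring
    rw [e]
    have g1 : γ (2 * n + 1) ≤ γ (2 * n) := hγ (by omega)
    have g2 : γ (2 * n + 1 + 1) ≤ γ (2 * n + 1) := hγ (by omega)
    have b1 : b (2 * n) ≤ b (2 * n + 1) := hb (by omega)
    have b2 : b (2 * n + 1) ≤ b (2 * n + 1 + 1) := hb (by omega)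
    have b0 : 0 ≤ b (2 * n) := hb0 ▸ hb (Nat.zero_le _)
    have h1 : 0 ≤ γ (2 * n + 1) * (γ (2 * n) - γ (2 * n + 1)) * b (2 * n + 1) :=
      mul_nonneg (mul_nonneg (hγ0 _) (by linarith)) (by linarith)
    have h2 : γ (2 * n + 1 + 1) ^ 2 * b (2 * n + 1 + 1) ≤ γ (2 * n + 1) ^ 2 * b (2 * n + 1 + 1) :=
      mul_le_mul_of_nonneg_right (pow_le_pow_left₀ (hγ0 _) g2 2) (by linarith)
    nlinarith

/-- Young's inequality. The last hypothesis handles `b = 0`, where the quotient `x ^ 2 / b` is zero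
by convention and would otherwise lose the term. -/
theorem mul_le_mul_sq_add_div {a x b l : ℝ} (hl : 0 < l) (hb : 0 ≤ b) (h : b = 0 → x = 0) :
    a * x ≤ l * (a ^ 2 * b) + x ^ 2 / b / (4 * l) := by
  rcases hb.eq_or_lt with hb | hb
  · simp [h hb.symm, ← hb]
  · have : l * (a ^ 2 * b) + x ^ 2 / b / (4 * l) - a * x = (2 * l * a * b - x) ^ 2 / (4 * l * b) := by
      field_simp
      ring
    have h2 : 0 ≤ (2 * l * a * b - x) ^ 2 / (4 * l * b) := by positivity
    linarith

/-- Chaining along dyadic scales. On a pair of neighbouring cells, replace the left weight by the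
right one: the error is a decrement of `γ` times the increment of `N` over the left cell, handled by
Young's inequality and `sum_sq_decrement_mul_le`. What remains is the same sum on the coarser grid.
Each of the `r + 1` scales costs one copy of the quadratic form, and the noise part no longer
involves `γ`. -/
theorem sum_antitone_mul_increment_le (r : ℕ) {γ b N : ℕ → ℝ} {l : ℝ} (hl : 0 < l)
    (hγ : Antitone γ) (hγ0 : ∀ g, 0 ≤ γ g) (hb : Monotone b) (hb0 : b 0 = 0)
    (hN : ∀ g, b (g + 1) = 0 → N (g + 1) = N g) :
    ∑ g ∈ Finset.range (2 ^ r), γ g * (N (g + 1) - N g)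
      ≤ l * (r + 1) * ∑ g ∈ Finset.range (2 ^ r), γ g ^ 2 * (b (g + 1) - b g)
        + dyadicEnergy r N b / (4 * l) := by
  have hbn : ∀ g, 0 ≤ b g := fun g => hb0 ▸ hb (Nat.zero_le _)
  induction r generalizing γ b N with
  | zero =>
    have := mul_le_mul_sq_add_div (a := γ 0) (x := N 1 - N 0) hl (hbn 1)
      (fun h => sub_eq_zero.2 (hN 0 h))
    simpa [dyadicEnergy, hb0] using this
  | succ r ih =>
    have key := ih (γ := fun i => γ (2 * i + 1)) (b := fun i => b (2 * i))
      (N := fun i => N (2 * i)) (fun i j h => hγ (by omega)) (fun _ => hγ0 _)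
      (fun i j h => hb (by omega)) hb0
      (fun g h => by
        have h2 : b (2 * g + 1 + 1) = 0 := h
        have h1 : b (2 * g + 1) = 0 := le_antisymm (h2 ▸ hb (by omega)) (hbn _)
        exact (hN _ h2).trans (hN _ h1))
      (fun _ => hbn _)
    have hsplit : ∑ g ∈ Finset.range (2 ^ (r + 1)), γ g * (N (g + 1) - N g)
        = ∑ i ∈ Finset.range (2 ^ r), (γ (2 * i) - γ (2 * i + 1)) * (N (2 * i + 1) - N (2 * i))
          + ∑ i ∈ Finset.range (2 ^ r), γ (2 * i + 1) * (N (2 * (i + 1)) - N (2 * i)) := by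
      rw [pow_succ', sum_range_two_mul, ← Finset.sum_add_distrib]
      refine Finset.sum_congr rfl fun i _ => ?_
      rw [show 2 * (i + 1) = 2 * i + 1 + 1 by ring]
      ring
    -- The coarse grid keeps the smaller, right weight of each pair, so the quadratic form does not
    -- grow.
    have hcoarse : ∑ i ∈ Finset.range (2 ^ r), γ (2 * i + 1) ^ 2 * (b (2 * (i + 1)) - b (2 * i))
        ≤ ∑ g ∈ Finset.range (2 ^ (r + 1)), γ g ^ 2 * (b (g + 1) - b g) := by
      rw [pow_succ', sum_range_two_mul]
      refine Finset.sum_le_sum fun i _ => ?_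
      rw [show 2 * (i + 1) = 2 * i + 1 + 1 by ring]
      have b1 : b (2 * i) ≤ b (2 * i + 1) := hb (by omega)
      have h2 : γ (2 * i + 1) ^ 2 ≤ γ (2 * i) ^ 2 := pow_le_pow_left₀ (hγ0 _) (hγ (by omega)) 2
      nlinarith
    have hleft : ∑ i ∈ Finset.range (2 ^ r),
          (γ (2 * i) - γ (2 * i + 1)) * (N (2 * i + 1) - N (2 * i))
        ≤ l * ∑ g ∈ Finset.range (2 ^ (r + 1)), γ g ^ 2 * (b (g + 1) - b g)
          + (∑ i ∈ Finset.range (2 ^ r), (N (2 * i + 1) - N (2 * i)) ^ 2 / b (2 * i + 1))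
            / (4 * l) := by
      have h1 := sum_sq_decrement_mul_le hγ hγ0 hb hb0 (2 ^ r)
      rw [← pow_succ'] at h1
      have h2 : 0 ≤ γ (2 ^ (r + 1)) ^ 2 * b (2 ^ (r + 1)) := mul_nonneg (sq_nonneg _) (hbn _)
      calc _ ≤ ∑ i ∈ Finset.range (2 ^ r), (l * ((γ (2 * i) - γ (2 * i + 1)) ^ 2 * b (2 * i + 1))
              + (N (2 * i + 1) - N (2 * i)) ^ 2 / b (2 * i + 1) / (4 * l)) :=
            Finset.sum_le_sum fun i _ => mul_le_mul_sq_add_div hl (hbn _)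
              (fun h => sub_eq_zero.2 (hN _ h))
        _ ≤ _ := by
            rw [Finset.sum_add_distrib, ← Finset.mul_sum, ← Finset.sum_div]
            have := mul_le_mul_of_nonneg_left (a := l) (le_of_add_le_of_nonneg_left h1 h2) hl.le
            linarith
    have h3 := mul_le_mul_of_nonneg_left hcoarse (show 0 ≤ l * ((r : ℝ) + 1) by positivity)
    rw [hsplit, dyadicEnergy, add_div]
    push_cast
    linarith

theorem dyadicEnergy_nonneg (r : ℕ) {N b : ℕ → ℝ} (hb : ∀ g, 0 ≤ b g) :
    0 ≤ dyadicEnergy r N b := by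
  induction r generalizing N b with
  | zero => exact div_nonneg (sq_nonneg _) (hb _)
  | succ r ih =>
    exact add_nonneg (Finset.sum_nonneg fun i _ => div_nonneg (sq_nonneg _) (hb _))
      (ih fun _ => hb _)

theorem dyadicEnergy_neg (r : ℕ) (N b : ℕ → ℝ) :
    dyadicEnergy r (fun i => -N i) b = dyadicEnergy r N b := by
  induction r generalizing N b with
  | zero => simp only [dyadicEnergy]; ring
  | succ r ih =>
    simp only [dyadicEnergy]
    rw [ih (fun i => N (2 * i))]
    congr 1
    exact Finset.sum_congr rfl fun i _ => by ring

/-- Merging two adjacent intervals does not increase the sum of relative increments; hence the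
finest grid dominates all coarser ones. -/
theorem sub_div_le_add {x y t : ℝ} (hx : 0 ≤ x) (hxy : x ≤ y) (hyt : y ≤ t) :
    (t - x) / t ≤ (y - x) / y + (t - y) / t := by
  rcases hx.eq_or_lt with rfl | hx
  · rcases hxy.eq_or_lt with rfl | hy
    · simp
    · have : 0 < t := hy.trans_le hyt
      rw [sub_zero, sub_zero, div_self this.ne', div_self hy.ne']
      have : 0 ≤ (t - y) / t := div_nonneg (by linarith) this.le
      linarith
  · have hy := hx.trans_le hxy
    have ht := hy.trans_le hyt
    have : (y - x) / t ≤ (y - x) / y := div_le_div_of_nonneg_left (by linarith) hy hyt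
    have e : (t - x) / t = (y - x) / t + (t - y) / t := by rw [← add_div]; ring
    linarith

theorem integrable_dyadicEnergy {Ω : Type*} [MeasurableSpace Ω] {μ : Measure Ω} (r : ℕ)
    {N : ℕ → Ω → ℝ} {b : ℕ → ℝ} (hint : ∀ i j, Integrable (fun ω => (N j ω - N i ω) ^ 2) μ) :
    Integrable (fun ω => dyadicEnergy r (fun i => N i ω) b) μ := by
  induction r generalizing N b with
  | zero => exact (hint 0 1).div_const _
  | succ r ih =>
    exact (integrable_finsetSum _ fun i _ => (hint _ _).div_const _).add
      (ih (N := fun i => N (2 * i)) fun _ _ => hint _ _)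

/-- At each scale the expected energy is at most `C` times a sum of relative increments of `b` on
that grid. By `sub_div_le_add` this is bounded by the sum on the finest grid, and there are `r + 1`
scales. -/
theorem integral_dyadicEnergy_le {Ω : Type*} [MeasurableSpace Ω] {μ : Measure Ω} (r : ℕ)
    {N : ℕ → Ω → ℝ} {b : ℕ → ℝ} {C : ℝ} (hC : 0 ≤ C) (hb : Monotone b) (hbn : ∀ g, 0 ≤ b g)
    (hint : ∀ i j, Integrable (fun ω => (N j ω - N i ω) ^ 2) μ)
    (hvar : ∀ i j, i ≤ j → ∫ ω, (N j ω - N i ω) ^ 2 ∂μ ≤ C * (b j - b i)) :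
    ∫ ω, dyadicEnergy r (fun i => N i ω) b ∂μ
      ≤ C * (r + 1) * ∑ g ∈ Finset.range (2 ^ r), (b (g + 1) - b g) / b (g + 1) := by
  induction r generalizing N b with
  | zero =>
    simp only [dyadicEnergy, integral_div]
    simpa [mul_div_assoc] using div_le_div_of_nonneg_right (hvar 0 1 (by omega)) (hbn 1)
  | succ r ih =>
    have key := ih (N := fun i => N (2 * i)) (b := fun i => b (2 * i))
      (fun i j h => hb (by omega)) (fun _ => hbn _) (fun _ _ => hint _ _)
      (fun i j h => hvar _ _ (by omega))
    simp only [dyadicEnergy]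
    rw [integral_add (integrable_finsetSum _ fun i _ => (hint _ _).div_const _)
      (integrable_dyadicEnergy r (N := fun i => N (2 * i)) fun _ _ => hint _ _),
      integral_finsetSum _ fun i _ => (hint _ _).div_const _]
    have hfine : ∑ i ∈ Finset.range (2 ^ r),
          ∫ ω, (N (2 * i + 1) ω - N (2 * i) ω) ^ 2 / b (2 * i + 1) ∂μ
        ≤ C * ∑ g ∈ Finset.range (2 ^ (r + 1)), (b (g + 1) - b g) / b (g + 1) := by
      rw [pow_succ', sum_range_two_mul, Finset.mul_sum]
      refine Finset.sum_le_sum fun i _ => ?_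
      rw [integral_div]
      have h1 := div_le_div_of_nonneg_right (hvar (2 * i) (2 * i + 1) (by omega)) (hbn (2 * i + 1))
      have h2 : 0 ≤ (b (2 * i + 1 + 1) - b (2 * i + 1)) / b (2 * i + 1 + 1) :=
        div_nonneg (sub_nonneg.2 (hb (by omega))) (hbn _)
      rw [mul_add, ← mul_div_assoc]
      have := mul_nonneg hC h2
      linarith
    have hcoarse : ∑ i ∈ Finset.range (2 ^ r), (b (2 * (i + 1)) - b (2 * i)) / b (2 * (i + 1))
        ≤ ∑ g ∈ Finset.range (2 ^ (r + 1)), (b (g + 1) - b g) / b (g + 1) := by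
      rw [pow_succ', sum_range_two_mul]
      exact Finset.sum_le_sum fun i _ =>
        sub_div_le_add (hbn _) (hb (by omega)) (hb (show 2 * i + 1 ≤ 2 * (i + 1) by omega))
    have h3 := mul_le_mul_of_nonneg_left hcoarse (show 0 ≤ C * ((r : ℝ) + 1) by positivity)
    push_cast
    linarith

/-- Because `log 2 ≥ 1/2`, the number of scales is at most `2 (1 + log M)`. It appears squared: once
from the Young parameter `δ / (r + 1)` and once from the expected energy. -/
theorem natLog_two_add_two_sq_le {M : ℕ} (hM : 1 ≤ M) :
    ((Nat.log 2 M + 1 : ℕ) + 1 : ℝ) ^ 2 ≤ 4 * (1 + Real.log M) ^ 2 := by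
  have h1 : ((2 : ℝ) ^ Nat.log 2 M) ≤ M := by exact_mod_cast Nat.pow_log_le_self 2 (by omega)
  have h2 := Real.log_le_log (by positivity) h1
  rw [Real.log_pow] at h2
  have h3 := Real.log_two_gt_d9
  have h4 : (0 : ℝ) ≤ Nat.log 2 M := Nat.cast_nonneg _
  have h5 : ((Nat.log 2 M + 1 : ℕ) + 1 : ℝ) ≤ 2 * (1 + Real.log M) := by
    push_cast
    nlinarith
  calc _ ≤ (2 * (1 + Real.log M)) ^ 2 := pow_le_pow_left₀ (by positivity) h5 2
    _ = _ := by ring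

/-- Weighted increments of a process with monotone weights are controlled by the quadratic form of
the weights, up to a remainder which does not depend on the weights. -/
theorem exists_remainder_antitone {Ω : Type*} [MeasurableSpace Ω] {μ : Measure Ω} {M : ℕ}
    (hM : 1 ≤ M) {N : ℕ → Ω → ℝ} {b : ℕ → ℝ} {C : ℝ} (hC : 0 ≤ C)
    (hb : ∀ i j, i ≤ j → j ≤ M → b i ≤ b j) (hb0 : b 0 = 0)
    (hN : ∀ g, g < M → b (g + 1) = 0 → ∀ ω, N (g + 1) ω = N g ω)
    (hint : ∀ i j, i ≤ M → j ≤ M → Integrable (fun ω => (N j ω - N i ω) ^ 2) μ)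
    (hvar : ∀ i j, i ≤ j → j ≤ M → ∫ ω, (N j ω - N i ω) ^ 2 ∂μ ≤ C * (b j - b i)) :
    ∃ T : Ω → ℝ, Integrable T μ ∧ (∀ ω, 0 ≤ T ω) ∧
      ∫ ω, T ω ∂μ ≤ 4 * C * (1 + Real.log M) ^ 2
        * ∑ g ∈ Finset.range M, (b (g + 1) - b g) / b (g + 1) ∧
      ∀ ω δ, 0 < δ → ∀ γ : ℕ → ℝ, (∀ i j, i ≤ j → j < M → γ j ≤ γ i) → (∀ g, g < M → 0 ≤ γ g) →
        |∑ g ∈ Finset.range M, γ g * (N (g + 1) ω - N g ω)|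
          ≤ δ * ∑ g ∈ Finset.range M, γ g ^ 2 * (b (g + 1) - b g) + T ω / (4 * δ) := by
  set r := Nat.log 2 M + 1 with hr
  have hMr : M ≤ 2 ^ r := (Nat.lt_pow_succ_log_self (by norm_num) M).le
  -- Freezing the process and `b` after `M` pads the index set to a power of two without adding
  -- increments.
  set N' : ℕ → Ω → ℝ := fun i => N (min i M) with hN'
  set b' : ℕ → ℝ := fun i => b (min i M) with hb'
  have hbm : Monotone b' := fun i j h => hb _ _ (by omega) (by omega)
  have hb'0 : b' 0 = 0 := by simp [hb', hb0]
  have hbn : ∀ g, 0 ≤ b' g := fun g => hb'0 ▸ hbm (Nat.zero_le _)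
  have hNz : ∀ g, b' (g + 1) = 0 → ∀ ω, N' (g + 1) ω = N' g ω := by
    intro g h ω
    simp only [hN']
    by_cases hg : g < M
    · have e1 : min (g + 1) M = g + 1 := by omega
      have e2 : min g M = g := by omega
      simp only [hb', e1] at h
      rw [e1, e2, hN g hg h ω]
    · rw [show min (g + 1) M = min g M by omega]
  have hint' : ∀ i j, Integrable (fun ω => (N' j ω - N' i ω) ^ 2) μ :=
    fun i j => hint _ _ (by omega) (by omega)
  have hext : ∀ F : ℕ → ℝ, (∀ g, M ≤ g → F g = 0) →
      ∑ g ∈ Finset.range (2 ^ r), F g = ∑ g ∈ Finset.range M, F g := by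
    intro F hF
    refine (Finset.sum_subset (Finset.range_subset_range.2 hMr) fun g _ h => hF g ?_).symm
    simpa using h
  have hlt : ∀ g ∈ Finset.range M, min (g + 1) M = g + 1 ∧ min g M = g := fun g h => by
    have := Finset.mem_range.1 h
    omega
  have hge : ∀ g, M ≤ g → min (g + 1) M = M ∧ min g M = M := fun g h => by omega
  refine ⟨fun ω => (r + 1) * dyadicEnergy r (fun i => N' i ω) b',
    (integrable_dyadicEnergy r hint').const_mul _,
    fun ω => mul_nonneg (by positivity) (dyadicEnergy_nonneg r hbn), ?_, ?_⟩
  · rw [integral_const_mul]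
    have h1 := integral_dyadicEnergy_le r hC hbm hbn hint'
      (fun i j h => hvar _ _ (by omega) (by omega))
    rw [hext _ (fun g hg => by simp [hb', hge g hg])] at h1
    have h2 : ∑ g ∈ Finset.range M, (b' (g + 1) - b' g) / b' (g + 1)
        = ∑ g ∈ Finset.range M, (b (g + 1) - b g) / b (g + 1) :=
      Finset.sum_congr rfl fun g hg => by simp [hb', hlt g hg]
    rw [h2] at h1
    have h3 : 0 ≤ ∑ g ∈ Finset.range M, (b (g + 1) - b g) / b (g + 1) := by
      rw [← h2]
      exact Finset.sum_nonneg fun g _ => div_nonneg (sub_nonneg.2 (hbm (by omega))) (hbn _)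
    calc _ ≤ ((r : ℝ) + 1) * (C * (r + 1)
            * ∑ g ∈ Finset.range M, (b (g + 1) - b g) / b (g + 1)) :=
          mul_le_mul_of_nonneg_left h1 (by positivity)
      _ = ((r : ℝ) + 1) ^ 2 * (C * ∑ g ∈ Finset.range M, (b (g + 1) - b g) / b (g + 1)) := by ring
      _ ≤ 4 * (1 + Real.log M) ^ 2 * (C * ∑ g ∈ Finset.range M, (b (g + 1) - b g) / b (g + 1)) :=
          mul_le_mul_of_nonneg_right (natLog_two_add_two_sq_le hM) (mul_nonneg hC h3)
      _ = _ := by ring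
  · intro ω δ hδ γ hγ hγ0
    set γ' : ℕ → ℝ := fun g => if g < M then γ g else 0 with hγ'
    have hanti : Antitone γ' := by
      intro i j h
      simp only [hγ']
      split_ifs with h1 h2 h2
      · exact hγ _ _ h h1
      · omega
      · exact hγ0 _ h2
      · exact le_rfl
    have hnn : ∀ g, 0 ≤ γ' g := by
      intro g
      simp only [hγ']
      split_ifs with h1
      · exact hγ0 _ h1
      · exact le_rfl
    have hrp : (0 : ℝ) < r + 1 := by positivity
    -- Chosen so that the `r + 1` copies of the quadratic form add up to `δ`.
    have hl : 0 < δ / (r + 1) := div_pos hδ hrp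
    have e1 : ∑ g ∈ Finset.range (2 ^ r), γ' g * (N' (g + 1) ω - N' g ω)
        = ∑ g ∈ Finset.range M, γ g * (N (g + 1) ω - N g ω) := by
      rw [hext _ (fun g hg => by simp [hN', hge g hg])]
      exact Finset.sum_congr rfl fun g hg => by
        simp [hN', hlt g hg, hγ', Finset.mem_range.1 hg]
    have e2 : ∑ g ∈ Finset.range (2 ^ r), γ' g ^ 2 * (b' (g + 1) - b' g)
        = ∑ g ∈ Finset.range M, γ g ^ 2 * (b (g + 1) - b g) := by
      rw [hext _ (fun g hg => by simp [hb', hge g hg])]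
      exact Finset.sum_congr rfl fun g hg => by
        simp [hb', hlt g hg, hγ', Finset.mem_range.1 hg]
    have up := sum_antitone_mul_increment_le r hl hanti hnn hbm hb'0
      (N := fun i => N' i ω) (fun g h => hNz g h ω)
    -- The process `-N` has the same energy, which yields the absolute value.
    have down := sum_antitone_mul_increment_le r hl hanti hnn hbm hb'0
      (N := fun i => -N' i ω) (fun g h => by rw [hNz g h ω])
    rw [dyadicEnergy_neg] at down
    have e3 : ∑ g ∈ Finset.range (2 ^ r), γ' g * (-N' (g + 1) ω - -N' g ω)
        = -∑ g ∈ Finset.range (2 ^ r), γ' g * (N' (g + 1) ω - N' g ω) := by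
      rw [← Finset.sum_neg_distrib]
      exact Finset.sum_congr rfl fun g _ => by ring
    rw [e3, e1, e2] at down
    rw [e1, e2] at up
    have e4 : δ / (r + 1) * ((r : ℝ) + 1) = δ := by field_simp
    have e5 : dyadicEnergy r (fun i => N' i ω) b' / (4 * (δ / (r + 1)))
        = (r + 1) * dyadicEnergy r (fun i => N' i ω) b' / (4 * δ) := by field_simp
    rw [e4, e5] at up down
    exact abs_le.2 ⟨by linarith, up⟩

end ModelAvg

/-! ### Moments of linear and quadratic forms in the noise -/

namespace ModelAvg

/-- All absolute moments of `g` are finite. -/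
def HasAllMoments {Ω : Type*} [MeasurableSpace Ω] (μ : Measure Ω) (g : Ω → ℝ) : Prop :=
  ∀ q : ℝ≥0, MemLp g q μ

namespace HasAllMoments

variable {Ω : Type*} [MeasurableSpace Ω] {μ : Measure Ω} {g h : Ω → ℝ}

theorem integrable (hg : HasAllMoments μ g) : Integrable g μ := by
  have := hg 1
  rwa [ENNReal.coe_one, memLp_one_iff_integrable] at this

theorem add (hg : HasAllMoments μ g) (hh : HasAllMoments μ h) :
    HasAllMoments μ (fun ω => g ω + h ω) := fun q => (hg q).add (hh q)

theorem sub (hg : HasAllMoments μ g) (hh : HasAllMoments μ h) :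
    HasAllMoments μ (fun ω => g ω - h ω) := fun q => (hg q).sub (hh q)

theorem const [IsProbabilityMeasure μ] (c : ℝ) : HasAllMoments μ (fun _ => c) :=
  fun _ => memLp_const c

theorem const_mul (hg : HasAllMoments μ g) (c : ℝ) : HasAllMoments μ (fun ω => c * g ω) :=
  fun q => (hg q).const_mul c

theorem mul (hg : HasAllMoments μ g) (hh : HasAllMoments μ h) :
    HasAllMoments μ (fun ω => g ω * h ω) := fun q => by
  have : ENNReal.HolderTriple ((2 * q : ℝ≥0) : ENNReal) ((2 * q : ℝ≥0) : ENNReal) q := by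
    constructor
    rw [ENNReal.coe_mul, ENNReal.mul_inv (by simp) (by simp), ← add_mul]
    simp [ENNReal.inv_two_add_inv_two]
  exact MemLp.mul' (hh (2 * q)) (hg (2 * q))

theorem pow_two (hg : HasAllMoments μ g) : HasAllMoments μ (fun ω => g ω ^ 2) := by
  simpa only [sq] using hg.mul hg

theorem sum {ι : Type*} (s : Finset ι) {g : ι → Ω → ℝ} (hg : ∀ i ∈ s, HasAllMoments μ (g i)) :
    HasAllMoments μ (fun ω => ∑ i ∈ s, g i ω) :=
  fun q => memLp_finsetSum s fun i hi => hg i hi q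

end HasAllMoments

/-- `F` factors through the coordinates in `s`: extending them by zero does not change its value.
This lets the moment computations add one noise variable at a time. -/
theorem indepFun_of_dependsOn {Ω : Type*} [MeasurableSpace Ω] {μ : Measure Ω} {n : ℕ}
    {ε : Fin n → Ω → ℝ} (hm : ∀ i, Measurable (ε i)) (hi : iIndepFun ε μ) (s : Finset (Fin n))
    {a : Fin n} (ha : a ∉ s) {F : (Fin n → ℝ) → ℝ} (hF : Measurable F)
    (hdep : ∀ x y, (∀ i ∈ s, x i = y i) → F x = F y) {h : ℝ → ℝ} (hh : Measurable h) :
    IndepFun (fun ω => F (fun i => ε i ω)) (fun ω => h (ε a ω)) μ := by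
  have key := hi.indepFun_finset s {a} (by simpa using ha) hm
  set e : (s → ℝ) → (Fin n → ℝ) := fun v i => if h : i ∈ s then v ⟨i, h⟩ else 0 with he
  have hem : Measurable e := by
    refine measurable_pi_lambda _ fun i => ?_
    simp only [he]
    split_ifs with h
    · exact measurable_pi_apply _
    · exact measurable_const
  have := key.comp (φ := fun v => F (e v))
    (ψ := fun v : ({a} : Finset (Fin n)) → ℝ => h (v ⟨a, by simp⟩))
    (hF.comp hem) (hh.comp (measurable_pi_apply _))
  convert this using 1
  · funext ω
    refine hdep _ _ fun i hi => ?_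
    simp [he, hi]
  · rfl

variable {Ω : Type*} [MeasurableSpace Ω] {μ : Measure Ω} {n : ℕ} {ε : Fin n → Ω → ℝ} {σ : ℝ}
  {η : ℝ≥0}

/-- The centered quadratic form of the noise variables in `s`. -/
def quadForm (A : Matrix (Fin n) (Fin n) ℝ) (σ : ℝ) (s : Finset (Fin n))
    (x : Fin n → ℝ) : ℝ :=
  ∑ i ∈ s, ∑ k ∈ s, A i k * (x i * x k) - σ ^ 2 * ∑ i ∈ s, A i i

namespace IsSubgaussianNoise

theorem hasAllMoments (hε : IsSubgaussianNoise μ ε σ η) (i : Fin n) : HasAllMoments μ (ε i) :=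
  (hε.subgaussian i).memLp

theorem integral_mul_of_dependsOn (hε : IsSubgaussianNoise μ ε σ η) (s : Finset (Fin n))
    {a : Fin n} (ha : a ∉ s) {F : (Fin n → ℝ) → ℝ} (hF : Measurable F)
    (hdep : ∀ x y, (∀ i ∈ s, x i = y i) → F x = F y) {h : ℝ → ℝ} (hh : Measurable h) :
    ∫ ω, F (fun i => ε i ω) * h (ε a ω) ∂μ
      = (∫ ω, F (fun i => ε i ω) ∂μ) * ∫ ω, h (ε a ω) ∂μ :=
  (indepFun_of_dependsOn hε.measurable hε.indep s ha hF hdep hh).integral_fun_mul_eq_mul_integral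
    (hF.comp (measurable_pi_lambda _ hε.measurable)).aestronglyMeasurable
    (hh.comp (hε.measurable a)).aestronglyMeasurable

theorem hasAllMoments_linear (hε : IsSubgaussianNoise μ ε σ η) (s : Finset (Fin n))
    (c : Fin n → ℝ) : HasAllMoments μ (fun ω => ∑ i ∈ s, c i * ε i ω) :=
  HasAllMoments.sum s fun i _ => (hε.hasAllMoments i).const_mul _

theorem integral_linear (hε : IsSubgaussianNoise μ ε σ η) (s : Finset (Fin n)) (c : Fin n → ℝ) :
    ∫ ω, ∑ i ∈ s, c i * ε i ω ∂μ = 0 := by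
  rw [integral_finsetSum _ fun i _ => ((hε.hasAllMoments i).const_mul _).integrable]
  simp [integral_const_mul, hε.mean]

theorem integral_linear_sq (hε : IsSubgaussianNoise μ ε σ η) (s : Finset (Fin n))
    (c : Fin n → ℝ) :
    ∫ ω, (∑ i ∈ s, c i * ε i ω) ^ 2 ∂μ = σ ^ 2 * ∑ i ∈ s, c i ^ 2 := by
  induction s using Finset.induction_on with
  | empty => simp
  | insert a s ha ih =>
    have hL := hε.hasAllMoments_linear s c
    have ha' := hε.hasAllMoments a
    have hcross : ∫ ω, (∑ i ∈ s, c i * ε i ω) * ε a ω ∂μ = 0 := by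
      have := hε.integral_mul_of_dependsOn s ha (F := fun x => ∑ i ∈ s, c i * x i) (by fun_prop)
        (fun x y h => Finset.sum_congr rfl fun i hi => by rw [h i hi]) (h := fun x => x)
        measurable_id
      simpa [hε.mean] using this
    have e : ∀ ω, (∑ i ∈ insert a s, c i * ε i ω) ^ 2
        = (∑ i ∈ s, c i * ε i ω) ^ 2 + (2 * c a * ((∑ i ∈ s, c i * ε i ω) * ε a ω)
          + c a ^ 2 * ε a ω ^ 2) := fun ω => by
      rw [Finset.sum_insert ha]; ring
    simp only [e]
    rw [integral_add hL.pow_two.integrable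
        (((hL.mul ha').const_mul _).add (ha'.pow_two.const_mul _)).integrable,
      integral_add ((hL.mul ha').const_mul _).integrable (ha'.pow_two.const_mul _).integrable,
      integral_const_mul, integral_const_mul, hcross, ih, hε.variance, Finset.sum_insert ha]
    ring

/-- From `x⁴ / 4! ≤ exp |x| ≤ exp x + exp (-x)` and the moment generating function at `±1`: `48 = 24
· 2`. The terms in `σ` sum to `-σ⁴` and are dropped. -/
theorem integral_pow_four_le [IsProbabilityMeasure μ] (hε : IsSubgaussianNoise μ ε σ η)
    (i : Fin n) : ∫ ω, (ε i ω ^ 2 - σ ^ 2) ^ 2 ∂μ ≤ 48 * Real.exp (η / 2) := by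
  have h := hε.hasAllMoments i
  have hs := hε.subgaussian i
  have e : ∀ ω, (ε i ω ^ 2 - σ ^ 2) ^ 2 = (ε i ω ^ 2) ^ 2 - (2 * σ ^ 2 * ε i ω ^ 2 - σ ^ 4) :=
    fun ω => by ring
  simp only [e]
  rw [integral_sub h.pow_two.pow_two.integrable
      ((h.pow_two.const_mul _).sub (HasAllMoments.const _)).integrable,
    integral_sub (h.pow_two.const_mul _).integrable (integrable_const _), integral_const_mul,
    hε.variance]
  have h4 : ∫ ω, (ε i ω ^ 2) ^ 2 ∂μ ≤ ∫ ω, 24 * (Real.exp (1 * ε i ω) + Real.exp (-1 * ε i ω)) ∂μ := by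
    refine integral_mono h.pow_two.pow_two.integrable
      (((hs.integrable_exp_mul 1).add (hs.integrable_exp_mul (-1))).const_mul _) fun ω => ?_
    have hx := Real.pow_div_factorial_le_exp (|ε i ω|) (abs_nonneg _) 4
    have h3 : Real.exp |ε i ω| ≤ Real.exp (1 * ε i ω) + Real.exp (-1 * ε i ω) := by
      rcases abs_choice (ε i ω) with h | h <;> rw [h] <;>
        [have := Real.exp_pos (-1 * ε i ω); have := Real.exp_pos (1 * ε i ω)] <;>
        simp only [one_mul, neg_one_mul] at * <;> linarith
    have h5 : |ε i ω| ^ 4 = (ε i ω ^ 2) ^ 2 := by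
      rw [← sq_abs (ε i ω)]; ring
    rw [h5] at hx
    norm_num [Nat.factorial] at hx ⊢
    norm_num at h3
    linarith
  rw [integral_const_mul, integral_add (hs.integrable_exp_mul 1) (hs.integrable_exp_mul (-1))] at h4
  have m1 := hs.mgf_le 1
  have m2 := hs.mgf_le (-1)
  simp only [mgf] at m1 m2
  norm_num at m1 m2 h4 ⊢
  nlinarith [sq_nonneg (σ ^ 2)]

theorem hasAllMoments_quadForm [IsProbabilityMeasure μ] (hε : IsSubgaussianNoise μ ε σ η)
    (A : Matrix (Fin n) (Fin n) ℝ) (s : Finset (Fin n)) :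
    HasAllMoments μ (fun ω => quadForm A σ s (fun i => ε i ω)) :=
  (HasAllMoments.sum s fun i _ => HasAllMoments.sum s fun k _ =>
    ((hε.hasAllMoments i).mul (hε.hasAllMoments k)).const_mul _).sub (HasAllMoments.const _)

theorem quadForm_insert {A : Matrix (Fin n) (Fin n) ℝ} (hA : ∀ i k, A i k = A k i)
    {s : Finset (Fin n)} {a : Fin n} (ha : a ∉ s) (x : Fin n → ℝ) :
    quadForm A σ (insert a s) x = quadForm A σ s x
      + (2 * ((∑ k ∈ s, A a k * x k) * x a) + A a a * (x a ^ 2 - σ ^ 2)) := by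
  simp only [quadForm, Finset.sum_insert ha, Finset.sum_add_distrib]
  have : ∑ i ∈ s, A i a * (x i * x a) = (∑ k ∈ s, A a k * x k) * x a := by
    rw [Finset.sum_mul]
    exact Finset.sum_congr rfl fun i _ => by rw [hA i a]; ring
  have h2 : ∑ k ∈ s, A a k * (x a * x k) = (∑ k ∈ s, A a k * x k) * x a := by
    rw [Finset.sum_mul]
    exact Finset.sum_congr rfl fun i _ => by ring
  rw [this, h2]
  ring

/-- Adding a noise variable changes the centered form by a martingale increment, orthogonal to the
form so far. The off-diagonal part of the increment contributes `8 σ⁴ ∑ A a k²` and the diagonal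
part `2 · 48 exp (η/2) A a a²`, whence the constant. -/
theorem integral_quadForm_sq_le [IsProbabilityMeasure μ] (hε : IsSubgaussianNoise μ ε σ η)
    {A : Matrix (Fin n) (Fin n) ℝ} (hA : ∀ i k, A i k = A k i) (s : Finset (Fin n)) :
    ∫ ω, quadForm A σ s (fun i => ε i ω) ∂μ = 0 ∧
    ∫ ω, quadForm A σ s (fun i => ε i ω) ^ 2 ∂μ
      ≤ (4 * σ ^ 4 + 96 * Real.exp (η / 2)) * ∑ i ∈ s, ∑ k ∈ s, A i k ^ 2 := by
  induction s using Finset.induction_on with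
  | empty => simp [quadForm]
  | insert a s ha ih =>
    have hQ := hε.hasAllMoments_quadForm A s
    have hU := hε.hasAllMoments_linear s (fun k => A a k)
    have hx := hε.hasAllMoments a
    have hc : HasAllMoments μ (fun ω => ε a ω ^ 2 - σ ^ 2) := hx.pow_two.sub (HasAllMoments.const _)
    have hc0 : ∫ ω, (ε a ω ^ 2 - σ ^ 2) ∂μ = 0 := by
      rw [integral_sub hx.pow_two.integrable (integrable_const _), hε.variance]; simp
    have hUm : Measurable (fun x : Fin n → ℝ => ∑ k ∈ s, A a k * x k) := by fun_prop
    have hUd : ∀ x y : Fin n → ℝ, (∀ i ∈ s, x i = y i) →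
        ∑ k ∈ s, A a k * x k = ∑ k ∈ s, A a k * y k :=
      fun x y h => Finset.sum_congr rfl fun i hi => by rw [h i hi]
    have hQm : Measurable (quadForm A σ s) := by unfold quadForm; fun_prop
    have hQd : ∀ x y : Fin n → ℝ, (∀ i ∈ s, x i = y i) → quadForm A σ s x = quadForm A σ s y :=
      fun x y h => by
        unfold quadForm
        congr 1
        exact Finset.sum_congr rfl fun i hi => Finset.sum_congr rfl fun k hk => by
          rw [h i hi, h k hk]
    have c1 : ∫ ω, (∑ k ∈ s, A a k * ε k ω) * ε a ω ∂μ = 0 := by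
      have := hε.integral_mul_of_dependsOn s ha hUm hUd (h := fun x => x) measurable_id
      simpa [hε.mean] using this
    have c2 : ∫ ω, quadForm A σ s (fun i => ε i ω) * (∑ k ∈ s, A a k * ε k ω) * ε a ω ∂μ = 0 := by
      have := hε.integral_mul_of_dependsOn s ha (hQm.mul hUm)
        (fun x y h => by simp only [Pi.mul_apply]; rw [hQd x y h, hUd x y h]) (h := fun x => x)
        measurable_id
      simpa [hε.mean] using this
    have c3 : ∫ ω, quadForm A σ s (fun i => ε i ω) * (ε a ω ^ 2 - σ ^ 2) ∂μ = 0 := by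
      have := hε.integral_mul_of_dependsOn s ha hQm hQd (h := fun x => x ^ 2 - σ ^ 2) (by fun_prop)
      rw [this, hc0, mul_zero]
    have c4 : ∫ ω, (∑ k ∈ s, A a k * ε k ω) ^ 2 * ε a ω ^ 2 ∂μ
        = σ ^ 2 * (∑ k ∈ s, A a k ^ 2) * σ ^ 2 := by
      have := hε.integral_mul_of_dependsOn s ha (hUm.pow_const 2)
        (fun x y h => congrArg (· ^ 2) (hUd x y h)) (h := fun x => x ^ 2) (by fun_prop)
      rw [this, hε.variance, hε.integral_linear_sq s (fun k => A a k)]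
    have c5 := hε.integral_pow_four_le a
    constructor
    · simp only [quadForm_insert hA ha]
      rw [integral_add hQ.integrable (((hU.mul hx).const_mul _).add (hc.const_mul _)).integrable,
        integral_add ((hU.mul hx).const_mul _).integrable (hc.const_mul _).integrable,
        integral_const_mul, integral_const_mul, ih.1, c1, hc0]
      simp
    · have hle : ∀ ω, quadForm A σ (insert a s) (fun i => ε i ω) ^ 2
          ≤ quadForm A σ s (fun i => ε i ω) ^ 2
            + (4 * (quadForm A σ s (fun i => ε i ω) * (∑ k ∈ s, A a k * ε k ω) * ε a ω)
            + (2 * A a a * (quadForm A σ s (fun i => ε i ω) * (ε a ω ^ 2 - σ ^ 2))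
            + (8 * ((∑ k ∈ s, A a k * ε k ω) ^ 2 * ε a ω ^ 2)
            + 2 * A a a ^ 2 * (ε a ω ^ 2 - σ ^ 2) ^ 2))) := fun ω => by
        rw [quadForm_insert hA ha]
        nlinarith [sq_nonneg (2 * ((∑ k ∈ s, A a k * ε k ω) * ε a ω)
          - A a a * (ε a ω ^ 2 - σ ^ 2))]
      have i1 := ((hQ.mul hU).mul hx).const_mul 4
      have i2 := (hQ.mul hc).const_mul (2 * A a a)
      have i3 := (hU.pow_two.mul hx.pow_two).const_mul 8
      have i4 := hc.pow_two.const_mul (2 * A a a ^ 2)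
      have hmono := integral_mono (hε.hasAllMoments_quadForm A (insert a s)).pow_two.integrable
        (hQ.pow_two.add (i1.add (i2.add (i3.add i4)))).integrable hle
      rw [integral_add hQ.pow_two.integrable (i1.add (i2.add (i3.add i4))).integrable,
        integral_add i1.integrable (i2.add (i3.add i4)).integrable,
        integral_add i2.integrable (i3.add i4).integrable,
        integral_add i3.integrable i4.integrable,
        integral_const_mul, integral_const_mul, integral_const_mul, integral_const_mul,
        c2, c3, c4] at hmono
      have e : ∑ i ∈ insert a s, ∑ k ∈ insert a s, A i k ^ 2
          = ∑ i ∈ s, ∑ k ∈ s, A i k ^ 2 + (2 * ∑ k ∈ s, A a k ^ 2 + A a a ^ 2) := by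
        simp only [Finset.sum_insert ha, Finset.sum_add_distrib]
        rw [Finset.sum_congr rfl fun i (_ : i ∈ s) => show A i a ^ 2 = A a i ^ 2 by rw [hA i a]]
        ring
      rw [e]
      have p1 : 0 ≤ ∑ k ∈ s, A a k ^ 2 := Finset.sum_nonneg fun _ _ => sq_nonneg _
      have p2 : 0 ≤ Real.exp (η / 2) := (Real.exp_pos _).le
      have p3 := mul_le_mul_of_nonneg_left c5 (show 0 ≤ 2 * A a a ^ 2 by positivity)
      have p4 := mul_nonneg p1 p2
      have p5 : 0 ≤ σ ^ 4 * A a a ^ 2 := by positivity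
      have := ih.2
      nlinarith

end IsSubgaussianNoise

end ModelAvg

/-! ### Reduction to the sequence model -/

namespace ModelAvg

/-- The shrinkage factor which the weights `w` give to the coefficient `j`. -/
def shrinkage {p : ℕ} {ι : Type*} [Fintype ι] (𝓜 : ι → Finset (Fin p)) (w : ι → ℝ) (j : Fin p) :
    ℝ :=
  ∑ m, if j ∈ 𝓜 m then w m else 0

/-- Squared loss of the shrinkage estimator in the sequence model. -/
def seqLoss {p : ℕ} (γ θ e : Fin p → ℝ) : ℝ := ∑ j, (γ j * (θ j + e j) - θ j) ^ 2

/-- Risk of the shrinkage estimator in the sequence model. -/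
def seqRisk {p : ℕ} (σ : ℝ) (γ θ : Fin p → ℝ) : ℝ :=
  ∑ j, ((1 - γ j) ^ 2 * θ j ^ 2 + σ ^ 2 * γ j ^ 2)

variable {n p : ℕ} {Φ : Matrix (Fin n) (Fin p) ℝ}

theorem sum_mul_of_orthonormal (hΦ : Φᵀ * Φ = 1) (j k : Fin p) :
    ∑ i, Φ i j * Φ i k = if j = k then 1 else 0 := by
  have := congrFun (congrFun hΦ j) k
  rwa [Matrix.mul_apply, Matrix.one_apply] at this

/-- The Gram matrix of orthonormal columns is the identity, so all candidate projections are
diagonal in the same coordinates. -/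
theorem hatMatrix_eq (hΦ : Φᵀ * Φ = 1) (I : Finset (Fin p)) :
    hatMatrix Φ I = Φ * Matrix.diagonal (fun j => if j ∈ I then (1 : ℝ) else 0) * Φᵀ := by
  have h1 : (subDesign Φ I)ᵀ * subDesign Φ I = 1 := by
    ext a b
    rw [Matrix.mul_apply]
    have := sum_mul_of_orthonormal hΦ a b
    simp only [subDesign, Matrix.transpose_apply, Matrix.submatrix_apply, id]
    rw [this, Matrix.one_apply]
    exact if_congr Subtype.ext_iff.symm rfl rfl
  unfold hatMatrix
  rw [h1, inv_one, Matrix.mul_one]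
  ext i k
  rw [Matrix.mul_apply, Matrix.mul_apply (M := Φ * _)]
  simp only [Matrix.mul_diagonal, subDesign, Matrix.transpose_apply, Matrix.submatrix_apply, id]
  rw [Finset.sum_coe_sort I (fun j => Φ i j * Φ k j)]
  simp [Finset.sum_ite_mem, mul_ite, ite_mul]

theorem avgHatMatrix_eq (hΦ : Φᵀ * Φ = 1) {ι : Type*} [Fintype ι] (𝓜 : ι → Finset (Fin p))
    (w : ι → ℝ) : avgHatMatrix Φ 𝓜 w = Φ * Matrix.diagonal (shrinkage 𝓜 w) * Φᵀ := by
  unfold avgHatMatrix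
  simp only [hatMatrix_eq hΦ]
  have : Matrix.diagonal (shrinkage 𝓜 w)
      = ∑ m, w m • Matrix.diagonal (fun j => if j ∈ 𝓜 m then (1 : ℝ) else 0) := by
    ext j k
    simp only [Matrix.sum_apply, Matrix.smul_apply, Matrix.diagonal_apply, shrinkage]
    by_cases h : j = k
    · simp [h]
    · simp [h]
  rw [this, Matrix.mul_sum, Matrix.sum_mul]
  exact Finset.sum_congr rfl fun m _ => by rw [Matrix.mul_smul, Matrix.smul_mul]

theorem avgHatMatrix_mulVec (hΦ : Φᵀ * Φ = 1) {ι : Type*} [Fintype ι] (𝓜 : ι → Finset (Fin p))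
    (w : ι → ℝ) (v : Fin n → ℝ) :
    avgHatMatrix Φ 𝓜 w *ᵥ v = Φ *ᵥ (fun j => shrinkage 𝓜 w j * (Φᵀ *ᵥ v) j) := by
  rw [avgHatMatrix_eq hΦ, ← Matrix.mulVec_mulVec, ← Matrix.mulVec_mulVec]
  congr 1
  ext j
  rw [Matrix.mulVec_diagonal]

theorem sqNorm_mulVec (hΦ : Φᵀ * Φ = 1) (v : Fin p → ℝ) : sqNorm (Φ *ᵥ v) = ∑ j, v j ^ 2 := by
  have h : ∀ {k : ℕ} (u : Fin k → ℝ), sqNorm u = u ⬝ᵥ u := fun u => by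
    simp [sqNorm, dotProduct, sq]
  rw [h, Matrix.dotProduct_mulVec, Matrix.vecMul_mulVec, hΦ, Matrix.vecMul_one, ← h]
  rfl

theorem sqNorm_sub_mulVec (hΦ : Φᵀ * Φ = 1) (y : Fin n → ℝ) (v : Fin p → ℝ) :
    sqNorm (y - Φ *ᵥ v) = sqNorm y - 2 * ∑ j, (Φᵀ *ᵥ y) j * v j + ∑ j, v j ^ 2 := by
  have h1 : ∑ i, y i * (Φ *ᵥ v) i = ∑ j, (Φᵀ *ᵥ y) j * v j := by
    change y ⬝ᵥ (Φ *ᵥ v) = (Φᵀ *ᵥ y) ⬝ᵥ v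
    rw [Matrix.dotProduct_mulVec, Matrix.mulVec_transpose]
  rw [← h1, ← sqNorm_mulVec hΦ v]
  simp only [sqNorm, Pi.sub_apply, Finset.mul_sum]
  rw [← Finset.sum_sub_distrib, ← Finset.sum_add_distrib]
  exact Finset.sum_congr rfl fun i _ => by ring

/-- This is where the span condition enters: the regression function has no component outside the
range of `Φ`, so the risk has no bias term beyond the sequence model. -/
theorem eq_mulVec_of_mem_columns {X : Matrix (Fin n) (Fin p) ℝ}
    (h : IsOrthonormalBasisOfColumns Φ X) (β : Fin p → ℝ) :
    X *ᵥ β = Φ *ᵥ (Φᵀ *ᵥ (X *ᵥ β)) := by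
  have h1 : X *ᵥ β ∈ LinearMap.range Φ.mulVecLin := by
    rw [Matrix.range_mulVecLin, h.span_eq, ← Matrix.range_mulVecLin]
    exact ⟨β, rfl⟩
  obtain ⟨v, hv⟩ := h1
  rw [Matrix.mulVecLin_apply] at hv
  rw [← hv, Matrix.mulVec_mulVec v, h.orthonormal, Matrix.one_mulVec]

variable {ι : Type*} [Fintype ι] {f : Fin n → ℝ}

theorem maLoss_eq {Ω : Type*} (hΦ : Φᵀ * Φ = 1) (hf : f = Φ *ᵥ (Φᵀ *ᵥ f))
    (𝓜 : ι → Finset (Fin p)) (ε : Fin n → Ω → ℝ) (w : ι → ℝ) (ω : Ω) :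
    maLoss Φ 𝓜 f ε w ω
      = seqLoss (shrinkage 𝓜 w) (Φᵀ *ᵥ f) (Φᵀ *ᵥ fun i => ε i ω) / n := by
  have h1 : Φᵀ *ᵥ response f ε ω = Φᵀ *ᵥ f + Φᵀ *ᵥ fun i => ε i ω := by
    rw [← Matrix.mulVec_add]; rfl
  have h2 : avgHatMatrix Φ 𝓜 w *ᵥ response f ε ω - f
      = Φ *ᵥ (fun j => shrinkage 𝓜 w j * ((Φᵀ *ᵥ f) j + (Φᵀ *ᵥ fun i => ε i ω) j)
        - (Φᵀ *ᵥ f) j) := by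
    rw [avgHatMatrix_mulVec hΦ, h1]
    conv_lhs => rw [hf]
    rw [← Matrix.mulVec_sub, ← hf]
    rfl
  rw [maLoss, loss, h2, sqNorm_mulVec hΦ, seqLoss]

theorem plugInRisk_eq (hΦ : Φᵀ * Φ = 1) (hf : f = Φ *ᵥ (Φᵀ *ᵥ f))
    (𝓜 : ι → Finset (Fin p)) (σ : ℝ) (w : ι → ℝ) :
    plugInRisk Φ 𝓜 f σ w = seqRisk σ (shrinkage 𝓜 w) (Φᵀ *ᵥ f) / n := by
  have h2 : f - avgHatMatrix Φ 𝓜 w *ᵥ f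
      = Φ *ᵥ (fun j => (1 - shrinkage 𝓜 w j) * (Φᵀ *ᵥ f) j) := by
    rw [avgHatMatrix_mulVec hΦ]
    conv_lhs => rw [hf]
    rw [← Matrix.mulVec_sub, ← hf]
    congr 1
    ext j
    simp only [Pi.sub_apply]
    ring
  have h3 : ((avgHatMatrix Φ 𝓜 w)ᵀ * avgHatMatrix Φ 𝓜 w).trace
      = ∑ j, shrinkage 𝓜 w j ^ 2 := by
    rw [avgHatMatrix_eq hΦ]
    simp only [Matrix.transpose_mul, Matrix.transpose_transpose, Matrix.diagonal_transpose]
    rw [Matrix.trace_mul_comm, Matrix.mul_assoc, Matrix.mul_assoc, ← Matrix.mul_assoc Φᵀ Φ, hΦ,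
      Matrix.one_mul, ← Matrix.mul_assoc (Matrix.diagonal _), Matrix.diagonal_mul_diagonal,
      Matrix.trace_mul_comm, Matrix.mul_assoc, hΦ, Matrix.mul_one, Matrix.trace_diagonal]
    exact Finset.sum_congr rfl fun j _ => (sq _).symm
  rw [plugInRisk, h2, sqNorm_mulVec hΦ, h3, seqRisk, Finset.sum_add_distrib, ← Finset.mul_sum,
    add_div]
  simp only [mul_pow]
  ring

theorem sum_card_mul (𝓜 : ι → Finset (Fin p)) (w : ι → ℝ) :
    ∑ m, ((𝓜 m).card : ℝ) * w m = ∑ j, shrinkage 𝓜 w j := by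
  simp only [shrinkage]
  rw [Finset.sum_comm]
  exact Finset.sum_congr rfl fun m _ => by rw [← Finset.sum_filter]; simp

/-- The weights enter only through the shrinkage factors; the term `sqNorm y` cancels when two
weights are compared. -/
theorem mmaCriterion_eq (hΦ : Φᵀ * Φ = 1) (𝓜 : ι → Finset (Fin p)) (y : Fin n → ℝ) (s : ℝ)
    (w : ι → ℝ) :
    mmaCriterion Φ 𝓜 y s w = (sqNorm y + ∑ j, (shrinkage 𝓜 w j ^ 2 * (Φᵀ *ᵥ y) j ^ 2
      - 2 * shrinkage 𝓜 w j * (Φᵀ *ᵥ y) j ^ 2 + 2 * s * shrinkage 𝓜 w j)) / n := by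
  rw [mmaCriterion, avgHatMatrix_mulVec hΦ, sqNorm_sub_mulVec hΦ, sum_card_mul]
  have : ∑ j, (shrinkage 𝓜 w j ^ 2 * (Φᵀ *ᵥ y) j ^ 2
      - 2 * shrinkage 𝓜 w j * (Φᵀ *ᵥ y) j ^ 2 + 2 * s * shrinkage 𝓜 w j)
      = - 2 * ∑ j, (Φᵀ *ᵥ y) j * (shrinkage 𝓜 w j * (Φᵀ *ᵥ y) j)
        + ∑ j, (shrinkage 𝓜 w j * (Φᵀ *ᵥ y) j) ^ 2 + 2 * s * ∑ j, shrinkage 𝓜 w j := by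
    simp only [Finset.mul_sum]
    rw [← Finset.sum_add_distrib, ← Finset.sum_add_distrib]
    exact Finset.sum_congr rfl fun j _ => by ring
  rw [this]
  ring

theorem shrinkage_nonneg (𝓜 : ι → Finset (Fin p)) {w : ι → ℝ} (hw : ∀ m, 0 ≤ w m) (j : Fin p) :
    0 ≤ shrinkage 𝓜 w j :=
  Finset.sum_nonneg fun m _ => by split_ifs; exacts [hw m, le_rfl]

theorem shrinkage_le_one (𝓜 : ι → Finset (Fin p)) {w : ι → ℝ} (hw : w ∈ stdSimplex ℝ ι)
    (j : Fin p) : shrinkage 𝓜 w j ≤ 1 := by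
  rw [← hw.2]
  exact Finset.sum_le_sum fun m _ => by split_ifs; exacts [le_rfl, hw.1 m]

/-! ### Moments of the transformed noise -/

variable {Ω : Type*} [MeasurableSpace Ω] {μ : Measure Ω}
  {ε : Fin n → Ω → ℝ} {σ : ℝ} {η : ℝ≥0}

theorem sum_mul_score (c : Fin p → ℝ) (x : Fin n → ℝ) :
    ∑ j, c j * (Φᵀ *ᵥ x) j = ∑ i, (Φ *ᵥ c) i * x i := by
  change c ⬝ᵥ (Φᵀ *ᵥ x) = (Φ *ᵥ c) ⬝ᵥ x
  rw [Matrix.dotProduct_mulVec, Matrix.vecMul_transpose]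

theorem hasAllMoments_score (hε : IsSubgaussianNoise μ ε σ η) (j : Fin p) :
    HasAllMoments μ (fun ω => (Φᵀ *ᵥ fun i => ε i ω) j) := by
  simpa only [Matrix.mulVec, dotProduct] using hε.hasAllMoments_linear Finset.univ (fun i => Φᵀ j i)

theorem integral_sum_mul_score (hε : IsSubgaussianNoise μ ε σ η) (c : Fin p → ℝ) :
    ∫ ω, ∑ j, c j * (Φᵀ *ᵥ fun i => ε i ω) j ∂μ = 0 := by
  simp only [sum_mul_score]
  exact hε.integral_linear _ _

theorem integral_sum_mul_score_sq (hΦ : Φᵀ * Φ = 1) (hε : IsSubgaussianNoise μ ε σ η)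
    (c : Fin p → ℝ) :
    ∫ ω, (∑ j, c j * (Φᵀ *ᵥ fun i => ε i ω) j) ^ 2 ∂μ = σ ^ 2 * ∑ j, c j ^ 2 := by
  simp only [sum_mul_score]
  rw [hε.integral_linear_sq, ← sqNorm_mulVec hΦ]
  rfl

theorem integral_score_sq (hΦ : Φᵀ * Φ = 1) (hε : IsSubgaussianNoise μ ε σ η) (j : Fin p) :
    ∫ ω, (Φᵀ *ᵥ fun i => ε i ω) j ^ 2 ∂μ = σ ^ 2 := by
  simpa [Pi.single_apply] using integral_sum_mul_score_sq hΦ hε (Pi.single j 1)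

theorem integral_score (hε : IsSubgaussianNoise μ ε σ η) (j : Fin p) :
    ∫ ω, (Φᵀ *ᵥ fun i => ε i ω) j ∂μ = 0 := by
  simpa [Pi.single_apply] using integral_sum_mul_score (Φ := Φ) hε (Pi.single j 1)

variable [IsProbabilityMeasure μ]

/-- The sum is the centered quadratic form of the projection onto the columns in `I`, whose trace
and squared Frobenius norm both equal `|I|`. The scores themselves need not be independent, so the
bound is taken in the original noise. -/
theorem integral_sum_score_sq_sub_le (hΦ : Φᵀ * Φ = 1) (hε : IsSubgaussianNoise μ ε σ η)
    (I : Finset (Fin p)) :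
    ∫ ω, (∑ j ∈ I, ((Φᵀ *ᵥ fun i => ε i ω) j ^ 2 - σ ^ 2)) ^ 2 ∂μ
      ≤ (4 * σ ^ 4 + 96 * Real.exp (η / 2)) * I.card := by
  set A : Matrix (Fin n) (Fin n) ℝ := Matrix.of fun i k => ∑ j ∈ I, Φ i j * Φ k j with hA
  have hAe : ∀ i k, A i k = ∑ j ∈ I, Φ i j * Φ k j := fun _ _ => rfl
  have hsymm : ∀ i k, A i k = A k i := fun i k => by
    rw [hAe, hAe]
    exact Finset.sum_congr rfl fun j _ => mul_comm _ _
  have hq : ∀ x : Fin n → ℝ, quadForm A σ Finset.univ x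
      = ∑ j ∈ I, ((Φᵀ *ᵥ x) j ^ 2 - σ ^ 2) := by
    intro x
    have h1 : ∑ i, ∑ k, A i k * (x i * x k) = ∑ j ∈ I, (Φᵀ *ᵥ x) j ^ 2 := by
      have e : ∀ j, (Φᵀ *ᵥ x) j ^ 2 = ∑ i, ∑ k, Φ i j * Φ k j * (x i * x k) := fun j => by
        rw [sq]
        simp only [Matrix.mulVec, dotProduct, Matrix.transpose_apply]
        rw [Finset.sum_mul_sum]
        exact Finset.sum_congr rfl fun i _ => Finset.sum_congr rfl fun k _ => by ring
      simp only [e, hAe, Finset.sum_mul]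
      exact (Finset.sum_congr rfl fun i _ => Finset.sum_comm).trans Finset.sum_comm
    have h2 : ∑ i, A i i = I.card := by
      simp only [hAe]
      rw [Finset.sum_comm]
      simp [sum_mul_of_orthonormal hΦ]
    rw [quadForm, h1, h2, Finset.sum_sub_distrib]
    simp [mul_comm]
  have hsq : ∑ i, ∑ k, A i k ^ 2 = I.card := by
    have e : ∀ i k, A i k ^ 2 = ∑ j ∈ I, ∑ l ∈ I, (Φ i j * Φ i l) * (Φ k j * Φ k l) := fun i k => by
      rw [sq, hAe, Finset.sum_mul_sum]
      exact Finset.sum_congr rfl fun j _ => Finset.sum_congr rfl fun l _ => by ring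
    have e2 : ∑ j ∈ I, ∑ l ∈ I, ∑ i, ∑ k, (Φ i j * Φ i l) * (Φ k j * Φ k l) = I.card := by
      simp only [← Finset.sum_mul_sum, sum_mul_of_orthonormal hΦ]
      simp
    simp only [e]
    rw [← e2]
    refine ((Finset.sum_congr rfl fun i _ => Finset.sum_comm).trans Finset.sum_comm).trans ?_
    exact Finset.sum_congr rfl fun j _ =>
      (Finset.sum_congr rfl fun i _ => Finset.sum_comm).trans Finset.sum_comm
  have := (hε.integral_quadForm_sq_le hsymm Finset.univ).2
  simp only [hq] at this
  rwa [hsq] at this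

theorem integral_seqLoss (hΦ : Φᵀ * Φ = 1) (hε : IsSubgaussianNoise μ ε σ η) (γ θ : Fin p → ℝ) :
    ∫ ω, seqLoss γ θ (Φᵀ *ᵥ fun i => ε i ω) ∂μ = seqRisk σ γ θ := by
  have hs := fun j : Fin p => hasAllMoments_score (Φ := Φ) hε j
  have e : ∀ ω j, (γ j * (θ j + (Φᵀ *ᵥ fun i => ε i ω) j) - θ j) ^ 2
      = (1 - γ j) ^ 2 * θ j ^ 2 + (-2 * (1 - γ j) * γ j * θ j * (Φᵀ *ᵥ fun i => ε i ω) j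
        + γ j ^ 2 * (Φᵀ *ᵥ fun i => ε i ω) j ^ 2) := fun ω j => by ring
  simp only [seqLoss, seqRisk, e]
  have hi := fun j => (((hs j).const_mul (-2 * (1 - γ j) * γ j * θ j)).add
    ((hs j).pow_two.const_mul (γ j ^ 2)))
  rw [integral_finsetSum _ fun j _ => ((HasAllMoments.const _).add (hi j)).integrable]
  refine Finset.sum_congr rfl fun j _ => ?_
  rw [integral_add (integrable_const _) (hi j).integrable,
    integral_add ((hs j).const_mul _).integrable ((hs j).pow_two.const_mul _).integrable,
    integral_const_mul (-2 * (1 - γ j) * γ j * θ j), integral_const_mul (γ j ^ 2), integral_score hε, integral_score_sq hΦ hε]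
  simp [mul_comm]

theorem maRisk_eq (hΦ : Φᵀ * Φ = 1) (hf : f = Φ *ᵥ (Φᵀ *ᵥ f)) (hε : IsSubgaussianNoise μ ε σ η)
    (𝓜 : ι → Finset (Fin p)) (w : ι → ℝ) :
    maRisk μ Φ 𝓜 f ε w = seqRisk σ (shrinkage 𝓜 w) (Φᵀ *ᵥ f) / n := by
  simp only [maRisk, maLoss_eq hΦ hf, integral_div, integral_seqLoss hΦ hε]

end ModelAvg

/-! ### Grouped coefficients -/

namespace ModelAvg

/-- The sum of `F j` over the coefficients `j < t`. -/
def partialSum {p : ℕ} (F : Fin p → ℝ) (t : ℕ) : ℝ :=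
  ∑ j ∈ Finset.univ.filter (fun j : Fin p => (j : ℕ) < t), F j

theorem partialSum_sub {p : ℕ} (F : Fin p → ℝ) {a b : ℕ} (hab : a ≤ b) :
    partialSum F b - partialSum F a
      = ∑ j ∈ Finset.univ.filter (fun j : Fin p => a ≤ (j : ℕ) ∧ (j : ℕ) < b), F j := by
  simp only [partialSum, Finset.sum_filter]
  rw [← Finset.sum_sub_distrib]
  refine Finset.sum_congr rfl fun j _ => ?_
  by_cases h1 : (j : ℕ) < a
  · simp [h1, h1.trans_le hab]
  · simp [h1, not_lt.1 h1]

theorem partialSum_of_le {p : ℕ} (F : Fin p → ℝ) {t : ℕ} (h : p ≤ t) :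
    partialSum F t = ∑ j, F j := by
  unfold partialSum
  rw [Finset.filter_true_of_mem fun j _ => j.2.trans_le h]

theorem partialSum_zero {p : ℕ} (F : Fin p → ℝ) : partialSum F 0 = 0 := by simp [partialSum]

theorem partialSum_one {p t : ℕ} (h : t ≤ p) : partialSum (fun _ : Fin p => (1 : ℝ)) t = t := by
  have : Finset.card (Finset.univ.filter (fun j : Fin p => (j : ℕ) < t)) = t := by
    rw [Fin.card_filter_val_lt]
    omega
  simp [partialSum, this]

/-- Sizes `0 = k 0 < k 1 < ⋯ < k M = p` of nested models. -/
structure IsModelSizes (p M : ℕ) (k : ℕ → ℕ) : Prop where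
  pos : 1 ≤ M
  zero : k 0 = 0
  lt : ∀ m < M, k m < k (m + 1)
  last : k M = p

/-- The coefficient vector `c` has the constant value `γ g` on the `g`-th group. -/
def GroupConst {p : ℕ} (M : ℕ) (k : ℕ → ℕ) (γ : ℕ → ℝ) (c : Fin p → ℝ) : Prop :=
  ∀ g < M, ∀ j : Fin p, k g ≤ j → (j : ℕ) < k (g + 1) → c j = γ g

variable {p M : ℕ} {k : ℕ → ℕ}

namespace IsModelSizes

theorem le (hk : IsModelSizes p M k) {i j : ℕ} (hij : i ≤ j) (hj : j ≤ M) : k i ≤ k j := by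
  induction j, hij using Nat.le_induction with
  | base => exact le_rfl
  | succ j _ ih => exact (ih (by omega)).trans (hk.lt j (by omega)).le

theorem le_p (hk : IsModelSizes p M k) {j : ℕ} (hj : j ≤ M) : k j ≤ p :=
  hk.last ▸ hk.le hj le_rfl

theorem one_le (hk : IsModelSizes p M k) {j : ℕ} (h1 : 1 ≤ j) (hj : j ≤ M) : 1 ≤ k j :=
  (Nat.succ_le_of_lt (hk.zero ▸ hk.lt 0 hk.pos)).trans (hk.le h1 hj)

theorem exists_group (hk : IsModelSizes p M k) (j : Fin p) :
    ∃ g < M, k g ≤ j ∧ (j : ℕ) < k (g + 1) := by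
  have h : ∃ m, (j : ℕ) < k m := ⟨M, hk.last ▸ j.2⟩
  have h0 : Nat.find h ≠ 0 := fun h0 => by
    have := Nat.find_spec h
    rw [h0, hk.zero] at this
    omega
  have hM : Nat.find h ≤ M := Nat.find_min' h (hk.last ▸ j.2)
  refine ⟨Nat.find h - 1, by omega, not_lt.1 (Nat.find_min h (by omega)), ?_⟩
  rw [Nat.sub_add_cancel (by omega)]
  exact Nat.find_spec h

end IsModelSizes

theorem GroupConst.sum_mul (hk : IsModelSizes p M k) {γ : ℕ → ℝ} {c : Fin p → ℝ}
    (hc : GroupConst M k γ c) (F : Fin p → ℝ) :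
    ∑ j, c j * F j
      = ∑ g ∈ Finset.range M, γ g * (partialSum F (k (g + 1)) - partialSum F (k g)) := by
  have key : ∀ m ≤ M, partialSum (fun j => c j * F j) (k m)
      = ∑ g ∈ Finset.range m, γ g * (partialSum F (k (g + 1)) - partialSum F (k g)) := by
    intro m hm
    induction m with
    | zero => simp [hk.zero, partialSum_zero]
    | succ m ih =>
      rw [Finset.sum_range_succ, ← ih (by omega), partialSum_sub _ (hk.lt m (by omega)).le,
        Finset.mul_sum, ← sub_eq_iff_eq_add', partialSum_sub _ (hk.lt m (by omega)).le]
      refine Finset.sum_congr rfl fun j hj => ?_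
      have := (Finset.mem_filter.1 hj).2
      rw [hc m (by omega) j this.1 this.2]
  rw [← key M le_rfl, hk.last, partialSum_of_le _ le_rfl]

theorem GroupConst.comp {γ : ℕ → ℝ} {c : Fin p → ℝ} (hc : GroupConst M k γ c) (φ : ℝ → ℝ) :
    GroupConst M k (fun g => φ (γ g)) (fun j => φ (c j)) :=
  fun g hg j h1 h2 => congrArg φ (hc g hg j h1 h2)

/-- The total weight of the models which contain the `g`-th group. -/
def groupWeight {M : ℕ} (w : Fin M → ℝ) (g : ℕ) : ℝ := ∑ m : Fin M, if g ≤ m then w m else 0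

/-- With models numbered from 0, model `m` has size `k (m + 1)`, so it contains group `g` exactly
when `g ≤ m`. -/
theorem groupConst_shrinkage (hk : IsModelSizes p M k) (w : Fin M → ℝ) :
    GroupConst M k (groupWeight w) (shrinkage (nestedModels p M k) w) := by
  intro g hg j h1 h2
  refine Finset.sum_congr rfl fun m _ => ?_
  have : j ∈ nestedModels p M k m ↔ g ≤ m := by
    simp only [nestedModels, Finset.mem_filter, Finset.mem_univ, true_and]
    constructor
    · intro h
      by_contra hlt
      have := hk.le (show (m : ℕ) + 1 ≤ g by omega) hg.le
      omega
    · intro h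
      exact h2.trans_le (hk.le (by omega) (by omega))
  simp [this]

theorem groupWeight_anti {w : Fin M → ℝ} (hw : ∀ m, 0 ≤ w m) : Antitone (groupWeight w) := by
  intro i j h
  refine Finset.sum_le_sum fun m _ => ?_
  split_ifs with h1 h2
  · exact le_rfl
  · omega
  · exact hw m
  · exact le_rfl

theorem groupWeight_nonneg {w : Fin M → ℝ} (hw : ∀ m, 0 ≤ w m) (g : ℕ) : 0 ≤ groupWeight w g :=
  Finset.sum_nonneg fun m _ => by split_ifs; exacts [hw m, le_rfl]

theorem groupWeight_le_one {w : Fin M → ℝ} (hw : w ∈ stdSimplex ℝ (Fin M)) (g : ℕ) :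
    groupWeight w g ≤ 1 := by
  rw [← hw.2]
  exact Finset.sum_le_sum fun m _ => by split_ifs; exacts [le_rfl, hw.1 m]

/-- Every nonincreasing sequence which starts at `1` consists of group weights. -/
theorem exists_groupWeight_eq (hM : 1 ≤ M) {γ : ℕ → ℝ} (h0 : γ 0 = 1)
    (hγ : ∀ i j, i ≤ j → j < M → γ j ≤ γ i) (hγ0 : ∀ g, g < M → 0 ≤ γ g) :
    ∃ w ∈ stdSimplex ℝ (Fin M), ∀ g < M, groupWeight w g = γ g := by
  set γ' : ℕ → ℝ := fun g => if g < M then γ g else 0 with hγ'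
  have hsum : ∀ g ≤ M, groupWeight (fun m : Fin M => γ' m - γ' (m + 1)) g = γ' g := by
    intro g hg
    unfold groupWeight
    rw [Fin.sum_univ_eq_sum_range (fun m => if g ≤ m then γ' m - γ' (m + 1) else 0),
      ← Finset.sum_filter]
    have : (Finset.range M).filter (fun m => g ≤ m) = Finset.Ico g M := by
      ext m; simp; tauto
    rw [this, Finset.sum_Ico_eq_sub _ hg, Finset.sum_range_sub', Finset.sum_range_sub']
    simp [hγ']
  refine ⟨fun m => γ' m - γ' (m + 1), ⟨fun m => ?_, ?_⟩, fun g hg => ?_⟩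
  · simp only [hγ', m.2, if_true]
    split_ifs with h
    · exact sub_nonneg.2 (hγ _ _ (by omega) h)
    · rw [sub_zero]; exact hγ0 _ m.2
  · have := hsum 0 (by omega)
    simp only [groupWeight, Nat.zero_le, if_true] at this
    rw [this]
    simp [hγ', h0, show 0 < M by omega]
  · rw [hsum g hg.le]
    simp [hγ', hg]

/-! ### The complexity `ψ` -/

theorem sum_Icc_one (F : ℕ → ℝ) (m : ℕ) :
    ∑ j ∈ Finset.Icc 1 m, F j = ∑ g ∈ Finset.range m, F (g + 1) := by
  induction m with
  | zero => simp
  | succ m ih => rw [Finset.sum_Icc_succ_top (by omega), ih, Finset.sum_range_succ]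

theorem tailSum_nonneg (θ : Fin p → ℝ) (M : ℕ) (k : ℕ → ℕ) (j : ℕ) : 0 ≤ tailSum θ M k j :=
  Finset.sum_nonneg fun _ _ => sq_nonneg _

theorem tailSum_eq (hk : IsModelSizes p M k) (θ : Fin p → ℝ) {j : ℕ} (hj : j ≤ M) :
    tailSum θ M k j = partialSum (fun l => θ l ^ 2) (k M) - partialSum (fun l => θ l ^ 2) (k j) :=
  (partialSum_sub _ (hk.le hj le_rfl)).symm

theorem tailSum_anti (hk : IsModelSizes p M k) (θ : Fin p → ℝ) {i j : ℕ} (hij : i ≤ j)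
    (hj : j ≤ M) : tailSum θ M k j ≤ tailSum θ M k i := by
  refine Finset.sum_le_sum_of_subset_of_nonneg (fun l hl => ?_) fun _ _ _ => sq_nonneg _
  have := hk.le hij hj
  simp only [Finset.mem_filter, Finset.mem_univ, true_and] at hl ⊢
  omega

theorem tailSum_last (θ : Fin p → ℝ) (M : ℕ) (k : ℕ → ℕ) : tailSum θ M k M = 0 := by
  unfold tailSum
  rw [Finset.filter_false_of_mem fun l _ => by omega, Finset.sum_empty]

theorem sum_sub_div_le_card {a : ℕ → ℝ} (b : ℕ → ℝ) (M : ℕ) (ha : ∀ g < M, 0 ≤ a g)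
    (hb : ∀ g < M, 0 ≤ b g) :
    ∑ g ∈ Finset.range M, (b g - a g) / b g ≤ M := by
  calc _ ≤ ∑ g ∈ Finset.range M, (1 : ℝ) := by
        refine Finset.sum_le_sum fun g hg => div_le_one_of_le₀ ?_ (hb g (Finset.mem_range.1 hg))
        linarith [ha g (Finset.mem_range.1 hg)]
    _ = M := by simp

theorem sum_size_ratio_le (hk : IsModelSizes p M k) :
    ∑ g ∈ Finset.range M, ((k (g + 1) : ℝ) - k g) / k (g + 1)
      ≤ 1 + 4 * ∑ j ∈ Finset.Icc 1 (M - 1), ((k (j + 1) : ℝ) - k j) / (4 * k j) := by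
  obtain ⟨m, rfl⟩ : ∃ m, M = m + 1 := ⟨M - 1, by have := hk.pos; omega⟩
  rw [Finset.sum_range_succ', add_comm, Nat.add_sub_cancel, sum_Icc_one, Finset.mul_sum]
  refine add_le_add ?_ (Finset.sum_le_sum fun g hg => ?_)
  · exact div_le_one_of_le₀ (by simp) (by positivity)
  · have hg := Finset.mem_range.1 hg
    have h1 : (1 : ℝ) ≤ k (g + 1) := by exact_mod_cast hk.one_le (by omega) (by omega)
    have h2 : (k (g + 1) : ℝ) ≤ k (g + 1 + 1) := by exact_mod_cast (hk.lt (g + 1) (by omega)).le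
    have e : 4 * (((k (g + 1 + 1) : ℝ) - k (g + 1)) / (4 * k (g + 1)))
        = ((k (g + 1 + 1) : ℝ) - k (g + 1)) / k (g + 1) := by
      field_simp
    rw [e]
    exact div_le_div_of_nonneg_left (by linarith) (by linarith) h2

/-- Beyond `tailIndex` the tail sums vanish and the quotients are `0 / 0 = 0`. The term at the first
zero tail is at most 1; in the others the denominator may be replaced by the next, smaller tail sum.
-/
theorem sum_tail_ratio_le (hk : IsModelSizes p M k) (θ : Fin p → ℝ) :
    ∑ g ∈ Finset.range M, (tailSum θ M k g - tailSum θ M k (g + 1)) / tailSum θ M k g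
      ≤ 1 + 4 * ∑ j ∈ Finset.Icc 1 (tailIndex θ M k - 1),
            (tailSum θ M k (j - 1) - tailSum θ M k j) / (4 * tailSum θ M k j) := by
  have hne : {j : ℕ | 1 ≤ j ∧ j ≤ M ∧ tailSum θ M k j = 0}.Nonempty :=
    ⟨M, hk.pos, le_rfl, tailSum_last θ M k⟩
  obtain ⟨h1, h2, h3⟩ := Nat.sInf_mem hne
  change 1 ≤ tailIndex θ M k at h1
  change tailIndex θ M k ≤ M at h2
  change tailSum θ M k (tailIndex θ M k) = 0 at h3
  have hpos : ∀ j, 1 ≤ j → j < tailIndex θ M k → 0 < tailSum θ M k j := by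
    intro j hj hlt
    refine (tailSum_nonneg θ M k j).lt_of_ne fun h => Nat.notMem_of_lt_sInf hlt ⟨hj, by omega, h.symm⟩
  obtain ⟨m, hm⟩ : ∃ m, tailIndex θ M k = m + 1 := ⟨tailIndex θ M k - 1, by omega⟩
  rw [hm] at h2 h3 hpos ⊢
  have htrunc : ∑ g ∈ Finset.range M, (tailSum θ M k g - tailSum θ M k (g + 1)) / tailSum θ M k g
      = ∑ g ∈ Finset.range (m + 1),
        (tailSum θ M k g - tailSum θ M k (g + 1)) / tailSum θ M k g := by
    refine (Finset.sum_subset (Finset.range_subset_range.2 h2) fun g hg h => ?_).symm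
    have hg := Finset.mem_range.1 hg
    have h := not_lt.1 (fun h' => h (Finset.mem_range.2 h'))
    have : tailSum θ M k g = 0 :=
      le_antisymm (h3 ▸ tailSum_anti hk θ h hg.le) (tailSum_nonneg _ _ _ _)
    rw [this, div_zero]
  rw [htrunc, Finset.sum_range_succ, add_comm, Nat.add_sub_cancel, sum_Icc_one, Finset.mul_sum]
  refine add_le_add ?_ (Finset.sum_le_sum fun g hg => ?_)
  · refine div_le_one_of_le₀ ?_ (tailSum_nonneg _ _ _ _)
    linarith [tailSum_nonneg θ M k (m + 1)]
  · have hg := Finset.mem_range.1 hg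
    have h4 := hpos (g + 1) (by omega) (by omega)
    have h5 := tailSum_anti hk θ (show g ≤ g + 1 by omega) (by omega)
    have e : 4 * ((tailSum θ M k (g + 1 - 1) - tailSum θ M k (g + 1)) / (4 * tailSum θ M k (g + 1)))
        = (tailSum θ M k g - tailSum θ M k (g + 1)) / tailSum θ M k (g + 1) := by
      rw [Nat.add_sub_cancel]
      field_simp
    rw [e]
    exact div_le_div_of_nonneg_left (by linarith) h4 h5

/-- Each relative increment is at most 1, so the two sums together are at most `2M`; they are also
at most `2` plus four times the sums in `psi`. Both bounds are within a factor 4 of the minimum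
there. -/
theorem sum_ratio_add_le_psi (hk : IsModelSizes p M k) (θ : Fin p → ℝ) :
    (1 + Real.log M) ^ 2 * (∑ g ∈ Finset.range M, ((k (g + 1) : ℝ) - k g) / k (g + 1)
      + ∑ g ∈ Finset.range M, (tailSum θ M k g - tailSum θ M k (g + 1)) / tailSum θ M k g)
      ≤ 4 * psi θ M k := by
  have h1 := sum_size_ratio_le hk
  have h2 := sum_tail_ratio_le hk θ
  have h3 := sum_sub_div_le_card (a := fun g => (k g : ℝ)) (fun g => (k (g + 1) : ℝ)) M
    (fun _ _ => by positivity) (fun _ _ => by positivity)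
  have h4 := sum_sub_div_le_card (a := fun g => tailSum θ M k (g + 1)) (fun g => tailSum θ M k g) M
    (fun _ _ => tailSum_nonneg _ _ _ _) (fun _ _ => tailSum_nonneg _ _ _ _)
  rw [psi, mul_comm _ ((1 + Real.log M) ^ 2), mul_left_comm]
  refine mul_le_mul_of_nonneg_left ?_ (sq_nonneg _)
  have hM : (0 : ℝ) ≤ M := Nat.cast_nonneg _
  rcases min_cases (M : ℝ) (1 + ∑ j ∈ Finset.Icc 1 (M - 1), ((k (j + 1) : ℝ) - k j) / (4 * k j)
        + ∑ j ∈ Finset.Icc 1 (tailIndex θ M k - 1),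
            (tailSum θ M k (j - 1) - tailSum θ M k j) / (4 * tailSum θ M k j))
    with h | h <;> rw [h.1] <;> linarith

theorem tailSum_div (θ : Fin p → ℝ) (c : ℝ) (M : ℕ) (k : ℕ → ℕ) (j : ℕ) :
    tailSum (fun l => θ l / c) M k j = tailSum θ M k j / c ^ 2 := by
  simp only [tailSum, div_pow, Finset.sum_div]

/-- `psi` depends on the coefficients only through ratios of tail sums, so the normalization by `√n`
is immaterial. -/
theorem psi_div (θ : Fin p → ℝ) {c : ℝ} (hc : c ≠ 0) (M : ℕ) (k : ℕ → ℕ) :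
    psi (fun l => θ l / c) M k = psi θ M k := by
  have h1 : tailIndex (fun l => θ l / c) M k = tailIndex θ M k := by
    simp [tailIndex, tailSum_div, hc]
  simp only [psi, h1, tailSum_div]
  congr 3
  refine Finset.sum_congr rfl fun j _ => ?_
  rw [← sub_div, ← mul_div_assoc, div_div_div_cancel_right₀ (pow_ne_zero 2 hc)]

end ModelAvg

/-! ### Remainder terms of nested model averaging -/

namespace ModelAvg

variable {n p M : ℕ} {k : ℕ → ℕ} {Φ : Matrix (Fin n) (Fin p) ℝ} {Ω : Type*} [MeasurableSpace Ω]
  {μ : Measure Ω} {ε : Fin n → Ω → ℝ} {σ : ℝ} {η : ℝ≥0}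

/-- Bias weights such as `1 - γ` increase with the group index. Reading the groups backwards makes
them decrease, and the increments of the reversed process have variance `σ²` times increments of the
tail sums. -/
theorem exists_bias_remainder (hΦ : Φᵀ * Φ = 1) (hε : IsSubgaussianNoise μ ε σ η)
    (hk : IsModelSizes p M k) (θ : Fin p → ℝ) :
    ∃ T : Ω → ℝ, Integrable T μ ∧ (∀ ω, 0 ≤ T ω) ∧
      ∫ ω, T ω ∂μ ≤ 4 * σ ^ 2 * (1 + Real.log M) ^ 2
        * ∑ g ∈ Finset.range M,
          (tailSum θ M k g - tailSum θ M k (g + 1)) / tailSum θ M k g ∧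
      ∀ ω δ, 0 < δ → ∀ (γ : ℕ → ℝ) (c : Fin p → ℝ), (∀ i j, i ≤ j → j < M → γ i ≤ γ j) →
        (∀ g, g < M → 0 ≤ γ g) → GroupConst M k γ c →
        |∑ j, c j * (θ j * (Φᵀ *ᵥ fun i => ε i ω) j)|
          ≤ δ * ∑ j, c j ^ 2 * θ j ^ 2 + T ω / (4 * δ) := by
  set P : Ω → ℕ → ℝ := fun ω => partialSum (fun j => θ j * (Φᵀ *ᵥ fun i => ε i ω) j) with hP
  have hmom : ∀ t, HasAllMoments μ (fun ω => P ω t) := fun t =>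
    HasAllMoments.sum _ fun j _ => (hasAllMoments_score hε j).const_mul _
  have hvar : ∀ a b, a ≤ b → ∫ ω, (P ω b - P ω a) ^ 2 ∂μ
      = σ ^ 2 * (partialSum (fun j => θ j ^ 2) b - partialSum (fun j => θ j ^ 2) a) := by
    intro a b hab
    have := integral_sum_mul_score_sq hΦ hε
      (fun j => if a ≤ (j : ℕ) ∧ (j : ℕ) < b then θ j else 0)
    simp only [ite_mul, zero_mul, ite_pow, ne_eq, OfNat.ofNat_ne_zero, not_false_eq_true, zero_pow,
      ← Finset.sum_filter, ← partialSum_sub _ hab] at this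
    exact this
  have hreflect : ∀ G : ℕ → ℕ → ℝ, ∑ h ∈ Finset.range M, G (M - h) (M - (h + 1))
      = ∑ g ∈ Finset.range M, G (g + 1) g := by
    intro G
    rw [← Finset.sum_range_reflect]
    refine Finset.sum_congr rfl fun g hg => ?_
    have := Finset.mem_range.1 hg
    congr 1 <;> omega
  obtain ⟨T, h1, h2, h3, h4⟩ := exists_remainder_antitone (μ := μ) hk.pos
    (N := fun h ω => P ω (k M) - P ω (k (M - h)))
    (b := fun h => tailSum θ M k (M - h)) (C := σ ^ 2) (by positivity)
    (fun i j hij hj => tailSum_anti hk θ (by omega) (by omega))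
    (by simp [tailSum_last])
    -- A vanishing tail sum forces the coefficients there to vanish, hence also the process.
    (fun h hh h0 ω => by
      have hz : ∀ l : Fin p, k (M - (h + 1)) ≤ (l : ℕ) → (l : ℕ) < k M → θ l = 0 := by
        intro l hl1 hl2
        have := (Finset.sum_eq_zero_iff_of_nonneg (fun _ _ => sq_nonneg _)).1 h0 l (by simp [hl1, hl2])
        exact pow_eq_zero_iff (two_ne_zero) |>.1 this
      have hP0 : ∀ h' ≤ h + 1, P ω (k M) - P ω (k (M - h')) = 0 := by
        intro h' hh'
        rw [hP, partialSum_sub _ (hk.le (by omega) le_rfl)]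
        refine Finset.sum_eq_zero fun l hl => ?_
        have hl := (Finset.mem_filter.1 hl).2
        have : k (M - (h + 1)) ≤ k (M - h') := hk.le (by omega) (by omega)
        rw [hz l (by omega) hl.2, zero_mul]
      rw [hP0 _ le_rfl, hP0 _ (by omega)])
    (fun i j _ _ => (((hmom _).sub (hmom _)).sub ((hmom _).sub (hmom _))).pow_two.integrable)
    (fun i j hij hj => by
      have e : ∀ ω, P ω (k M) - P ω (k (M - j)) - (P ω (k M) - P ω (k (M - i)))
          = P ω (k (M - i)) - P ω (k (M - j)) := fun ω => by ring
      simp only [e]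
      rw [hvar _ _ (hk.le (by omega) (by omega)), tailSum_eq hk θ (by omega),
        tailSum_eq hk θ (by omega)]
      apply le_of_eq
      ring)
  refine ⟨T, h1, h2, ?_, fun ω δ hδ γ c hγ hγ0 hc => ?_⟩
  · rwa [hreflect (fun a b => (tailSum θ M k b - tailSum θ M k a) / tailSum θ M k b)] at h3
  · have := h4 ω δ hδ (fun h => γ (M - (h + 1))) (fun i j hij hj => hγ _ _ (by omega) (by omega))
      (fun g hg => hγ0 _ (by omega))
    rw [hreflect (fun a b => γ b * ((P ω (k M) - P ω (k b)) - (P ω (k M) - P ω (k a)))),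
      hreflect (fun a b => γ b ^ 2 * (tailSum θ M k b - tailSum θ M k a))] at this
    have e1 := hc.sum_mul hk (fun j => θ j * (Φᵀ *ᵥ fun i => ε i ω) j)
    have e2 := (hc.comp (· ^ 2)).sum_mul hk (fun j => θ j ^ 2)
    rw [e1, e2]
    convert this using 3
    · simp only [hP]
      ring
    · refine Finset.sum_congr rfl fun g hg => ?_
      have hg := Finset.mem_range.1 hg
      rw [tailSum_eq hk θ hg.le, tailSum_eq hk θ (show g + 1 ≤ M by omega)]
      ring

variable [IsProbabilityMeasure μ]

/-- The maximal inequality in the natural order of the groups, with the model sizes as `b`: the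
second moments of the increments are linear in the number of coefficients. -/
theorem exists_variance_remainder (hΦ : Φᵀ * Φ = 1) (hε : IsSubgaussianNoise μ ε σ η)
    (hk : IsModelSizes p M k) :
    ∃ T : Ω → ℝ, Integrable T μ ∧ (∀ ω, 0 ≤ T ω) ∧
      ∫ ω, T ω ∂μ ≤ 4 * (4 * σ ^ 4 + 96 * Real.exp (η / 2)) * (1 + Real.log M) ^ 2
        * ∑ g ∈ Finset.range M, ((k (g + 1) : ℝ) - k g) / k (g + 1) ∧
      ∀ ω δ, 0 < δ → ∀ (γ : ℕ → ℝ) (c : Fin p → ℝ), (∀ i j, i ≤ j → j < M → γ j ≤ γ i) →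
        (∀ g, g < M → 0 ≤ γ g) → GroupConst M k γ c →
        |∑ j, c j * ((Φᵀ *ᵥ fun i => ε i ω) j ^ 2 - σ ^ 2)|
          ≤ δ * ∑ j, c j ^ 2 + T ω / (4 * δ) := by
  have hmom : ∀ t, HasAllMoments μ
      (fun ω => partialSum (fun j => (Φᵀ *ᵥ fun i => ε i ω) j ^ 2 - σ ^ 2) t) := fun t =>
    HasAllMoments.sum _ fun j _ => (hasAllMoments_score hε j).pow_two.sub (HasAllMoments.const _)
  obtain ⟨T, h1, h2, h3, h4⟩ := exists_remainder_antitone (μ := μ) hk.pos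
    (N := fun m ω => partialSum (fun j => (Φᵀ *ᵥ fun i => ε i ω) j ^ 2 - σ ^ 2) (k m))
    (b := fun m => (k m : ℝ)) (C := 4 * σ ^ 4 + 96 * Real.exp (η / 2)) (by positivity)
    (fun i j hij hj => by exact_mod_cast hk.le hij hj) (by simp [hk.zero])
    (fun g hg h0 => by
      have := hk.one_le (j := g + 1) (by omega) (by omega)
      have h0 : k (g + 1) = 0 := by exact_mod_cast h0
      omega)
    (fun i j _ _ => ((hmom _).sub (hmom _)).pow_two.integrable)
    (fun i j hij hj => by
      simp only [partialSum_sub _ (hk.le hij hj)]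
      refine (integral_sum_score_sq_sub_le hΦ hε _).trans (le_of_eq ?_)
      congr 1
      have := partialSum_sub (fun _ : Fin p => (1 : ℝ)) (hk.le hij hj)
      rw [partialSum_one (hk.le_p hj), partialSum_one (hk.le_p (hij.trans hj))] at this
      rw [this]
      simp)
  refine ⟨T, h1, h2, h3, fun ω δ hδ γ c hγ hγ0 hc => ?_⟩
  have := h4 ω δ hδ γ hγ hγ0
  rw [← hc.sum_mul hk] at this
  have hsq : ∑ j, c j ^ 2 = ∑ g ∈ Finset.range M, γ g ^ 2 * ((k (g + 1) : ℝ) - k g) := by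
    have := (hc.comp (· ^ 2)).sum_mul hk (fun _ => 1)
    simp only [mul_one] at this
    rw [this]
    refine Finset.sum_congr rfl fun g hg => ?_
    have hg := Finset.mem_range.1 hg
    rw [partialSum_one (hk.le_p (by omega)), partialSum_one (hk.le_p hg.le)]
  rwa [hsq]

/-- The remainder constant of the oracle inequality. -/
noncomputable def remainderConst (σ : ℝ) (η : ℝ≥0) : ℝ :=
  16 * ((4 * σ ^ 4 + 96 * Real.exp (η / 2)) / σ ^ 2 + σ ^ 2)

/-- The noise terms of nested model averaging are controlled by a fraction of the risk, uniformly
in the weights. -/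
theorem exists_nested_remainder (hΦ : Φᵀ * Φ = 1) (hε : IsSubgaussianNoise μ ε σ η)
    (hσ : 0 < σ) (hk : IsModelSizes p M k) (θ : Fin p → ℝ) :
    ∃ W : Ω → ℝ, Integrable W μ ∧ (∀ ω, 0 ≤ W ω) ∧
      ∫ ω, W ω ∂μ ≤ remainderConst σ η * psi θ M k ∧
      ∀ w ∈ stdSimplex ℝ (Fin M), ∀ ω δ, 0 < δ →
        |seqLoss (shrinkage (nestedModels p M k) w) θ (Φᵀ *ᵥ fun i => ε i ω)
            - seqRisk σ (shrinkage (nestedModels p M k) w) θ|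
          ≤ 5 * δ * seqRisk σ (shrinkage (nestedModels p M k) w) θ + W ω / δ ∧
        2 * (∑ j, shrinkage (nestedModels p M k) w j * ((Φᵀ *ᵥ fun i => ε i ω) j ^ 2 - σ ^ 2))
          - 2 * (∑ j, (1 - shrinkage (nestedModels p M k) w j)
            * (θ j * (Φᵀ *ᵥ fun i => ε i ω) j))
          ≤ 2 * δ * seqRisk σ (shrinkage (nestedModels p M k) w) θ + W ω / δ := by
  obtain ⟨T, hT1, hT2, hT3, hT4⟩ := exists_variance_remainder (μ := μ) hΦ hε hk
  obtain ⟨U, hU1, hU2, hU3, hU4⟩ := exists_bias_remainder (μ := μ) hΦ hε hk θ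
  have hσ2 : 0 < σ ^ 2 := by positivity
  refine ⟨fun ω => T ω / σ ^ 2 + U ω, (hT1.div_const _).add hU1,
    fun ω => add_nonneg (div_nonneg (hT2 ω) hσ2.le) (hU2 ω), ?_, ?_⟩
  · rw [integral_add (hT1.div_const _) hU1, integral_div]
    have h1 := div_le_div_of_nonneg_right hT3 hσ2.le
    have h2 := sum_ratio_add_le_psi hk θ
    set V1 := ∑ g ∈ Finset.range M, ((k (g + 1) : ℝ) - k g) / k (g + 1)
    set V2 := ∑ g ∈ Finset.range M, (tailSum θ M k g - tailSum θ M k (g + 1)) / tailSum θ M k g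
    have hV1 : 0 ≤ V1 := Finset.sum_nonneg fun g hg => div_nonneg (sub_nonneg.2
      (by exact_mod_cast (hk.lt g (Finset.mem_range.1 hg)).le)) (Nat.cast_nonneg _)
    have hV2 : 0 ≤ V2 := Finset.sum_nonneg fun g hg => div_nonneg (sub_nonneg.2
      (tailSum_anti hk θ (Nat.le_succ g) (Finset.mem_range.1 hg))) (tailSum_nonneg _ _ _ _)
    set K := 4 * σ ^ 4 + 96 * Real.exp (η / 2) with hK
    have hK0 : 0 ≤ K / σ ^ 2 := by positivity
    set l := (1 + Real.log M) ^ 2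
    have hl : 0 ≤ l := sq_nonneg _
    have e : 4 * K * l * V1 / σ ^ 2 = 4 * (K / σ ^ 2) * (l * V1) := by ring
    rw [e] at h1
    have h3 : 4 * (K / σ ^ 2) * (l * V1) + 4 * σ ^ 2 * l * V2
        ≤ 4 * (K / σ ^ 2 + σ ^ 2) * (l * (V1 + V2)) := by
      have a1 := mul_nonneg hσ2.le (mul_nonneg hl hV1)
      have a2 := mul_nonneg hK0 (mul_nonneg hl hV2)
      linarith
    have h4 := mul_le_mul_of_nonneg_left h2 (show 0 ≤ 4 * (K / σ ^ 2 + σ ^ 2) by positivity)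
    rw [remainderConst, ← hK]
    linarith
  · intro w hw ω δ hδ
    set γ := shrinkage (nestedModels p M k) w with hγ
    set e := Φᵀ *ᵥ fun i => ε i ω with he
    have hG := groupConst_shrinkage hk w
    have hanti := groupWeight_anti hw.1
    have hnn := groupWeight_nonneg hw.1
    have hle := groupWeight_le_one hw
    have hγ0 : ∀ j, 0 ≤ γ j := shrinkage_nonneg _ hw.1
    have hγ1 : ∀ j, γ j ≤ 1 := shrinkage_le_one _ hw
    have hδσ : 0 < δ * σ ^ 2 := by positivity
    -- The criterion noise involves `γ` and `1 - γ`, the loss also their squares. All four are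
    -- monotone with values in `[0, 1]`, so the fourth powers arising from the squares are at most
    -- the squares. The factor `σ ^ 2` matches the variance part of the risk.
    have A1 := hT4 ω (δ * σ ^ 2) hδσ _ _ (fun i j h _ => hanti h) (fun g _ => hnn g) hG
    have A2 := hT4 ω (δ * σ ^ 2) hδσ _ _
      (fun i j h _ => pow_le_pow_left₀ (hnn _) (hanti h) 2) (fun g _ => sq_nonneg _)
      (hG.comp (· ^ 2))
    have B1 := hU4 ω δ hδ _ _ (fun i j h _ => sub_le_sub_left (hanti h) 1)
      (fun g _ => sub_nonneg.2 (hle g)) (hG.comp (1 - ·))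
    have B2 := hU4 ω δ hδ _ _
      (fun i j h _ => pow_le_pow_left₀ (sub_nonneg.2 (hle _)) (sub_le_sub_left (hanti h) 1) 2)
      (fun g _ => sq_nonneg _) (hG.comp (fun x => (1 - x) ^ 2))
    simp only [← hγ, ← he] at A1 A2 B1 B2
    have A3 : ∑ j, (γ j ^ 2) ^ 2 ≤ ∑ j, γ j ^ 2 := Finset.sum_le_sum fun j _ =>
      pow_le_of_le_one (sq_nonneg _) (pow_le_one₀ (hγ0 j) (hγ1 j)) two_ne_zero
    have B3 : ∑ j, ((1 - γ j) ^ 2) ^ 2 * θ j ^ 2 ≤ ∑ j, (1 - γ j) ^ 2 * θ j ^ 2 :=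
      Finset.sum_le_sum fun j _ => mul_le_mul_of_nonneg_right
        (pow_le_of_le_one (sq_nonneg _) (pow_le_one₀ (sub_nonneg.2 (hγ1 j))
          (by linarith [hγ0 j])) two_ne_zero) (sq_nonneg _)
    have hR : seqRisk σ γ θ = ∑ j, (1 - γ j) ^ 2 * θ j ^ 2 + σ ^ 2 * ∑ j, γ j ^ 2 := by
      rw [seqRisk, Finset.sum_add_distrib, Finset.mul_sum]
    have hL : seqLoss γ θ e - seqRisk σ γ θ = ∑ j, γ j ^ 2 * (e j ^ 2 - σ ^ 2)
        - 2 * ∑ j, (1 - γ j) * (θ j * e j) + 2 * ∑ j, (1 - γ j) ^ 2 * (θ j * e j) := by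
      rw [seqLoss, seqRisk, Finset.mul_sum, Finset.mul_sum, ← Finset.sum_sub_distrib,
        ← Finset.sum_sub_distrib, ← Finset.sum_add_distrib]
      exact Finset.sum_congr rfl fun j _ => by ring
    have hA0 : 0 ≤ ∑ j, γ j ^ 2 := Finset.sum_nonneg fun _ _ => sq_nonneg _
    have hB0 : 0 ≤ ∑ j, (1 - γ j) ^ 2 * θ j ^ 2 := Finset.sum_nonneg fun _ _ => by positivity
    have hA3 := mul_le_mul_of_nonneg_left A3 hδσ.le
    have hB3 := mul_le_mul_of_nonneg_left B3 hδ.le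
    have e1 : T ω / (4 * (δ * σ ^ 2)) = T ω / σ ^ 2 / δ / 4 := by field_simp
    have e2 : U ω / (4 * δ) = U ω / δ / 4 := by field_simp
    have t0 : 0 ≤ T ω / σ ^ 2 / δ := div_nonneg (div_nonneg (hT2 ω) hσ2.le) hδ.le
    have u0 : 0 ≤ U ω / δ := div_nonneg (hU2 ω) hδ.le
    have p1 := mul_nonneg hδ.le hB0
    have p2 := mul_nonneg hδσ.le hA0
    rw [e1] at A1 A2
    rw [e2] at B1 B2
    rw [abs_le] at A1 A2 B1 B2
    rw [hL, hR, abs_le, add_div]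
    refine ⟨⟨?_, ?_⟩, ?_⟩ <;> linarith

end ModelAvg

/-! ### Oracle inequality for nested Mallows model averaging -/

namespace ModelAvg

theorem seqRisk_nonneg {p : ℕ} (σ : ℝ) (γ θ : Fin p → ℝ) : 0 ≤ seqRisk σ γ θ :=
  Finset.sum_nonneg fun _ _ => by positivity

theorem measurable_shrinkage {p : ℕ} {ι Ω : Type*} [Fintype ι] [MeasurableSpace Ω]
    (𝓜 : ι → Finset (Fin p)) {w : Ω → ι → ℝ} (hw : Measurable w) (j : Fin p) :
    Measurable (fun ω => shrinkage 𝓜 (w ω) j) := by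
  refine Finset.measurable_sum _ fun m _ => ?_
  split_ifs
  · exact (measurable_pi_apply m).comp hw
  · exact measurable_const

/-- Young's inequality in each coordinate. With `a` the error of the variance estimator, this is the
source of the condition on `p E(σ̂² - σ²)²`. -/
theorem abs_mul_sum_le {p : ℕ} {a t : ℝ} (ht : 0 < t) (γ : Fin p → ℝ) :
    |a * ∑ j, γ j| ≤ t * ∑ j, γ j ^ 2 + p * a ^ 2 / (4 * t) := by
  have h : ∀ x : ℝ, |a * x| ≤ t * x ^ 2 + a ^ 2 / (4 * t) := fun x => by
    have e1 : t * x ^ 2 + a ^ 2 / (4 * t) - a * x = (2 * t * x - a) ^ 2 / (4 * t) := by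
      field_simp; ring
    have e2 : t * x ^ 2 + a ^ 2 / (4 * t) + a * x = (2 * t * x + a) ^ 2 / (4 * t) := by
      field_simp; ring
    have p1 : 0 ≤ (2 * t * x - a) ^ 2 / (4 * t) := by positivity
    have p2 : 0 ≤ (2 * t * x + a) ^ 2 / (4 * t) := by positivity
    exact abs_le.2 ⟨by linarith, by linarith⟩
  calc _ ≤ ∑ j, |a * γ j| := by rw [Finset.mul_sum]; exact Finset.abs_sum_le_sum_abs _ _
    _ ≤ ∑ j, (t * γ j ^ 2 + a ^ 2 / (4 * t)) := Finset.sum_le_sum fun j _ => h _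
    _ = _ := by
      rw [Finset.sum_add_distrib, ← Finset.mul_sum]
      simp
      ring

/-- Minimality of the Mallows criterion, rewritten in terms of the loss. -/
theorem seqLoss_le_of_criterion_le {p : ℕ} {γ γ₀ θ e : Fin p → ℝ} {s σ : ℝ}
    (h : ∑ j, (γ j ^ 2 * (θ j + e j) ^ 2 - 2 * γ j * (θ j + e j) ^ 2 + 2 * s * γ j)
      ≤ ∑ j, (γ₀ j ^ 2 * (θ j + e j) ^ 2 - 2 * γ₀ j * (θ j + e j) ^ 2 + 2 * s * γ₀ j)) :
    seqLoss γ θ e ≤ seqLoss γ₀ θ e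
      + (2 * (∑ j, γ j * (e j ^ 2 - σ ^ 2)) - 2 * (∑ j, (1 - γ j) * (θ j * e j)))
      - (2 * (∑ j, γ₀ j * (e j ^ 2 - σ ^ 2)) - 2 * (∑ j, (1 - γ₀ j) * (θ j * e j)))
      - 2 * ((s - σ ^ 2) * ∑ j, γ j) + 2 * ((s - σ ^ 2) * ∑ j, γ₀ j) := by
  have key : ∀ γ : Fin p → ℝ, seqLoss γ θ e
      = ∑ j, (γ j ^ 2 * (θ j + e j) ^ 2 - 2 * γ j * (θ j + e j) ^ 2 + 2 * s * γ j)
      + (2 * (∑ j, γ j * (e j ^ 2 - σ ^ 2)) - 2 * (∑ j, (1 - γ j) * (θ j * e j)))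
      - 2 * ((s - σ ^ 2) * ∑ j, γ j) + ∑ j, (θ j ^ 2 + 2 * (θ j * e j)) := by
    intro γ
    rw [seqLoss]
    simp only [Finset.mul_sum]
    rw [← Finset.sum_sub_distrib, ← Finset.sum_add_distrib, ← Finset.sum_sub_distrib,
      ← Finset.sum_add_distrib]
    exact Finset.sum_congr rfl fun j _ => by ring
  rw [key γ, key γ₀]
  linarith

theorem integral_le_sub_add {Ω : Type*} [MeasurableSpace Ω] {μ : Measure Ω} {F A Z B C D E : Ω → ℝ} (hF : Integrable F μ) (hA : Integrable A μ)
    (hZ : Integrable Z μ) (hB : Integrable B μ) (hC : Integrable C μ) (hD : Integrable D μ)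
    (hE : Integrable E μ)
    (h : ∀ ω, F ω ≤ A ω - Z ω + (B ω + (C ω + (D ω + E ω)))) :
    ∫ ω, F ω ∂μ ≤ ∫ ω, A ω ∂μ - ∫ ω, Z ω ∂μ
      + (∫ ω, B ω ∂μ + (∫ ω, C ω ∂μ + (∫ ω, D ω ∂μ + ∫ ω, E ω ∂μ))) := by
  have i1 : Integrable (fun ω => D ω + E ω) μ := hD.add hE
  have i2 : Integrable (fun ω => C ω + (D ω + E ω)) μ := hC.add i1
  have i3 : Integrable (fun ω => B ω + (C ω + (D ω + E ω))) μ := hB.add i2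
  have i4 : Integrable (fun ω => A ω - Z ω) μ := hA.sub hZ
  rw [← integral_sub hA hZ, ← integral_add hD hE, ← integral_add hC i1, ← integral_add hB i2,
    ← integral_add i4 i3]
  exact integral_mono hF (i4.add i3) h

variable {n p M : ℕ} {k : ℕ → ℕ} {Φ : Matrix (Fin n) (Fin p) ℝ} {Ω : Type*} [MeasurableSpace Ω]
  {μ : Measure Ω} [IsProbabilityMeasure μ] {ε : Fin n → Ω → ℝ} {σ : ℝ} {η : ℝ≥0}

theorem integrable_seqLoss {ι : Type*} [Fintype ι] (hε : IsSubgaussianNoise μ ε σ η)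
    (𝓜 : ι → Finset (Fin p)) (θ : Fin p → ℝ) {w : Ω → ι → ℝ} (hw : Measurable w)
    (hws : ∀ ω, w ω ∈ stdSimplex ℝ ι) :
    Integrable (fun ω => seqLoss (shrinkage 𝓜 (w ω)) θ (Φᵀ *ᵥ fun i => ε i ω)) μ := by
  have hs := fun j : Fin p => hasAllMoments_score (Φ := Φ) hε j
  have hm : ∀ j, Measurable (fun ω => (Φᵀ *ᵥ fun i => ε i ω) j) := fun j => by
    simp only [Matrix.mulVec, dotProduct]
    exact Finset.measurable_sum _ fun i _ => (hε.measurable i).const_mul _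
  refine Integrable.mono'
    (g := fun ω => ∑ j, (2 * θ j ^ 2 + 2 * (Φᵀ *ᵥ fun i => ε i ω) j ^ 2))
    (HasAllMoments.sum _ fun j _ => (HasAllMoments.const _).add
      ((hs j).pow_two.const_mul 2)).integrable ?_ (ae_of_all _ fun ω => ?_)
  · refine Measurable.aestronglyMeasurable (Finset.measurable_sum _ fun j _ => ?_)
    exact (((measurable_shrinkage 𝓜 hw j).mul ((hm j).const_add _)).sub_const _).pow_const 2
  · rw [seqLoss, Real.norm_of_nonneg (Finset.sum_nonneg fun _ _ => sq_nonneg _)]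
    refine Finset.sum_le_sum fun j _ => ?_
    set g := shrinkage 𝓜 (w ω) j
    set x := (Φᵀ *ᵥ fun i => ε i ω) j
    have h0 : 0 ≤ g := shrinkage_nonneg 𝓜 (hws ω).1 j
    have h1 : g ≤ 1 := shrinkage_le_one 𝓜 (hws ω) j
    have h2 : (1 - g) ^ 2 * θ j ^ 2 ≤ 1 * θ j ^ 2 :=
      mul_le_mul_of_nonneg_right (pow_le_one₀ (by linarith) (by linarith)) (sq_nonneg _)
    have h3 : g ^ 2 * x ^ 2 ≤ 1 * x ^ 2 :=
      mul_le_mul_of_nonneg_right (pow_le_one₀ h0 h1) (sq_nonneg _)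
    nlinarith [sq_nonneg ((1 - g) * θ j + g * x)]

theorem integrable_seqRisk {ι : Type*} [Fintype ι] (σ : ℝ)
    (𝓜 : ι → Finset (Fin p)) (θ : Fin p → ℝ) {w : Ω → ι → ℝ} (hw : Measurable w)
    (hws : ∀ ω, w ω ∈ stdSimplex ℝ ι) :
    Integrable (fun ω => seqRisk σ (shrinkage 𝓜 (w ω)) θ) μ := by
  refine Integrable.mono' (g := fun _ => ∑ j, (θ j ^ 2 + σ ^ 2)) (integrable_const _) ?_
    (ae_of_all _ fun ω => ?_)
  · refine Measurable.aestronglyMeasurable (Finset.measurable_sum _ fun j _ => ?_)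
    have := measurable_shrinkage 𝓜 hw j
    exact (((this.const_sub 1).pow_const 2).mul_const _).add ((this.pow_const 2).const_mul _)
  · rw [Real.norm_of_nonneg (seqRisk_nonneg _ _ _)]
    refine Finset.sum_le_sum fun j _ => ?_
    have h0 := shrinkage_nonneg 𝓜 (hws ω).1 j
    have h1 := shrinkage_le_one 𝓜 (hws ω) j
    refine add_le_add ?_ ?_
    · exact mul_le_of_le_one_left (sq_nonneg _) (pow_le_one₀ (by linarith) (by linarith))
    · exact mul_le_of_le_one_right (sq_nonneg _) (pow_le_one₀ h0 h1)

/-- At a fixed comparison weight the noise in the criterion is centered, so it needs no remainder.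
-/
theorem integral_criterion_noise (hΦ : Φᵀ * Φ = 1) (hε : IsSubgaussianNoise μ ε σ η)
    (γ θ : Fin p → ℝ) :
    Integrable (fun ω => 2 * (∑ j, γ j * ((Φᵀ *ᵥ fun i => ε i ω) j ^ 2 - σ ^ 2))
      - 2 * (∑ j, (1 - γ j) * (θ j * (Φᵀ *ᵥ fun i => ε i ω) j))) μ ∧
    ∫ ω, (2 * (∑ j, γ j * ((Φᵀ *ᵥ fun i => ε i ω) j ^ 2 - σ ^ 2))
      - 2 * (∑ j, (1 - γ j) * (θ j * (Φᵀ *ᵥ fun i => ε i ω) j))) ∂μ = 0 := by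
  have hs := fun j : Fin p => hasAllMoments_score (Φ := Φ) hε j
  have h1 : ∀ j, HasAllMoments μ (fun ω => γ j * ((Φᵀ *ᵥ fun i => ε i ω) j ^ 2 - σ ^ 2)) :=
    fun j => ((hs j).pow_two.sub (HasAllMoments.const _)).const_mul _
  have h2 : ∀ j, HasAllMoments μ (fun ω => (1 - γ j) * (θ j * (Φᵀ *ᵥ fun i => ε i ω) j)) :=
    fun j => ((hs j).const_mul _).const_mul _
  have i1 := ((HasAllMoments.sum Finset.univ fun j _ => h1 j).const_mul 2).integrable
  have i2 := ((HasAllMoments.sum Finset.univ fun j _ => h2 j).const_mul 2).integrable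
  refine ⟨i1.sub i2, ?_⟩
  rw [integral_sub i1 i2, integral_const_mul, integral_const_mul,
    integral_finsetSum _ fun j _ => (h1 j).integrable,
    integral_finsetSum _ fun j _ => (h2 j).integrable]
  have e1 : ∀ j, ∫ ω, γ j * ((Φᵀ *ᵥ fun i => ε i ω) j ^ 2 - σ ^ 2) ∂μ = 0 := fun j => by
    rw [integral_const_mul, integral_sub (hs j).pow_two.integrable (integrable_const _),
      integral_score_sq hΦ hε]
    simp
  have e2 : ∀ j, ∫ ω, (1 - γ j) * (θ j * (Φᵀ *ᵥ fun i => ε i ω) j) ∂μ = 0 := fun j => by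
    rw [integral_const_mul, integral_const_mul, integral_score hε]
    simp
  simp [e1, e2]

/-- Oracle inequality for Mallows model averaging over nested models, in the sequence model. -/
theorem nested_oracle_inequality (hΦ : Φᵀ * Φ = 1) {f : Fin n → ℝ} (hn : 1 ≤ n)
    (hε : IsSubgaussianNoise μ ε σ η) (hσ : 0 < σ) (hk : IsModelSizes p M k) {s : Ω → ℝ}
    (hs : Integrable (fun ω => (s ω - σ ^ 2) ^ 2) μ) {w : Ω → Fin M → ℝ}
    (hw : IsMMAWeight Φ (nestedModels p M k) f ε s w) {w₀ : Fin M → ℝ}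
    (hw₀ : w₀ ∈ stdSimplex ℝ (Fin M)) {δ K : ℝ} (hδ : 0 < δ)
    (hK : remainderConst σ η * psi (Φᵀ *ᵥ f) M k + p * (∫ ω, (s ω - σ ^ 2) ^ 2 ∂μ) / σ ^ 2 ≤ K) :
    (1 - 9 * δ) * ∫ ω, seqRisk σ (shrinkage (nestedModels p M k) (w ω)) (Φᵀ *ᵥ f) ∂μ
      ≤ (1 + 2 * δ) * seqRisk σ (shrinkage (nestedModels p M k) w₀) (Φᵀ *ᵥ f) + 2 * K / δ ∧
    ∫ ω, seqLoss (shrinkage (nestedModels p M k) (w ω)) (Φᵀ *ᵥ f) (Φᵀ *ᵥ fun i => ε i ω) ∂μ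
      ≤ (1 + 5 * δ) * ∫ ω, seqRisk σ (shrinkage (nestedModels p M k) (w ω)) (Φᵀ *ᵥ f) ∂μ
        + K / δ := by
  set θ := Φᵀ *ᵥ f with hθ
  set 𝓜 := nestedModels p M k with h𝓜
  obtain ⟨W, hW1, hW2, hW3, hW4⟩ := exists_nested_remainder (μ := μ) hΦ hε hσ hk θ
  have hσ2 : 0 < σ ^ 2 := by positivity
  have hnR : (0 : ℝ) < n := by exact_mod_cast hn
  have iL := integrable_seqLoss (Φ := Φ) hε 𝓜 θ hw.measurable hw.mem_simplex
  have iR := integrable_seqRisk (μ := μ) σ 𝓜 θ hw.measurable hw.mem_simplex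
  have iL0 := integrable_seqLoss (Φ := Φ) hε 𝓜 θ (measurable_const (a := w₀)) fun _ => hw₀
  have iZ := integral_criterion_noise hΦ hε (shrinkage 𝓜 w₀) θ
  have iWd := hW1.div_const δ
  have hV0 : 0 ≤ p * (∫ ω, (s ω - σ ^ 2) ^ 2 ∂μ) / σ ^ 2 := by
    have : 0 ≤ ∫ ω, (s ω - σ ^ 2) ^ 2 ∂μ := integral_nonneg fun _ => sq_nonneg _
    positivity
  have hψ : ∫ ω, W ω ∂μ + p * (∫ ω, (s ω - σ ^ 2) ^ 2 ∂μ) / σ ^ 2 ≤ K := by linarith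
  have hdev : |∫ ω, seqLoss (shrinkage 𝓜 (w ω)) θ (Φᵀ *ᵥ fun i => ε i ω) ∂μ
      - ∫ ω, seqRisk σ (shrinkage 𝓜 (w ω)) θ ∂μ|
      ≤ 5 * δ * ∫ ω, seqRisk σ (shrinkage 𝓜 (w ω)) θ ∂μ + (∫ ω, W ω ∂μ) / δ := by
    rw [← integral_sub iL iR]
    refine (abs_integral_le_integral_abs).trans ?_
    rw [← integral_const_mul, ← integral_div, ← integral_add (iR.const_mul _) iWd]
    exact integral_mono (iL.sub iR).abs ((iR.const_mul _).add iWd)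
      fun ω => (hW4 (w ω) (hw.mem_simplex ω) ω δ hδ).1
  -- For the random weight, `4δ` is `2δ` from the criterion noise plus `2δ` from the variance
  -- estimator; together with the `5δ` of `hdev` this leaves the factor `1 - 9δ`.
  have hpath : ∀ ω, seqLoss (shrinkage 𝓜 (w ω)) θ (Φᵀ *ᵥ fun i => ε i ω)
      ≤ seqLoss (shrinkage 𝓜 w₀) θ (Φᵀ *ᵥ fun i => ε i ω)
        - (2 * (∑ j, shrinkage 𝓜 w₀ j * ((Φᵀ *ᵥ fun i => ε i ω) j ^ 2 - σ ^ 2))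
          - 2 * (∑ j, (1 - shrinkage 𝓜 w₀ j) * (θ j * (Φᵀ *ᵥ fun i => ε i ω) j)))
        + (4 * δ * seqRisk σ (shrinkage 𝓜 (w ω)) θ + (W ω / δ
        + (2 * δ * seqRisk σ (shrinkage 𝓜 w₀) θ + p / (δ * σ ^ 2) * (s ω - σ ^ 2) ^ 2))) := by
    intro ω
    have hmin := hw.isMinOn ω hw₀
    simp only [Set.mem_ofPred_eq, mmaCriterion_eq hΦ] at hmin
    rw [div_le_div_iff_of_pos_right hnR, add_le_add_iff_left] at hmin
    have hy : ∀ j, (Φᵀ *ᵥ response f ε ω) j = θ j + (Φᵀ *ᵥ fun i => ε i ω) j := fun j => by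
      have : Φᵀ *ᵥ response f ε ω = Φᵀ *ᵥ f + Φᵀ *ᵥ fun i => ε i ω := by
        rw [← Matrix.mulVec_add]; rfl
      rw [this]; rfl
    simp only [hy] at hmin
    have h1 := seqLoss_le_of_criterion_le (σ := σ) hmin
    have h2 := (hW4 (w ω) (hw.mem_simplex ω) ω δ hδ).2
    have hδσ : 0 < δ * σ ^ 2 := by positivity
    have h3 := (abs_le.1 (abs_mul_sum_le (a := s ω - σ ^ 2) hδσ (shrinkage 𝓜 (w ω)))).1
    have h4 := (abs_le.1 (abs_mul_sum_le (a := s ω - σ ^ 2) hδσ (shrinkage 𝓜 w₀))).2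
    have hv : ∀ γ : Fin p → ℝ, δ * σ ^ 2 * ∑ j, γ j ^ 2 ≤ δ * seqRisk σ γ θ := fun γ => by
      rw [mul_assoc, seqRisk, Finset.mul_sum]
      refine mul_le_mul_of_nonneg_left (Finset.sum_le_sum fun j _ => ?_) hδ.le
      have : 0 ≤ (1 - γ j) ^ 2 * θ j ^ 2 := by positivity
      linarith
    have h5 := hv (shrinkage 𝓜 (w ω))
    have h6 := hv (shrinkage 𝓜 w₀)
    have e1 : (p : ℝ) * (s ω - σ ^ 2) ^ 2 / (4 * (δ * σ ^ 2))
        = p / (δ * σ ^ 2) * (s ω - σ ^ 2) ^ 2 / 4 := by field_simp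
    rw [e1] at h3 h4
    linarith
  have iA := iR.const_mul (4 * δ)
  have iS := hs.const_mul (p / (δ * σ ^ 2))
  have iC : Integrable (fun _ : Ω => 2 * δ * seqRisk σ (shrinkage 𝓜 w₀) θ) μ := integrable_const _
  have hint := integral_le_sub_add iL iL0 iZ.1 iA iWd iC iS hpath
  rw [iZ.2, integral_seqLoss hΦ hε, integral_const_mul,
    integral_const_mul ((p : ℝ) / (δ * σ ^ 2)), integral_div] at hint
  simp only [integral_const, probReal_univ, one_smul, sub_zero] at hint
  have e2 : (p : ℝ) / (δ * σ ^ 2) * ∫ ω, (s ω - σ ^ 2) ^ 2 ∂μ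
      = p * (∫ ω, (s ω - σ ^ 2) ^ 2 ∂μ) / σ ^ 2 / δ := by field_simp
  rw [e2] at hint
  have hKδ := div_le_div_of_nonneg_right hψ hδ.le
  rw [add_div] at hKδ
  have hV0δ := div_nonneg hV0 hδ.le
  have hW0 := div_nonneg (integral_nonneg (μ := μ) hW2) hδ.le
  obtain ⟨d1, d2⟩ := abs_le.1 hdev
  have e3 : 2 * K / δ = K / δ + K / δ := by ring
  rw [e3]
  constructor <;> linarith

end ModelAvg

/-! ### Approximation of the ideal risk by nested models -/

namespace ModelAvg

variable {p M : ℕ} {k : ℕ → ℕ}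

theorem le_partialSum_sub {F : Fin p → ℝ} {a b : ℕ} (hab : a ≤ b) (hb : b ≤ p) {m : ℝ}
    (h : ∀ j : Fin p, a ≤ j → (j : ℕ) < b → m ≤ F j) :
    m * ((b : ℝ) - a) ≤ partialSum F b - partialSum F a := by
  rw [← partialSum_one hb, ← partialSum_one (hab.trans hb), partialSum_sub _ hab,
    partialSum_sub _ hab, Finset.mul_sum]
  refine Finset.sum_le_sum fun j hj => ?_
  have := (Finset.mem_filter.1 hj).2
  rw [mul_one]
  exact h j this.1 this.2

theorem partialSum_sub_le {F : Fin p → ℝ} {a b : ℕ} (hab : a ≤ b) (hb : b ≤ p) {m : ℝ}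
    (h : ∀ j : Fin p, a ≤ j → (j : ℕ) < b → F j ≤ m) :
    partialSum F b - partialSum F a ≤ m * ((b : ℝ) - a) := by
  have := le_partialSum_sub (F := fun j => -F j) (m := -m) hab hb
    fun j h1 h2 => neg_le_neg (h j h1 h2)
  have e : ∀ t, partialSum (fun j => -F j) t = -partialSum F t := fun t => by
    simp [partialSum]
  rw [e, e] at this
  linarith

theorem IsModelSizes.sum_eq (hk : IsModelSizes p M k) (F : Fin p → ℝ) :
    ∑ j, F j = ∑ g ∈ Finset.range M, (partialSum F (k (g + 1)) - partialSum F (k g)) := by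
  rw [Finset.sum_range_sub (fun g => partialSum F (k g)), hk.zero, partialSum_zero, sub_zero,
    hk.last, partialSum_of_le _ le_rfl]

theorem GroupConst.sum_sq (hk : IsModelSizes p M k) {γ : ℕ → ℝ} {c : Fin p → ℝ}
    (hc : GroupConst M k γ c) :
    ∑ j, c j ^ 2 = ∑ g ∈ Finset.range M, γ g ^ 2 * ((k (g + 1) : ℝ) - k g) := by
  have := (hc.comp (· ^ 2)).sum_mul hk (fun _ => 1)
  simp only [mul_one] at this
  rw [this]
  refine Finset.sum_congr rfl fun g hg => ?_
  have hg := Finset.mem_range.1 hg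
  rw [partialSum_one (hk.le_p (by omega)), partialSum_one (hk.le_p hg.le)]

theorem seqRisk_eq {σ : ℝ} (γ θ : Fin p → ℝ) :
    seqRisk σ γ θ = ∑ j, (1 - γ j) ^ 2 * θ j ^ 2 + σ ^ 2 * ∑ j, γ j ^ 2 := by
  rw [seqRisk, Finset.sum_add_distrib, Finset.mul_sum]

/-- A monotone shrinkage vector can be replaced by one which is constant on the groups, if the
group sizes grow slowly. -/
theorem exists_grouped_weight (hk : IsModelSizes p M k) {σ r : ℝ} (hr : 0 ≤ r)
    (hratio : ∀ g, g + 2 ≤ M →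
      (k (g + 2) : ℝ) - k (g + 1) ≤ (1 + r) * ((k (g + 1) : ℝ) - k g))
    {c : ℕ → ℝ} (hc : Antitone c) (hc1 : c 0 = 1) (hc0 : ∀ j, 0 ≤ c j) (θ : Fin p → ℝ) :
    ∃ w ∈ stdSimplex ℝ (Fin M), seqRisk σ (shrinkage (nestedModels p M k) w) θ
      ≤ σ ^ 2 * k 1 + (1 + r) * seqRisk σ (fun j => c j) θ := by
  -- Each group takes the value of `c` at its left end. This is the largest value in the group, so
  -- the bias can only decrease. The variance on a group is compared with that of `c` on the
  -- preceding group, where `c` is at least as large.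
  obtain ⟨w, hw, hwg⟩ := exists_groupWeight_eq hk.pos (γ := fun g => c (k g))
    (by simp [hk.zero, hc1]) (fun i j hij hj => hc (hk.le hij hj.le)) (fun g _ => hc0 _)
  refine ⟨w, hw, ?_⟩
  have hG : GroupConst M k (fun g => c (k g)) (shrinkage (nestedModels p M k) w) :=
    fun g hg j h1 h2 => by rw [groupConst_shrinkage hk w g hg j h1 h2, hwg g hg]
  have hbias : ∑ j, (1 - shrinkage (nestedModels p M k) w j) ^ 2 * θ j ^ 2
      ≤ ∑ j : Fin p, (1 - c j) ^ 2 * θ j ^ 2 := by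
    refine Finset.sum_le_sum fun j _ => mul_le_mul_of_nonneg_right ?_ (sq_nonneg _)
    obtain ⟨g, hg, h1, h2⟩ := hk.exists_group j
    rw [hG g hg j h1 h2]
    have : c (k g) ≤ 1 := hc1 ▸ hc (Nat.zero_le _)
    exact pow_le_pow_left₀ (by linarith) (by linarith [hc h1]) 2
  have hvar : ∑ j, shrinkage (nestedModels p M k) w j ^ 2
      ≤ k 1 + (1 + r) * ∑ j : Fin p, c j ^ 2 := by
    rw [hG.sum_sq hk, hk.sum_eq]
    obtain ⟨m, rfl⟩ : ∃ m, M = m + 1 := ⟨M - 1, by have := hk.pos; omega⟩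
    rw [Finset.sum_range_succ', Finset.sum_range_succ, add_comm]
    refine add_le_add (by simp [hk.zero, hc1]) ?_
    rw [mul_add]
    refine le_add_of_le_of_nonneg ?_ (mul_nonneg (by linarith) ?_)
    · rw [Finset.mul_sum]
      refine Finset.sum_le_sum fun g hg => ?_
      have hg := Finset.mem_range.1 hg
      have h1 := hratio g (by omega)
      have h2 := le_partialSum_sub (F := fun j => c j ^ 2) (hk.lt g (by omega)).le
        (hk.le_p (by omega)) (m := c (k (g + 1)) ^ 2)
        fun j _ h2 => pow_le_pow_left₀ (hc0 _) (hc h2.le) 2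
      have h3 := mul_le_mul_of_nonneg_left h1 (sq_nonneg (c (k (g + 1))))
      have h4 := mul_le_mul_of_nonneg_left h2 (show 0 ≤ 1 + r by linarith)
      calc _ ≤ _ := h3
        _ = (1 + r) * (c (k (g + 1)) ^ 2 * ((k (g + 1) : ℝ) - k g)) := by ring
        _ ≤ _ := h4
    · have := le_partialSum_sub (F := fun j => c j ^ 2) (hk.lt m (by omega)).le
        (hk.le_p le_rfl) (m := 0) fun j _ _ => sq_nonneg _
      linarith
  rw [seqRisk_eq, seqRisk_eq]
  have h1 := mul_le_mul_of_nonneg_left hvar (sq_nonneg σ)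
  have h2 : 0 ≤ ∑ j : Fin p, (1 - c j) ^ 2 * θ j ^ 2 :=
    Finset.sum_nonneg fun _ _ => by positivity
  have h3 := mul_nonneg hr h2
  nlinarith

/-- The smallest risk of a single shrunken coefficient with square `t`. -/
noncomputable def idealCoefRisk (σ t : ℝ) : ℝ := t * σ ^ 2 / (t + σ ^ 2)

/-- Complete the square around the minimizer `x = t / (t + σ²)`. -/
theorem idealCoefRisk_le {σ : ℝ} (hσ : 0 < σ) {t : ℝ} (ht : 0 ≤ t) (x : ℝ) :
    idealCoefRisk σ t ≤ (1 - x) ^ 2 * t + σ ^ 2 * x ^ 2 := by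
  have : 0 < t + σ ^ 2 := by positivity
  rw [idealCoefRisk, div_le_iff₀ this]
  nlinarith [sq_nonneg ((t + σ ^ 2) * x - t)]

theorem idealCoefRisk_mono {σ : ℝ} (hσ : 0 < σ) {s t : ℝ} (hs : 0 ≤ s) (hst : s ≤ t) :
    idealCoefRisk σ s ≤ idealCoefRisk σ t := by
  have h1 : 0 < s + σ ^ 2 := by positivity
  have h2 : 0 < t + σ ^ 2 := by linarith
  rw [idealCoefRisk, idealCoefRisk, div_le_div_iff₀ h1 h2]
  have : 0 ≤ σ ^ 2 * σ ^ 2 * (t - s) := mul_nonneg (by positivity) (by linarith)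
  nlinarith

/-- A lower bound on the risk of every shrinkage vector. -/
noncomputable def idealSeqRisk (σ : ℝ) (θ : Fin p → ℝ) : ℝ := ∑ j, idealCoefRisk σ (θ j ^ 2)

theorem idealSeqRisk_le {σ : ℝ} (hσ : 0 < σ) (γ θ : Fin p → ℝ) :
    idealSeqRisk σ θ ≤ seqRisk σ γ θ :=
  Finset.sum_le_sum fun _ _ => idealCoefRisk_le hσ (sq_nonneg _) _

/-- If the squared coefficients decrease from block to block and the block sizes grow slowly, then
a monotone blockwise constant shrinkage vector has nearly the ideal risk. -/
theorem exists_blockwise_shrinkage {D : ℕ} {d : ℕ → ℕ} (hd : IsModelSizes p D d) {σ r : ℝ}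
    (hσ : 0 < σ) (hr : 0 ≤ r)
    (hratio : ∀ l, l + 2 ≤ D →
      (d (l + 2) : ℝ) - d (l + 1) ≤ (1 + r) * ((d (l + 1) : ℝ) - d l))
    {θ : Fin p → ℝ}
    (hθ : ∀ l, l + 2 ≤ D → ∀ i j : Fin p, d l ≤ i → (i : ℕ) < d (l + 1) → d (l + 1) ≤ j →
      (j : ℕ) < d (l + 2) → θ j ^ 2 ≤ θ i ^ 2) :
    ∃ c : ℕ → ℝ, Antitone c ∧ c 0 = 1 ∧ (∀ j, 0 ≤ c j) ∧
      seqRisk σ (fun j : Fin p => c j) θ ≤ σ ^ 2 * d 1 + (1 + r) * idealSeqRisk σ θ := by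
  have hσ2 : 0 < σ ^ 2 := by positivity
  set P := partialSum (fun j => θ j ^ 2) with hP
  -- The mean square of a block: a constant shrinkage factor sees only this average.
  set t : ℕ → ℝ := fun l => (P (d (l + 1)) - P (d l)) / ((d (l + 1) : ℝ) - d l) with ht
  have hlen : ∀ l < D, (0 : ℝ) < (d (l + 1) : ℝ) - d l := fun l hl =>
    sub_pos.2 (by exact_mod_cast hd.lt l hl)
  have hblock : ∀ l < D, P (d (l + 1)) - P (d l) = t l * ((d (l + 1) : ℝ) - d l) := fun l hl =>
    (div_mul_cancel₀ _ (hlen l hl).ne').symm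
  have ht0 : ∀ l < D, 0 ≤ t l := fun l hl => by
    refine div_nonneg ?_ (hlen l hl).le
    have := le_partialSum_sub (F := fun j => θ j ^ 2) (hd.lt l hl).le (hd.le_p hl) (m := 0)
      fun _ _ _ => sq_nonneg _
    linarith
  have hnext : ∀ l, l + 2 ≤ D → ∀ i : Fin p, d l ≤ i → (i : ℕ) < d (l + 1) →
      t (l + 1) ≤ θ i ^ 2 := fun l hl i h1 h2 => by
    rw [ht, div_le_iff₀ (hlen (l + 1) (by omega))]
    exact partialSum_sub_le (hd.lt (l + 1) (by omega)).le (hd.le_p hl) fun j h3 h4 =>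
      hθ l hl i j h1 h2 h3 h4
  have hanti1 : ∀ l, l + 2 ≤ D → t (l + 1) ≤ t l := fun l hl => by
    change t (l + 1) ≤ _ / _
    rw [le_div_iff₀ (hlen l (by omega))]
    exact le_partialSum_sub (hd.lt l (by omega)).le (hd.le_p (by omega)) (hnext l hl)
  have hanti : ∀ i j, i ≤ j → j < D → t j ≤ t i := by
    intro i j hij hj
    induction j, hij using Nat.le_induction with
    | base => exact le_rfl
    | succ j _ ih => exact (hanti1 j (by omega)).trans (ih (by omega))
  -- The first block must have factor 1, since every nested model contains it and the weights sum to
  -- 1. It has no bias, and its variance is `σ² d₁`.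
  set γ : ℕ → ℝ := fun l => if l = 0 then 1 else t l / (t l + σ ^ 2) with hγ
  have hγ0 : ∀ l < D, 0 ≤ γ l := fun l hl => by
    simp only [hγ]
    split_ifs
    · exact zero_le_one
    · have := ht0 l hl
      positivity
  have hγanti : ∀ i j, i ≤ j → j < D → γ j ≤ γ i := by
    intro i j hij hj
    have h1 := ht0 j hj
    have h2 := hanti i j hij hj
    have h3 : 0 < t j + σ ^ 2 := by linarith
    simp only [hγ]
    split_ifs with hj0 hi0 hi0
    · exact le_rfl
    · omega
    · exact div_le_one_of_le₀ (by linarith) h3.le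
    · rw [div_le_div_iff₀ h3 (by linarith)]
      nlinarith
  obtain ⟨w, hw, hwg⟩ := exists_groupWeight_eq hd.pos (γ := γ) (by simp [hγ]) hγanti hγ0
  set q : Fin p → ℝ := shrinkage (nestedModels p D d) w with hq
  have hG : GroupConst D d γ q := fun g hg j h1 h2 => by
    rw [hq, groupConst_shrinkage hd w g hg j h1 h2, hwg g hg]
  refine ⟨fun i => ∑ m : Fin D, if i < d (m + 1) then w m else 0, ?_, ?_, ?_, ?_⟩
  · intro i j hij
    refine Finset.sum_le_sum fun m _ => ?_
    split_ifs with h1 h2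
    · exact le_rfl
    · omega
    · exact hw.1 m
    · exact le_rfl
  · rw [← hw.2]
    refine Finset.sum_congr rfl fun m _ => if_pos ?_
    exact hd.one_le (by omega) (by omega)
  · exact fun j => Finset.sum_nonneg fun m _ => by split_ifs; exacts [hw.1 m, le_rfl]
  · have e : (fun j : Fin p => ∑ m : Fin D, if (j : ℕ) < d (m + 1) then w m else 0) = q := by
      funext j
      simp [hq, shrinkage, nestedModels]
    change seqRisk σ (fun j : Fin p => ∑ m : Fin D, if (j : ℕ) < d (m + 1) then w m else 0) θ ≤ _
    rw [e, seqRisk_eq, hG.sum_sq hd, (hG.comp (fun x => (1 - x) ^ 2)).sum_mul hd, Finset.mul_sum,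
      ← Finset.sum_add_distrib, idealSeqRisk, hd.sum_eq]
    obtain ⟨m, hm⟩ : ∃ m, D = m + 1 := ⟨D - 1, by have := hd.pos; omega⟩
    rw [hm, Finset.sum_range_succ', Finset.sum_range_succ, add_comm]
    refine add_le_add (by simp [hγ, hd.zero]) ?_
    rw [mul_add]
    refine le_add_of_le_of_nonneg ?_ (mul_nonneg (by linarith) ?_)
    · rw [Finset.mul_sum]
      refine Finset.sum_le_sum fun l hl => ?_
      have hl := Finset.mem_range.1 hl
      have hl2 : l + 2 ≤ D := by omega
      have h0 := ht0 (l + 1) (by omega)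
      have h3 : 0 < t (l + 1) + σ ^ 2 := by linarith
      -- The shift by one block: the mean square of block `l + 1` lies below every squared
      -- coefficient of block `l`, so monotonicity of `idealCoefRisk` applies coefficientwise.
      have h1 : idealCoefRisk σ (t (l + 1)) * ((d (l + 1) : ℝ) - d l)
          ≤ partialSum (fun j => idealCoefRisk σ (θ j ^ 2)) (d (l + 1))
            - partialSum (fun j => idealCoefRisk σ (θ j ^ 2)) (d l) :=
        le_partialSum_sub (hd.lt l (by omega)).le (hd.le_p (by omega)) fun j a1 a2 =>
          idealCoefRisk_mono hσ h0 (hnext l hl2 j a1 a2)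
      have hh0 : 0 ≤ idealCoefRisk σ (t (l + 1)) := by
        unfold idealCoefRisk; positivity
      have h4 := mul_le_mul_of_nonneg_left h1 (show 0 ≤ 1 + r by linarith)
      have h5 := mul_le_mul_of_nonneg_left (hratio l hl2) hh0
      have h6 : (1 - γ (l + 1)) ^ 2 * (P (d (l + 1 + 1)) - P (d (l + 1)))
          + σ ^ 2 * (γ (l + 1) ^ 2 * ((d (l + 1 + 1) : ℝ) - d (l + 1)))
          = idealCoefRisk σ (t (l + 1)) * ((d (l + 1 + 1) : ℝ) - d (l + 1)) := by
        rw [hblock (l + 1) (by omega)]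
        have : γ (l + 1) = t (l + 1) / (t (l + 1) + σ ^ 2) := by simp [hγ]
        rw [this, idealCoefRisk]
        field_simp
        ring
      calc _ = _ := h6
        _ ≤ _ := h5
        _ = (1 + r) * (idealCoefRisk σ (t (l + 1)) * ((d (l + 1) : ℝ) - d l)) := by ring
        _ ≤ _ := h4
    · have := le_partialSum_sub (F := fun j => idealCoefRisk σ (θ j ^ 2)) (hd.lt m (by omega)).le
        (hd.le_p (by omega)) (m := 0) fun j _ _ => by unfold idealCoefRisk; positivity
      linarith

/-! ### Weakly ordered coefficients -/

theorem WeaklyOrdered.isModelSizes {θ : Fin p → ℝ} {D : ℕ} {d : ℕ → ℕ} {z : ℝ}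
    (h : WeaklyOrdered θ D d z) : IsModelSizes p D d := ⟨h.pos, h.zero, h.lt, h.last⟩

theorem decrRearr_anti (θ : Fin p → ℝ) : Antitone (decrRearr θ) := by
  intro i j hij
  have := Tuple.monotone_sort (fun i => -|θ i|) hij
  simpa [decrRearr] using this

theorem WeaklyOrdered.abs_le {θ : Fin p → ℝ} {D : ℕ} {d : ℕ → ℕ} {z : ℝ}
    (h : WeaklyOrdered θ D d z) {l : ℕ} (hl : l + 2 ≤ D) {i j : Fin p} (hi1 : d l ≤ i)
    (hi2 : (i : ℕ) < d (l + 1)) (hj1 : d (l + 1) ≤ j) (hj2 : (j : ℕ) < d (l + 2)) :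
    |θ j| ≤ |θ i| := by
  obtain ⟨π, hπ⟩ := h.perm (l + 1) (by omega) (by omega)
  obtain ⟨ρ, hρ⟩ := h.perm (l + 2) (by omega) (by omega)
  rw [hπ ⟨i, hi1, hi2⟩, hρ ⟨j, hj1, hj2⟩]
  refine decrRearr_anti θ (Fin.le_def.2 ?_)
  have h1 := (π ⟨i, hi1, hi2⟩).2.2
  have h2 : d (l + 1) ≤ _ := (ρ ⟨j, hj1, hj2⟩).2.1
  omega

theorem WeaklyOrdered.ratio_le {θ : Fin p → ℝ} {D : ℕ} {d : ℕ → ℕ} {z : ℝ}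
    (h : WeaklyOrdered θ D d z) {l : ℕ} (hl : l + 2 ≤ D) :
    (d (l + 2) : ℝ) - d (l + 1) ≤ (1 + |z|) * ((d (l + 1) : ℝ) - d l) := by
  have h0 : (0 : ℝ) < (d (l + 1) : ℝ) - d l := sub_pos.2 (by exact_mod_cast h.lt l (by omega))
  have h1 := h.ratio (l + 1) (by omega) (by omega)
  rw [Nat.add_sub_cancel, div_le_iff₀ h0] at h1
  exact h1.trans (mul_le_mul_of_nonneg_right (by linarith [le_abs_self z]) h0.le)

/-- Nested models whose sizes grow slowly have nearly the ideal risk if the coefficients are weakly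
ordered. -/
theorem WeaklyOrdered.exists_weight {θ : Fin p → ℝ} {a : ℝ} (ha : 0 < a) {D : ℕ} {d : ℕ → ℕ}
    {z : ℝ} (h : WeaklyOrdered (fun j => θ j / a) D d z) (hk : IsModelSizes p M k) {σ r : ℝ}
    (hσ : 0 < σ) (hr : 0 ≤ r)
    (hratio : ∀ g, g + 2 ≤ M →
      (k (g + 2) : ℝ) - k (g + 1) ≤ (1 + r) * ((k (g + 1) : ℝ) - k g)) :
    ∃ w ∈ stdSimplex ℝ (Fin M), seqRisk σ (shrinkage (nestedModels p M k) w) θ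
      ≤ σ ^ 2 * k 1 + (1 + r) * (σ ^ 2 * d 1 + (1 + |z|) * idealSeqRisk σ θ) := by
  obtain ⟨c, hc, hc1, hc0, hR⟩ := exists_blockwise_shrinkage h.isModelSizes hσ (abs_nonneg z)
    (fun l hl => h.ratio_le hl) (θ := θ) (fun l hl i j h1 h2 h3 h4 => by
      have := h.abs_le hl h1 h2 h3 h4
      rw [abs_div, abs_div, div_le_div_iff_of_pos_right (abs_pos.2 ha.ne')] at this
      exact sq_le_sq.2 this)
  obtain ⟨w, hw, hwR⟩ := exists_grouped_weight hk (σ := σ) hr hratio hc hc1 hc0 θ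
  exact ⟨w, hw, hwR.trans (add_le_add_right (mul_le_mul_of_nonneg_left hR (by linarith)) _)⟩

/-! ### Sizes of the grouped models -/

theorem isModelSizes_id (hp : 1 ≤ p) : IsModelSizes p p id := ⟨hp, rfl, fun m _ => by simp, rfl⟩

theorem groupRate_pos {t₁ t₂ : ℝ} (ht₁ : 0 < t₁) {n : ℕ} (hn : 2 ≤ n) : 0 < groupRate t₁ t₂ n := by
  have : 0 < Real.log n := Real.log_pos (by exact_mod_cast hn)
  unfold groupRate
  positivity

theorem groupSum_succ (t₁ t₂ : ℝ) (n : ℕ) {m : ℕ} (hm : 1 ≤ m) :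
    groupSum t₁ t₂ n (m + 1) = groupSum t₁ t₂ n m
      + ⌊(⌈(groupRate t₁ t₂ n)⁻¹⌉₊ : ℝ) * (1 + groupRate t₁ t₂ n) ^ m⌋₊ := by
  unfold groupSum
  rw [Finset.sum_Icc_succ_top (by omega), Nat.add_sub_cancel]
  ring

theorem groupSum_one (t₁ t₂ : ℝ) (n : ℕ) :
    groupSum t₁ t₂ n 1 = ⌈(groupRate t₁ t₂ n)⁻¹⌉₊ := by
  simp [groupSum]

section Grouped

variable {t₁ t₂ : ℝ} {n : ℕ}

theorem inv_groupRate_le (hζ : 0 < groupRate t₁ t₂ n) (m : ℕ) :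
    (groupRate t₁ t₂ n)⁻¹
      ≤ (⌈(groupRate t₁ t₂ n)⁻¹⌉₊ : ℝ) * (1 + groupRate t₁ t₂ n) ^ m :=
  (Nat.le_ceil _).trans (le_mul_of_one_le_right (by positivity) (one_le_pow₀ (by linarith)))

theorem one_le_groupFloor (hζ : 0 < groupRate t₁ t₂ n) (m : ℕ) :
    1 ≤ ⌊(⌈(groupRate t₁ t₂ n)⁻¹⌉₊ : ℝ) * (1 + groupRate t₁ t₂ n) ^ m⌋₊ := by
  refine Nat.le_floor ?_
  have h1 : 1 ≤ ⌈(groupRate t₁ t₂ n)⁻¹⌉₊ := Nat.one_le_ceil_iff.2 (inv_pos.2 hζ)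
  have h2 : (1 : ℝ) ≤ ⌈(groupRate t₁ t₂ n)⁻¹⌉₊ := by exact_mod_cast h1
  have h3 : (1 : ℝ) ≤ (1 + groupRate t₁ t₂ n) ^ m := one_le_pow₀ (by linarith)
  push_cast
  nlinarith

/-- Makes the set defining `groupCount` nonempty, so that its infimum is attained. -/
theorem le_groupSum (hζ : 0 < groupRate t₁ t₂ n) {m : ℕ} (hm : 1 ≤ m) :
    m ≤ groupSum t₁ t₂ n m := by
  induction m, hm using Nat.le_induction with
  | base =>
    rw [groupSum_one]
    exact Nat.one_le_ceil_iff.2 (inv_pos.2 hζ)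
  | succ m hm ih =>
    rw [groupSum_succ _ _ _ hm]
    have := one_le_groupFloor hζ m
    omega

theorem groupCount_spec (hζ : 0 < groupRate t₁ t₂ n) (p : ℕ) :
    1 ≤ groupCount t₁ t₂ n p ∧ p ≤ groupSum t₁ t₂ n (groupCount t₁ t₂ n p) :=
  Nat.sInf_mem (s := {m : ℕ | 1 ≤ m ∧ p ≤ groupSum t₁ t₂ n m})
    ⟨p + 1, by omega, (Nat.le_succ p).trans (le_groupSum hζ (by omega))⟩

theorem groupSum_lt {m : ℕ} (h1 : 1 ≤ m) (h : m < groupCount t₁ t₂ n p) :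
    groupSum t₁ t₂ n m < p := by
  by_contra hle
  exact Nat.notMem_of_lt_sInf h ⟨h1, not_lt.1 hle⟩

theorem isModelSizes_groupSize (hζ : 0 < groupRate t₁ t₂ n) (hp : 1 ≤ p) :
    IsModelSizes p (groupCount t₁ t₂ n p) (groupSize t₁ t₂ n p) := by
  have hM := (groupCount_spec hζ p).1
  refine ⟨hM, by simp [groupSize], fun m hm => ?_, ?_⟩
  · unfold groupSize
    rcases Nat.eq_zero_or_pos m with rfl | hm0
    · simp only [if_true, zero_add, one_ne_zero, if_false]
      split_ifs
      · have := le_groupSum hζ le_rfl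
        omega
      · omega
    · simp only [hm0.ne', if_false, hm, if_true, Nat.succ_ne_zero]
      split_ifs with h
      · rw [groupSum_succ _ _ _ hm0]
        have := one_le_groupFloor hζ m
        omega
      · exact groupSum_lt hm0 hm
  · unfold groupSize
    rw [if_neg (by omega), if_neg (lt_irrefl _)]

/-- Put `x = k₁ (1 + ζ)^g`. Rounding down loses at most 1, and `1 ≤ ζ x` because `k₁ ≥ ζ⁻¹`. Hence
one increment is at least `(1 - ζ) x`, while the next is at most `(1 + ζ) x`. -/
theorem groupSize_ratio_le (hζ : 0 < groupRate t₁ t₂ n) {r : ℝ} (hr : 0 ≤ r)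
    (hζ1 : groupRate t₁ t₂ n < 1)
    (h : 1 + groupRate t₁ t₂ n ≤ (1 + r) * (1 - groupRate t₁ t₂ n)) {g : ℕ}
    (hg : g + 2 ≤ groupCount t₁ t₂ n p) :
    (groupSize t₁ t₂ n p (g + 2) : ℝ) - groupSize t₁ t₂ n p (g + 1)
      ≤ (1 + r) * ((groupSize t₁ t₂ n p (g + 1) : ℝ) - groupSize t₁ t₂ n p g) := by
  set ζ := groupRate t₁ t₂ n with hζd
  set A : ℝ := (⌈ζ⁻¹⌉₊ : ℝ) with hA
  have e1 : groupSize t₁ t₂ n p (g + 1) = groupSum t₁ t₂ n (g + 1) := by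
    unfold groupSize
    rw [if_neg (by omega), if_pos (by omega)]
  -- The last group is cut off at `p`, which only shortens it; it occurs only as the later of the
  -- two groups compared.
  have e2 : groupSize t₁ t₂ n p (g + 2) ≤ groupSum t₁ t₂ n (g + 2) := by
    unfold groupSize
    rw [if_neg (by omega)]
    split_ifs with hlt
    · exact le_rfl
    · have := (groupCount_spec hζ p).2
      rwa [show groupCount t₁ t₂ n p = g + 2 by omega] at this
  have h1 : (groupSize t₁ t₂ n p (g + 2) : ℝ) - groupSize t₁ t₂ n p (g + 1)
      ≤ A * (1 + ζ) ^ (g + 1) := by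
    have a1 : (groupSize t₁ t₂ n p (g + 2) : ℝ) ≤ groupSum t₁ t₂ n (g + 2) := by exact_mod_cast e2
    rw [groupSum_succ _ _ _ (show 1 ≤ g + 1 by omega)] at a1
    push_cast at a1
    have a2 := Nat.floor_le (show 0 ≤ A * (1 + ζ) ^ (g + 1) by positivity)
    rw [e1]
    linarith
  have h2 : A * (1 + ζ) ^ g - 1
      ≤ (groupSize t₁ t₂ n p (g + 1) : ℝ) - groupSize t₁ t₂ n p g := by
    rw [e1]
    rcases Nat.eq_zero_or_pos g with rfl | hg0
    · rw [groupSum_one]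
      simp [groupSize, hA, hζd]
    · have e3 : groupSize t₁ t₂ n p g = groupSum t₁ t₂ n g := by
        unfold groupSize
        rw [if_neg (by omega), if_pos (by omega)]
      rw [e3, groupSum_succ _ _ _ hg0]
      push_cast
      have := Nat.lt_floor_add_one (A * (1 + ζ) ^ g)
      linarith
  have h3 : 1 ≤ ζ * (A * (1 + ζ) ^ g) := by
    have := mul_le_mul_of_nonneg_left (inv_groupRate_le hζ g) hζ.le
    rwa [mul_inv_cancel₀ hζ.ne'] at this
  set x := A * (1 + ζ) ^ g with hx
  have h4 : A * (1 + ζ) ^ (g + 1) = (1 + ζ) * x := by rw [hx, pow_succ]; ring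
  rw [h4] at h1
  have hx0 : 0 ≤ x := by positivity
  have h5 := mul_le_mul_of_nonneg_right h hx0
  have h6 := mul_le_mul_of_nonneg_left h2 (show 0 ≤ 1 + r by linarith)
  have h7 := mul_nonneg (show 0 ≤ 1 + r by linarith) (sub_nonneg.2 h3)
  nlinarith

end Grouped

end ModelAvg

/-! ### Asymptotic optimality -/

namespace ModelAvg

theorem asympLE_of_forall {Q R : ℕ → ℝ} (hR : ∀ᶠ n in atTop, 0 < R n)
    (h : ∀ τ > 0, ∀ᶠ n in atTop, Q n ≤ (1 + τ) * R n) : AsympLE Q R := by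
  refine ⟨fun n => max (Q n / R n - 1) 0, ?_, ?_⟩
  · rw [Metric.tendsto_atTop']
    intro τ hτ
    obtain ⟨N, hN⟩ := eventually_atTop.1 (hR.and (h (τ / 2) (by positivity)))
    refine ⟨N, fun n hn => ?_⟩
    obtain ⟨h1, h2⟩ := hN n hn.le
    have h3 : Q n / R n ≤ 1 + τ / 2 := (div_le_iff₀ h1).2 h2
    rw [Real.dist_0_eq_abs, abs_of_nonneg (le_max_right _ _)]
    exact max_lt (by linarith) hτ
  · filter_upwards [hR] with n hn
    have h1 : Q n / R n ≤ 1 + max (Q n / R n - 1) 0 := by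
      linarith [le_max_left (Q n / R n - 1) 0]
    rwa [div_le_iff₀ hn] at h1

theorem eventually_le_of_isLittleO {g R : ℕ → ℝ} (h : g =o[atTop] R) (hR : ∀ n, 0 ≤ R n) {c : ℝ}
    (hc : 0 < c) : ∀ᶠ n in atTop, g n ≤ c * R n := by
  filter_upwards [h.def hc] with n hn
  rw [Real.norm_of_nonneg (hR n)] at hn
  exact (Real.le_norm_self _).trans hn

section Risk

variable {n p : ℕ} {Φ : Matrix (Fin n) (Fin p) ℝ} {Ω : Type*} [MeasurableSpace Ω]
  {μ : Measure Ω} {ε : Fin n → Ω → ℝ} {σ : ℝ} {η : ℝ≥0} {f : Fin n → ℝ}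
  {ι : Type*} [Fintype ι]

theorem maRisk_nonneg (𝓜 : ι → Finset (Fin p)) (w : ι → ℝ) : 0 ≤ maRisk μ Φ 𝓜 f ε w :=
  integral_nonneg fun _ => div_nonneg (Finset.sum_nonneg fun _ _ => sq_nonneg _) (Nat.cast_nonneg _)

theorem optRisk_nonneg (𝓜 : ι → Finset (Fin p)) : 0 ≤ optRisk μ Φ 𝓜 f ε :=
  Real.iInf_nonneg fun _ => maRisk_nonneg _ _

theorem optRisk_le (𝓜 : ι → Finset (Fin p)) {w : ι → ℝ} (hw : w ∈ stdSimplex ℝ ι) :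
    optRisk μ Φ 𝓜 f ε ≤ maRisk μ Φ 𝓜 f ε w :=
  ciInf_le ⟨0, by rintro _ ⟨w, rfl⟩; exact maRisk_nonneg _ _⟩ (⟨w, hw⟩ : stdSimplex ℝ ι)

/-- Push the weights forward along `𝓜`: a subset receives the total weight of the models equal to
it, and the averaged projection is unchanged. -/
theorem optRisk_allSubsets_le [Nonempty ι] (𝓜 : ι → Finset (Fin p)) :
    optRisk μ Φ (allSubsets p) f ε ≤ optRisk μ Φ 𝓜 f ε := by
  classical
  have : Nonempty (stdSimplex ℝ ι) := ⟨⟨_, single_mem_stdSimplex ℝ (Classical.arbitrary ι)⟩⟩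
  refine le_ciInf fun w => ?_
  set v : Finset (Fin p) → ℝ := fun I => ∑ m ∈ Finset.univ.filter (fun m => 𝓜 m = I), w.1 m with hv
  have hv1 : v ∈ stdSimplex ℝ (Finset (Fin p)) := by
    refine ⟨fun I => Finset.sum_nonneg fun m _ => w.2.1 m, ?_⟩
    rw [← w.2.2]
    exact Finset.sum_fiberwise Finset.univ 𝓜 w.1
  have hv2 : avgHatMatrix Φ (allSubsets p) v = avgHatMatrix Φ 𝓜 w := by
    simp only [avgHatMatrix, hv, allSubsets, id, Finset.sum_smul]
    refine Eq.trans ?_ (Finset.sum_fiberwise Finset.univ 𝓜 (fun m => w.1 m • hatMatrix Φ (𝓜 m)))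
    refine Finset.sum_congr rfl fun I _ => Finset.sum_congr rfl fun m hm => ?_
    rw [(Finset.mem_filter.1 hm).2]
  have hv3 : maRisk μ Φ (allSubsets p) f ε v = maRisk μ Φ 𝓜 f ε w := by
    simp only [maRisk, maLoss, hv2]
  exact hv3 ▸ optRisk_le _ hv1

theorem idealSeqRisk_le_optRisk [IsProbabilityMeasure μ] (hn : 1 ≤ n) (hΦ : Φᵀ * Φ = 1)
    (hf : f = Φ *ᵥ (Φᵀ *ᵥ f)) (hσ : 0 < σ) (hε : IsSubgaussianNoise μ ε σ η) :
    idealSeqRisk σ (Φᵀ *ᵥ f) ≤ n * optRisk μ Φ (allSubsets p) f ε := by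
  have hnR : (0 : ℝ) < n := by exact_mod_cast hn
  have : Nonempty (stdSimplex ℝ (Finset (Fin p))) := ⟨⟨_, single_mem_stdSimplex ℝ ∅⟩⟩
  rw [← div_le_iff₀' hnR]
  refine le_ciInf fun w => ?_
  rw [maRisk_eq hΦ hf hε]
  exact div_le_div_of_nonneg_right (idealSeqRisk_le hσ _ _) hnR.le

theorem seqRisk_bound_of_small {σ r z k d H R δ : ℝ} (hδ : 0 < δ) (hδ1 : δ ≤ 1 / 18)
    (hr : 0 ≤ r) (hrδ : r ≤ δ) (hz : 0 ≤ z) (hzδ : z ≤ δ) (hk : σ ^ 2 * k ≤ δ * R)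
    (hd : σ ^ 2 * d ≤ δ * R) (hH : H ≤ R) (hR : 0 ≤ R) :
    σ ^ 2 * k + (1 + r) * (σ ^ 2 * d + (1 + z) * H) ≤ (1 + 5 * δ) * R := by
  have h1 : (1 + z) * H ≤ (1 + δ) * R :=
    (mul_le_mul_of_nonneg_left hH (by linarith)).trans
      (mul_le_mul_of_nonneg_right (by linarith) hR)
  have h2 : (1 + r) * (σ ^ 2 * d + (1 + z) * H) ≤ (1 + δ) * (δ * R + (1 + δ) * R) :=
    (mul_le_mul_of_nonneg_left (add_le_add hd h1) (by linarith)).trans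
      (mul_le_mul_of_nonneg_right (by linarith) (by positivity))
  have h3 : δ * δ * R ≤ 1 / 18 * δ * R :=
    mul_le_mul_of_nonneg_right (mul_le_mul_of_nonneg_right hδ1 hδ.le) hR
  have h4 := mul_nonneg hδ.le hR
  nlinarith

/-- The bound `δ ≤ 1/18` keeps `1 - 9δ ≥ 1/2`. Dividing by `1 - 9δ` then gives `1 + 38δ` for the
risk, and multiplying by `1 + 5δ` leaves `1 + 55δ` for the loss. -/
theorem oracle_bound_of_small {ER EL R₀ R K δ : ℝ} (hδ : 0 < δ) (hδ1 : δ ≤ 1 / 18) (hR : 0 ≤ R)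
    (h₀ : R₀ ≤ (1 + 5 * δ) * R) (hK : K ≤ δ ^ 2 * R)
    (h1 : (1 - 9 * δ) * ER ≤ (1 + 2 * δ) * R₀ + 2 * K / δ)
    (h2 : EL ≤ (1 + 5 * δ) * ER + K / δ) :
    ER ≤ (1 + 55 * δ) * R ∧ EL ≤ (1 + 55 * δ) * R := by
  have hKδ : K / δ ≤ δ * R := by
    rw [div_le_iff₀ hδ]
    linarith
  have e : 2 * K / δ = 2 * (K / δ) := by ring
  rw [e] at h1
  have hR0 := mul_le_mul_of_nonneg_left h₀ (show 0 ≤ 1 + 2 * δ by linarith)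
  have hδR := mul_nonneg hδ.le hR
  have hδδR : δ * δ * R ≤ 1 / 18 * (δ * R) := by
    rw [mul_assoc]
    exact mul_le_mul_of_nonneg_right hδ1 hδR
  have h3 : (1 - 9 * δ) * ER ≤ (1 - 9 * δ) * ((1 + 38 * δ) * R) := by nlinarith
  have h4 : ER ≤ (1 + 38 * δ) * R := le_of_mul_le_mul_left h3 (by linarith)
  have h5 := mul_le_mul_of_nonneg_left h4 (show 0 ≤ 1 + 5 * δ by linarith)
  exact ⟨by linarith, by nlinarith⟩

end Risk

section Asymptotic

variable {Ω : Type*} [MeasurableSpace Ω] {μ : Measure Ω} {p : ℕ → ℕ}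
  {f : ∀ n, Fin n → ℝ} {ε : ∀ n, Fin n → Ω → ℝ} {σ : ℝ} {η : ℝ≥0}
  {Φ : ∀ n, Matrix (Fin n) (Fin (p n)) ℝ} {D : ℕ → ℕ} {d : ℕ → ℕ → ℕ} {z : ℕ → ℝ}
  {M : ℕ → ℕ} {k : ℕ → ℕ → ℕ}

/-- Since `d₁ ≥ 1`, the condition `d₁ = o(n R)` already excludes `R = 0`. -/
theorem eventually_optRisk_pos
    (hord : ∀ n, 1 ≤ n → WeaklyOrdered (transCoef (Φ n) (f n)) (D n) (d n) (z n))
    (hd : ∀ c > 0, ∀ᶠ n in atTop,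
      (d n 1 : ℝ) ≤ c * (n * optRisk μ (Φ n) (allSubsets (p n)) (f n) (ε n))) :
    ∀ᶠ n : ℕ in atTop, 0 < optRisk μ (Φ n) (allSubsets (p n)) (f n) (ε n) := by
  filter_upwards [hd 1 one_pos, eventually_ge_atTop 1] with n h1 hn
  have h2 : (1 : ℝ) ≤ d n 1 := by
    exact_mod_cast (hord n hn).isModelSizes.one_le le_rfl (hord n hn).pos
  refine (optRisk_nonneg _).lt_of_ne fun h => ?_
  rw [← h] at h1
  linarith

variable [IsProbabilityMeasure μ]

/-- Nested models with slowly growing sizes contain weights with nearly the ideal risk. -/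
theorem eventually_exists_weight (hσ : 0 < σ)
    (hε : ∀ n, 1 ≤ n → IsSubgaussianNoise μ (ε n) σ η)
    (hΦ : ∀ n, 1 ≤ n → (Φ n)ᵀ * Φ n = 1)
    (hf : ∀ n, 1 ≤ n → f n = Φ n *ᵥ ((Φ n)ᵀ *ᵥ f n))
    (hz : Tendsto z atTop (𝓝 0))
    (hord : ∀ n, 1 ≤ n → WeaklyOrdered (transCoef (Φ n) (f n)) (D n) (d n) (z n))
    (hk : ∀ᶠ n in atTop, IsModelSizes (p n) (M n) (k n))
    (hratio : ∀ r > 0, ∀ᶠ n in atTop, ∀ g, g + 2 ≤ M n →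
      (k n (g + 2) : ℝ) - k n (g + 1) ≤ (1 + r) * ((k n (g + 1) : ℝ) - k n g))
    (hd : ∀ c > 0, ∀ᶠ n in atTop,
      (d n 1 : ℝ) ≤ c * (n * optRisk μ (Φ n) (allSubsets (p n)) (f n) (ε n)))
    (hk1 : ∀ c > 0, ∀ᶠ n in atTop,
      (k n 1 : ℝ) ≤ c * (n * optRisk μ (Φ n) (allSubsets (p n)) (f n) (ε n)))
    {δ : ℝ} (hδ : 0 < δ) (hδ1 : δ ≤ 1 / 18) :
    ∀ᶠ n : ℕ in atTop, ∃ w ∈ stdSimplex ℝ (Fin (M n)),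
      seqRisk σ (shrinkage (nestedModels (p n) (M n) (k n)) w) ((Φ n)ᵀ *ᵥ f n)
        ≤ (1 + 5 * δ) * (n * optRisk μ (Φ n) (allSubsets (p n)) (f n) (ε n)) := by
  have hσ2 : 0 < σ ^ 2 := by positivity
  have hzδ : ∀ᶠ n in atTop, |z n| < δ := by
    have := hz.abs
    rw [abs_zero] at this
    exact this.eventually_lt_const hδ
  filter_upwards [hk, hratio δ hδ, hd (δ / σ ^ 2) (by positivity), hk1 (δ / σ ^ 2) (by positivity),
    hzδ, eventually_ge_atTop 1] with n h1 h2 h3 h4 h5 hn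
  have hnR : (0 : ℝ) < n := by exact_mod_cast hn
  obtain ⟨w, hw, hwR⟩ := (hord n hn).exists_weight (θ := (Φ n)ᵀ *ᵥ f n)
    (Real.sqrt_pos.2 hnR) h1 hσ hδ.le h2
  set R := (n : ℝ) * optRisk μ (Φ n) (allSubsets (p n)) (f n) (ε n) with hRdef
  have hR : 0 ≤ R := mul_nonneg hnR.le (optRisk_nonneg _)
  have hscale : ∀ x : ℝ, x ≤ δ / σ ^ 2 * R → σ ^ 2 * x ≤ δ * R := fun x hx => by
    have := mul_le_mul_of_nonneg_left hx hσ2.le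
    rwa [← mul_assoc, mul_div_cancel₀ _ hσ2.ne'] at this
  exact ⟨w, hw, hwR.trans (seqRisk_bound_of_small hδ hδ1 hδ.le le_rfl (abs_nonneg _) h5.le
    (hscale _ h4) (hscale _ h3)
    (idealSeqRisk_le_optRisk hn (hΦ n hn) (hf n hn) hσ (hε n hn)) hR)⟩

theorem optRisk_nested_isEquivalent (hσ : 0 < σ)
    (hε : ∀ n, 1 ≤ n → IsSubgaussianNoise μ (ε n) σ η)
    (hΦ : ∀ n, 1 ≤ n → (Φ n)ᵀ * Φ n = 1)
    (hf : ∀ n, 1 ≤ n → f n = Φ n *ᵥ ((Φ n)ᵀ *ᵥ f n))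
    (hz : Tendsto z atTop (𝓝 0))
    (hord : ∀ n, 1 ≤ n → WeaklyOrdered (transCoef (Φ n) (f n)) (D n) (d n) (z n))
    (hk : ∀ᶠ n in atTop, IsModelSizes (p n) (M n) (k n))
    (hratio : ∀ r > 0, ∀ᶠ n in atTop, ∀ g, g + 2 ≤ M n →
      (k n (g + 2) : ℝ) - k n (g + 1) ≤ (1 + r) * ((k n (g + 1) : ℝ) - k n g))
    (hd : ∀ c > 0, ∀ᶠ n in atTop,
      (d n 1 : ℝ) ≤ c * (n * optRisk μ (Φ n) (allSubsets (p n)) (f n) (ε n)))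
    (hk1 : ∀ c > 0, ∀ᶠ n in atTop,
      (k n 1 : ℝ) ≤ c * (n * optRisk μ (Φ n) (allSubsets (p n)) (f n) (ε n))) :
    (fun n => optRisk μ (Φ n) (nestedModels (p n) (M n) (k n)) (f n) (ε n)) ~[atTop]
      (fun n => optRisk μ (Φ n) (allSubsets (p n)) (f n) (ε n)) := by
  rw [IsEquivalent, isLittleO_iff]
  intro c hc
  set δ := min (1 / 18) (c / 5) with hδdef
  have hδ : 0 < δ := lt_min (by norm_num) (by positivity)
  filter_upwards [hk, eventually_exists_weight hσ hε hΦ hf hz hord hk hratio hd hk1 hδ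
    (min_le_left _ _), eventually_ge_atTop 1] with n h1 ⟨w, hw, hwR⟩ hn
  have hnR : (0 : ℝ) < n := by exact_mod_cast hn
  have : Nonempty (Fin (M n)) := ⟨⟨0, h1.pos⟩⟩
  have hlow : optRisk μ (Φ n) (allSubsets (p n)) (f n) (ε n)
      ≤ optRisk μ (Φ n) (nestedModels (p n) (M n) (k n)) (f n) (ε n) := optRisk_allSubsets_le _
  have hup : optRisk μ (Φ n) (nestedModels (p n) (M n) (k n)) (f n) (ε n)
      ≤ (1 + 5 * δ) * optRisk μ (Φ n) (allSubsets (p n)) (f n) (ε n) := by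
    refine (optRisk_le _ hw).trans ?_
    rw [maRisk_eq (hΦ n hn) (hf n hn) (hε n hn), div_le_iff₀ hnR]
    linarith
  have h0 : 0 ≤ optRisk μ (Φ n) (allSubsets (p n)) (f n) (ε n) := optRisk_nonneg _
  have hδc : 5 * δ ≤ c := by linarith [min_le_right (1 / 18) (c / 5)]
  rw [Pi.sub_apply, Real.norm_of_nonneg h0, Real.norm_of_nonneg (sub_nonneg.2 hlow)]
  have := mul_le_mul_of_nonneg_right hδc h0
  linarith

theorem achievesIdealAOP_nested (hσ : 0 < σ)
    (hε : ∀ n, 1 ≤ n → IsSubgaussianNoise μ (ε n) σ η)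
    (hΦ : ∀ n, 1 ≤ n → (Φ n)ᵀ * Φ n = 1)
    (hf : ∀ n, 1 ≤ n → f n = Φ n *ᵥ ((Φ n)ᵀ *ᵥ f n))
    (hz : Tendsto z atTop (𝓝 0))
    (hord : ∀ n, 1 ≤ n → WeaklyOrdered (transCoef (Φ n) (f n)) (D n) (d n) (z n))
    (hk : ∀ᶠ n in atTop, IsModelSizes (p n) (M n) (k n))
    (hratio : ∀ r > 0, ∀ᶠ n in atTop, ∀ g, g + 2 ≤ M n →
      (k n (g + 2) : ℝ) - k n (g + 1) ≤ (1 + r) * ((k n (g + 1) : ℝ) - k n g))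
    (hd : ∀ c > 0, ∀ᶠ n in atTop,
      (d n 1 : ℝ) ≤ c * (n * optRisk μ (Φ n) (allSubsets (p n)) (f n) (ε n)))
    (hk1 : ∀ c > 0, ∀ᶠ n in atTop,
      (k n 1 : ℝ) ≤ c * (n * optRisk μ (Φ n) (allSubsets (p n)) (f n) (ε n)))
    (hψ : ∀ c > 0, ∀ᶠ n in atTop, psi (transCoef (Φ n) (f n)) (M n) (k n)
      ≤ c * (n * optRisk μ (Φ n) (allSubsets (p n)) (f n) (ε n)))
    {s : ∀ _ : ℕ, Ω → ℝ} (hs : ∀ᶠ n in atTop, Integrable (fun ω => (s n ω - σ ^ 2) ^ 2) μ)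
    (hs0 : ∀ c > 0, ∀ᶠ n in atTop, (p n : ℝ) * ∫ ω, (s n ω - σ ^ 2) ^ 2 ∂μ
      ≤ c * (n * optRisk μ (Φ n) (allSubsets (p n)) (f n) (ε n)))
    {w : ∀ n, Ω → Fin (M n) → ℝ}
    (hw : ∀ᶠ n in atTop,
      IsMMAWeight (Φ n) (nestedModels (p n) (M n) (k n)) (f n) (ε n) (s n) (w n)) :
    AchievesIdealAOP μ Φ (fun n => nestedModels (p n) (M n) (k n)) f ε σ w := by
  have hσ2 : 0 < σ ^ 2 := by positivity
  have hbound : ∀ τ > 0, ∀ᶠ n in atTop,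
      ∫ ω, plugInRisk (Φ n) (nestedModels (p n) (M n) (k n)) (f n) σ (w n ω) ∂μ
        ≤ (1 + τ) * optRisk μ (Φ n) (allSubsets (p n)) (f n) (ε n) ∧
      ∫ ω, maLoss (Φ n) (nestedModels (p n) (M n) (k n)) (f n) (ε n) (w n ω) ω ∂μ
        ≤ (1 + τ) * optRisk μ (Φ n) (allSubsets (p n)) (f n) (ε n) := by
    intro τ hτ
    set δ := min (1 / 18) (τ / 55) with hδdef
    have hδ : 0 < δ := lt_min (by norm_num) (by positivity)
    have hδτ : 55 * δ ≤ τ := by linarith [min_le_right (1 / 18) (τ / 55)]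
    have hA : 0 < remainderConst σ η := by unfold remainderConst; positivity
    filter_upwards [hk, eventually_exists_weight hσ hε hΦ hf hz hord hk hratio hd hk1 hδ
      (min_le_left _ _), hψ (δ ^ 2 / 2 / remainderConst σ η) (by positivity), hs,
      hs0 (δ ^ 2 / 2 * σ ^ 2) (by positivity), hw, eventually_ge_atTop 1]
      with n h1 ⟨w₀, hw₀, hwR⟩ h2 h3 h4 h5 hn
    have hnR : (0 : ℝ) < n := by exact_mod_cast hn
    set R := (n : ℝ) * optRisk μ (Φ n) (allSubsets (p n)) (f n) (ε n) with hRdef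
    have hR : 0 ≤ R := mul_nonneg hnR.le (optRisk_nonneg _)
    have hpsi : psi (transCoef (Φ n) (f n)) (M n) (k n) = psi ((Φ n)ᵀ *ᵥ f n) (M n) (k n) :=
      psi_div _ (Real.sqrt_pos.2 hnR).ne' _ _
    rw [hpsi, div_mul_eq_mul_div, le_div_iff₀ hA] at h2
    have h6 : (p n : ℝ) * (∫ ω, (s n ω - σ ^ 2) ^ 2 ∂μ) / σ ^ 2 ≤ δ ^ 2 / 2 * R := by
      rw [div_le_iff₀ hσ2]
      linarith
    obtain ⟨o1, o2⟩ := nested_oracle_inequality (hΦ n hn) hn (hε n hn) hσ h1 h3 h5 hw₀ hδ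
      -- The oracle remainder is `K / δ`, so `K` must be of order `δ²`; the complexity and the
      -- variance estimator take half each.
      (K := δ ^ 2 * R) (by linarith)
    obtain ⟨b1, b2⟩ := oracle_bound_of_small hδ (min_le_left _ _) hR hwR le_rfl o1 o2
    have hfin : ∀ x : ℝ, x ≤ (1 + 55 * δ) * R →
        x / n ≤ (1 + τ) * optRisk μ (Φ n) (allSubsets (p n)) (f n) (ε n) := fun x hx => by
      rw [div_le_iff₀ hnR]
      have := mul_le_mul_of_nonneg_right hδτ hR
      calc x ≤ (1 + τ) * R := by linarith
        _ = _ := by rw [hRdef]; ring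
    constructor
    · simp only [plugInRisk_eq (hΦ n hn) (hf n hn), integral_div]
      exact hfin _ b1
    · simp only [maLoss_eq (hΦ n hn) (hf n hn), integral_div]
      exact hfin _ b2
  have hpos := eventually_optRisk_pos hord hd
  refine ⟨?_, asympLE_of_forall hpos fun τ hτ => (hbound τ hτ).mono fun _ h => h.2,
    asympLE_of_forall hpos fun τ hτ => (hbound τ hτ).mono fun _ h => h.1⟩
  filter_upwards [hw, eventually_ge_atTop 1] with n h5 hn
  simp only [plugInRisk_eq (hΦ n hn) (hf n hn), maLoss_eq (hΦ n hn) (hf n hn)]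
  exact ⟨(integrable_seqLoss (hε n hn) _ _ h5.measurable h5.mem_simplex).div_const _,
    (integrable_seqRisk _ _ _ h5.measurable h5.mem_simplex).div_const _⟩

end Asymptotic

theorem tendsto_groupRate (t₁ : ℝ) {t₂ : ℝ} (ht₂ : 0 < t₂) :
    Tendsto (groupRate t₁ t₂) atTop (𝓝 0) :=
  Tendsto.const_div_atTop ((tendsto_rpow_atTop ht₂).comp
    (Real.tendsto_log_atTop.comp tendsto_natCast_atTop_atTop)) _

theorem eventually_groupSize_ratio_le {t₁ t₂ : ℝ} (ht₁ : 0 < t₁) (ht₂ : 0 < t₂) (p : ℕ → ℕ)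
    {r : ℝ} (hr : 0 < r) :
    ∀ᶠ n in atTop, ∀ g, g + 2 ≤ groupCount t₁ t₂ n (p n) →
      (groupSize t₁ t₂ n (p n) (g + 2) : ℝ) - groupSize t₁ t₂ n (p n) (g + 1)
        ≤ (1 + r) * ((groupSize t₁ t₂ n (p n) (g + 1) : ℝ) - groupSize t₁ t₂ n (p n) g) := by
  -- The threshold at which `1 + ζ ≤ (1 + r) (1 - ζ)` becomes an equality.
  have hc : (0 : ℝ) < r / (2 + r) := by positivity
  filter_upwards [(tendsto_groupRate t₁ ht₂).eventually_lt_const hc, eventually_ge_atTop 2]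
    with n h1 hn g hg
  have h2 : groupRate t₁ t₂ n * (2 + r) < r := (lt_div_iff₀ (by linarith)).1 h1
  have h3 : r / (2 + r) < 1 := (div_lt_one (by linarith)).2 (by linarith)
  exact groupSize_ratio_le (groupRate_pos ht₁ hn) hr.le (h1.trans h3) (by linarith) hg

end ModelAvg

/-! ### The main theorem -/

theorem theorem6 {Ω : Type*} [MeasurableSpace Ω] (μ : Measure Ω) [IsProbabilityMeasure μ]
    -- the regression model `y = f + ε`, `f = X β`
    (p : ℕ → ℕ) (X : ∀ n, Matrix (Fin n) (Fin (p n)) ℝ) (β : ∀ n, Fin (p n) → ℝ)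
    (f : ∀ n, Fin n → ℝ) (ε : ∀ n, Fin n → Ω → ℝ) (σ : ℝ) (η : ℝ≥0)
    (hX : ∀ n, 1 ≤ n → p n ≤ n ∧ (X n).rank = p n)
    (hf : ∀ n, f n = X n *ᵥ β n)
    (hσ : 0 < σ)
    (hε : ∀ n, 1 ≤ n → IsSubgaussianNoise μ (ε n) σ η)
    -- an orthonormal basis of the column space of `X`
    (Φ : ∀ n, Matrix (Fin n) (Fin (p n)) ℝ)
    (hΦ : ∀ n, 1 ≤ n → IsOrthonormalBasisOfColumns (Φ n) (X n))
    -- `limsup n⁻¹ ‖f‖² < ∞`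
    (hbdd : IsBoundedUnder (· ≤ ·) atTop (fun n : ℕ => sqNorm (f n) / n))
    -- weakly ordered coefficients
    (D : ℕ → ℕ) (d : ℕ → ℕ → ℕ) (z : ℕ → ℝ) (hz : Tendsto z atTop (𝓝 0))
    (hord : ∀ n, 1 ≤ n → WeaklyOrdered (transCoef (Φ n) (f n)) (D n) (d n) (z n)) :
    -- equivalence of the optimal nested MA risk and the ideal MA risk
    ((fun n => (d n 1 : ℝ)) =o[atTop]
        (fun n : ℕ => n * optRisk μ (Φ n) (allSubsets (p n)) (f n) (ε n)) →
      (fun n => optRisk μ (Φ n) (allNested (p n)) (f n) (ε n)) ~[atTop]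
        (fun n => optRisk μ (Φ n) (allSubsets (p n)) (f n) (ε n))) ∧
    -- MMA on the nested or grouped models, with a variance estimator `s`
    (∀ s : ∀ n : ℕ, Ω → ℝ, (∀ n, 1 ≤ n → Measurable (s n)) →
      (∀ᶠ n in atTop, Integrable (fun ω => (s n ω - σ ^ 2) ^ 2) μ) →
      (fun n => (p n : ℝ) * ∫ ω, (s n ω - σ ^ 2) ^ 2 ∂μ) =o[atTop]
        (fun n : ℕ => n * optRisk μ (Φ n) (allSubsets (p n)) (f n) (ε n)) →
      (∀ w : ∀ n, Ω → Fin (p n) → ℝ,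
        (∀ n, 1 ≤ n → IsMMAWeight (Φ n) (allNested (p n)) (f n) (ε n) (s n) (w n)) →
        (fun n => max (d n 1 : ℝ) (psi (transCoef (Φ n) (f n)) (p n) id)) =o[atTop]
          (fun n : ℕ => n * optRisk μ (Φ n) (allSubsets (p n)) (f n) (ε n)) →
        AchievesIdealAOP μ Φ (fun n => allNested (p n)) f ε σ w) ∧
      (∀ t₁ t₂ : ℝ, 0 < t₁ → 0 < t₂ →
        ∀ w : ∀ n, Ω → Fin (groupCount t₁ t₂ n (p n)) → ℝ,
        (∀ n, 2 ≤ n →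
          IsMMAWeight (Φ n) (groupedModels t₁ t₂ n (p n)) (f n) (ε n) (s n) (w n)) →
        (fun n => max (max (d n 1 : ℝ) (groupSize t₁ t₂ n (p n) 1))
            (psi (transCoef (Φ n) (f n)) (groupCount t₁ t₂ n (p n))
              (groupSize t₁ t₂ n (p n)))) =o[atTop]
          (fun n : ℕ => n * optRisk μ (Φ n) (allSubsets (p n)) (f n) (ε n)) →
        AchievesIdealAOP μ Φ (fun n => groupedModels t₁ t₂ n (p n)) f ε σ w)) := by
  have hΦ' : ∀ n, 1 ≤ n → (Φ n)ᵀ * Φ n = 1 := fun n hn => (hΦ n hn).orthonormal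
  have hf' : ∀ n, 1 ≤ n → f n = Φ n *ᵥ ((Φ n)ᵀ *ᵥ f n) := fun n hn => by
    rw [hf n]
    exact eq_mulVec_of_mem_columns (hΦ n hn) (β n)
  have hp : ∀ n, 1 ≤ n → 1 ≤ p n := fun n hn =>
    (hord n hn).isModelSizes.last ▸ (hord n hn).isModelSizes.one_le (hord n hn).pos le_rfl
  have hR : ∀ n : ℕ, 0 ≤ (n : ℝ) * optRisk μ (Φ n) (allSubsets (p n)) (f n) (ε n) :=
    fun n => mul_nonneg (Nat.cast_nonneg _) (optRisk_nonneg _)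
  have hd1 : ∀ n, 1 ≤ n → (1 : ℝ) ≤ d n 1 := fun n hn => by
    exact_mod_cast (hord n hn).isModelSizes.one_le le_rfl (hord n hn).pos
  have hkA : ∀ᶠ n in atTop, IsModelSizes (p n) (p n) id :=
    (eventually_ge_atTop 1).mono fun n hn => isModelSizes_id (hp n hn)
  have hratioA : ∀ r : ℝ, r > 0 → ∀ᶠ n : ℕ in atTop, ∀ g, g + 2 ≤ p n →
      ((id (g + 2) : ℕ) : ℝ) - (id (g + 1) : ℕ) ≤ (1 + r) * (((id (g + 1) : ℕ) : ℝ) - (id g : ℕ)) :=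
    fun r hr => Eventually.of_forall fun n g _ => by
      simp only [id]
      push_cast
      linarith
  -- The smallest model of the full nested family has size `1 ≤ d₁`, so its cost is covered by the
  -- condition on `d₁`.
  have hk1A : (∀ c > 0, ∀ᶠ n in atTop,
        (d n 1 : ℝ) ≤ c * (n * optRisk μ (Φ n) (allSubsets (p n)) (f n) (ε n))) →
      ∀ c > 0, ∀ᶠ n : ℕ in atTop,
        ((id 1 : ℕ) : ℝ) ≤ c * (n * optRisk μ (Φ n) (allSubsets (p n)) (f n) (ε n)) :=
    fun h c hc => by
      filter_upwards [h c hc, eventually_ge_atTop 1] with n h1 hn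
      simp only [id, Nat.cast_one]
      exact (hd1 n hn).trans h1
  refine ⟨fun h => ?_, fun s _ hs hs0 => ⟨fun w hw h => ?_, fun t₁ t₂ ht₁ ht₂ w hw h => ?_⟩⟩
  · have hd := fun c (hc : c > 0) => eventually_le_of_isLittleO h hR hc
    exact optRisk_nested_isEquivalent hσ hε hΦ' hf' hz hord hkA hratioA hd (hk1A hd)
  · have hmax := fun c (hc : c > 0) => eventually_le_of_isLittleO h hR hc
    have hd := fun c (hc : c > 0) => (hmax c hc).mono fun n => (le_max_left _ _).trans
    exact achievesIdealAOP_nested hσ hε hΦ' hf' hz hord hkA hratioA hd (hk1A hd)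
      (fun c hc => (hmax c hc).mono fun n => (le_max_right _ _).trans) hs
      (fun c hc => eventually_le_of_isLittleO hs0 hR hc)
      ((eventually_ge_atTop 1).mono fun n hn => hw n hn)
  · have hmax := fun c (hc : c > 0) => eventually_le_of_isLittleO h hR hc
    exact achievesIdealAOP_nested hσ hε hΦ' hf' hz hord
      (k := fun n => groupSize t₁ t₂ n (p n))
      ((eventually_ge_atTop 2).mono fun n hn =>
        isModelSizes_groupSize (groupRate_pos ht₁ hn) (hp n (by omega)))
      (fun r hr => eventually_groupSize_ratio_le ht₁ ht₂ p hr)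
      (fun c hc => (hmax c hc).mono fun n =>
        ((le_max_left _ _).trans (le_max_left _ _)).trans)
      (fun c hc => (hmax c hc).mono fun n =>
        ((le_max_right _ _).trans (le_max_left _ _)).trans)
      (fun c hc => (hmax c hc).mono fun n => (le_max_right _ _).trans) hs
      (fun c hc => eventually_le_of_isLittleO hs0 hR hc)
      ((eventually_ge_atTop 2).mono fun n hn => hw n hn)
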